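/- **Setting.** Let $\mathbb T^2=\mathbb R^2/\mathbb Z^2$, $T^*\mathbb T^2=\mathbb T^2\times\mathbb R^2$, $\widehat{\mathbb R}=\mathbb R\cup\{\pm\infty\}$, and let $V\in C^\infty(\mathbb T^2;\mathbb R)$. For small $\hbar>0$ let $\varepsilon_\hbar>0$ and $\tau_\hbar$ be such that $\varepsilon_\hbar\to0$, $\hbar\varepsilon_\hbar^{-1}\to0$ and $\tau_\hbar\to+\infty$ as $\hbar\to0^+$. Let $\Lambda\subset\mathbb Z^2$ be a primitive sublattice of rank $1$ (its real span $\langle\Lambda\rangle$ is a line and $\langle\Lambda\rangle\cap\mathbb Z^2=\Lambda$), let $\mathfrak e_\Lambda$ be a generator of $\Lambda$, $H_\Lambda(\xi)=\langle\xi,\mathfrak e_\Lambda\rangle/\|\mathfrak e_\Lambda\|$ and $\Lambda^\perp=\{\xi\in\mathbb R^2:\langle\xi,\mathfrak e_\Lambda\rangle=0\}$. Let $C_c^\infty(T^*\mathbb T^2\times\widehat{\mathbb R})$ be the space of compactly supported continuous functions $a:T^*\mathbb T^2\times\widehat{\mathbb R}\to\mathbb C$ that are smooth on $T^*\mathbb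 T^2\times\mathbb R$ and all of whose partial derivatives in $(x,\xi,\eta)$ extend continuously to $T^*\mathbb T^2\times\widehat{\mathbb R}$. Let $\mathcal B=C_0(\mathbb R^2\times\widehat{\mathbb R},C^3(\mathbb T^2))$, the Banach space of continuous $C^3(\mathbb T^2)$-valued functions of $(\xi,\eta)$ vanishing at infinity. For a smooth compactly supported symbol $b$ on $T^*\mathbb T^2$ let $$\operatorname{Op}^w_\hbar(b)u(x)=\frac1{(2\pi\hbar)^2}\int_{\mathbb R^2}\Big(\int_{\mathbb R^2}e^{\frac i\hbar\langle x-y,\xi\rangle}\,b\Big(\frac{x+y}2,\xi\Big)\,d\xi\Big)u(y)\,dy,\qquad u\in L^2(\mathbb T^2),$$ where functions on $\mathbb T^2$ are viewed as periodic functions on $\mathbb R^2$. Let $\mathcal M_\Lambda(\tau,\varepsilon)$ be the set of all $\mu_\Lambda\in L^1(\mathbb R,\mathcal B)'$ (i.e. essentially bounded weakly-$*$ measurable families $t\mapsto\mu_\Lambda(t)\in\mathcal B'$) for which there are a sequence $\hbar_n\to0^+$ and $u_n\in L^2(\mathbb T^2)$ with $\|u_n\|_{L^2}=1$, $$\lim_{R\to\infty}\limsup_{n\to\infty}\big\|\mathbf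 1_{[R,\infty)}(-\hbar_n^2\Delta)u_n\big\|_{L^2}=0,\qquad \lim_{\delta\to0^+}\limsup_{n\to\infty}\big\|\mathbf 1_{[0,\delta]}(-\hbar_n^2\Delta)u_n\big\|_{L^2}=0,$$ such that, if $v_n$ denotes the solution of $$i\hbar_n\partial_tv_n=-\frac{\hbar_n^2}2\Delta v_n+\varepsilon_{\hbar_n}^2Vv_n,\qquad v_n(0)=u_n,$$ then, for all $a\in C_c^\infty(T^*\mathbb T^2\times\widehat{\mathbb R})$ and $\theta\in L^1(\mathbb R)$, $$\lim_{n\to\infty}\int_{\mathbb R}\theta(t)\Big\langle v_n(t\tau_{\hbar_n}),\operatorname{Op}^w_{\hbar_n}\Big(a\Big(x,\xi,\frac{H_\Lambda(\xi)}{\varepsilon_{\hbar_n}}\Big)\Big)v_n(t\tau_{\hbar_n})\Big\rangle_{L^2(\mathbb T^2)}dt=\int_{\mathbb R}\theta(t)\,\langle\mu_\Lambda(t),a\rangle\,dt.$$ **Proposition 2.1.** Let $\mu_\Lambda\in\mathcal M_\Lambda(\tau,\varepsilon)$. Then, for a.e. $t\in\mathbb R$, $\mu_\Lambda(t)$ is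 a finite positive Radon measure on $T^*\mathbb T^2\times\widehat{\mathbb R}$ that is concentrated on $\{\xi\neq0\}$, i.e. $\mu_\Lambda(t)(\{\xi=0\})=0$. Moreover, for a.e. $t$, let $$\tilde\mu_\Lambda(t)=\mu_\Lambda(t)\rceil_{T^*\mathbb T^2\times\mathbb R},\qquad\tilde\mu^\Lambda(t)=\mu_\Lambda(t)\rceil_{T^*\mathbb T^2\times\{\pm\infty\}},$$ so that $\mu_\Lambda(t)=\tilde\mu_\Lambda(t)+\tilde\mu^\Lambda(t)$. Then: 1. the finite positive measure $\tilde\mu_\Lambda(t)$ is concentrated on $\mathbb T^2\times(\Lambda^\perp\setminus\{0\})\times\mathbb R$, i.e. the complement of this set is $\tilde\mu_\Lambda(t)$-null, and its closed support lies in $\{\xi\in\Lambda^\perp\}$; 2. for every $a\in C_c^\infty(T^*\mathbb T^2\times\widehat{\mathbb R})$, $$\langle\tilde\mu_\Lambda(t),\xi\cdot\partial_xa\rangle=\langle\tilde\mu^\Lambda(t),\xi\cdot\partial_xa\rangle=0.$$ -/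

import Mathlib

open scoped ContDiff
open MeasureTheory Filter Topology Set

noncomputable section

namespace TwoMicrolocal

/-- The Euclidean plane. -/
abbrev Plane : Type := EuclideanSpace ℝ (Fin 2)

/-- The torus `ℝ² / ℤ²`. -/
abbrev Torus : Type := UnitAddTorus (Fin 2)

/-- The canonical projection `ℝ² → ℝ² / ℤ²`. -/
def toTorus (x : Plane) : Torus := fun i => ((x i : ℝ) : UnitAddCircle)

/-- The Lebesgue measure `dx` on the torus (of total mass one). -/
def torusMeasure : Measure Torus := Measure.pi fun _ => AddCircle.haarAddCircle

/-- `L²` of the torus. -/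
abbrev L2 : Type := Lp ℂ 2 torusMeasure

/-- A function on the torus is smooth if its periodic lift to the plane is smooth. -/
def SmoothOnTorus (φ : Torus → ℂ) : Prop := ContDiff ℝ ∞ fun x : Plane => φ (toTorus x)

/-- The Laplacian `∂₁² + ∂₂²` of a function on the torus. -/
def torusLaplacian (φ : Torus → ℂ) (x : Torus) : ℂ :=
  Laplacian.laplacian (fun y : Plane => φ (x + toTorus y)) 0

/-! ### The Schrödinger equation -/

/-- `P φ = -(ħ²/2) Δ φ + ε² V φ`, for smooth `φ`. -/
def schrodingerOp (ħ ε : ℝ) (V : Torus → ℝ) (φ : Torus → ℂ) (x : Torus) : ℂ :=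
  -((ħ : ℂ) ^ 2 / 2) * torusLaplacian φ x + (ε : ℂ) ^ 2 * (V x : ℂ) * φ x

/-- `v` is the solution in `C(ℝ; L²)` of `i ħ ∂ₜ v = P v`, `v(0) = u`, where the equation is
understood weakly in space: `i ħ (d/dt) ∫ φ v(t) dx = ∫ (P φ) v(t) dx` for all smooth `φ`. -/
structure IsSchrodingerSolution (ħ ε : ℝ) (V : Torus → ℝ) (u : L2) (v : ℝ → L2) : Prop where
  initial : v 0 = u
  continuous : Continuous v
  equation : ∀ φ : Torus → ℂ, SmoothOnTorus φ → ∀ t : ℝ,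
    HasDerivAt (fun s : ℝ => Complex.I * (ħ : ℂ) * ∫ x, φ x * v s x ∂torusMeasure)
      (∫ x, schrodingerOp ħ ε V φ x * v t x ∂torusMeasure) t

/-- The spectral projection `1_I(-ħ² Δ) u`: as `-ħ² Δ` multiplies the exponential
`exp(2 i π k·x)` by `4 π² ħ² |k|²`, it keeps the Fourier modes with `4 π² ħ² |k|² ∈ I`. -/
def spectralProj (I : Set ℝ) (ħ : ℝ) (u : L2) : L2 :=
  ∑' k : Fin 2 → ℤ,
    {k : Fin 2 → ℤ | 4 * Real.pi ^ 2 * ħ ^ 2 * ((k 0 : ℝ) ^ 2 + (k 1 : ℝ) ^ 2) ∈ I}.indicator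
      (fun k => UnitAddTorus.mFourierCoeff u k • (UnitAddTorus.mFourierLp 2 k : L2)) k

/-- No mass escapes to frequencies much larger than `1/ħ`. -/
def IsHOscillating (h : ℕ → ℝ) (u : ℕ → L2) : Prop :=
  Tendsto (fun R : ℝ => limsup (fun n => ‖spectralProj (Ici R) (h n) (u n)‖) atTop) atTop (𝓝 0)

/-- No mass concentrates at frequencies much smaller than `1/ħ`. -/
def IsStrictlyHOscillating (h : ℕ → ℝ) (u : ℕ → L2) : Prop :=
  Tendsto (fun δ : ℝ => limsup (fun n => ‖spectralProj (Icc 0 δ) (h n) (u n)‖) atTop)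
    (𝓝[>] 0) (𝓝 0)

/-! ### Weyl quantization -/

/-- The Weyl quantization of a symbol `b(x, ξ)`, smooth on `T*𝕋²` and compactly supported,
acting on functions on the torus:
`(2πħ)⁻² ∫_{y ∈ ℝ²} ∫_{ξ ∈ ℝ²} exp((i/ħ) ⟨x - y, ξ⟩) b((x + y)/2, ξ) u(y) dξ dy`,
written with `z = x - y`, so that `(x + y)/2 = x - z/2`; for such symbols the inner integral
is rapidly decaying in `z`. -/
def weyl (ħ : ℝ) (b : Torus → Plane → ℂ) (u : Torus → ℂ) (x : Torus) : ℂ :=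
  (((2 * Real.pi * ħ) ^ 2 : ℝ) : ℂ)⁻¹ *
    ∫ z : Plane, (∫ ξ : Plane,
        Complex.exp (Complex.I * ((inner ℝ z ξ / ħ : ℝ) : ℂ)) *
          b (x - toTorus ((2⁻¹ : ℝ) • z)) ξ) *
      u (x - toTorus z)

/-- `⟨u, Op(b) u⟩` in `L²` of the torus. -/
def wigner (ħ : ℝ) (b : Torus → Plane → ℂ) (u : L2) : ℂ :=
  ∫ x, (starRingEnd ℂ) (u x) * weyl ħ b u x ∂torusMeasure

/-! ### Sublattices -/

/-- A lattice vector seen in the plane. -/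
def latticeVec (k : Fin 2 → ℤ) : Plane := WithLp.toLp 2 fun i => (k i : ℝ)

/-- The linear span in the plane of a sublattice of `ℤ²`. -/
def latticeSpan (Λ : AddSubgroup (Fin 2 → ℤ)) : Submodule ℝ Plane :=
  Submodule.span ℝ (latticeVec '' (Λ : Set (Fin 2 → ℤ)))

/-- Primitive sublattices of rank one: `dim ⟨Λ⟩ = 1` and `⟨Λ⟩ ∩ ℤ² = Λ`. -/
structure IsPrimitiveRankOne (Λ : AddSubgroup (Fin 2 → ℤ)) : Prop where
  rank_one : Module.finrank ℝ (latticeSpan Λ) = 1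
  primitive : ∀ k : Fin 2 → ℤ, latticeVec k ∈ latticeSpan Λ ↔ k ∈ Λ

/-- `H_Λ(ξ) = ⟨ξ, 𝔢⟩ / ‖𝔢‖`, for a generator `𝔢` of `Λ`. -/
def hamiltonian (e : Fin 2 → ℤ) (ξ : Plane) : ℝ := inner ℝ ξ (latticeVec e) / ‖latticeVec e‖

/-- `Λ^⊥`, the covectors orthogonal to (all of) `Λ`. -/
def latticePerp (Λ : AddSubgroup (Fin 2 → ℤ)) : Set Plane :=
  {ξ | ∀ k ∈ Λ, inner ℝ ξ (latticeVec k) = 0}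

/-! ### Test functions on `T*𝕋² × [-∞, +∞]` -/

/-- `T*𝕋² × [-∞, +∞]`, with points `(x, ξ, η)`. -/
abbrev Phase : Type := Torus × Plane × EReal

/-- The periodic lift of a function on `T*𝕋² × [-∞, +∞]`, restricted to finite `η`. -/
def lift (a : Phase → ℂ) (q : Plane × Plane × ℝ) : ℂ :=
  a (toTorus q.1, q.2.1, (q.2.2 : EReal))

/-- `a` is in `C^∞` of `T*𝕋² × [-∞, +∞]`: it is continuous, smooth for finite `η`, and all its
partial derivatives in `(x, ξ, η)` extend continuously to `η = ±∞`. -/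
structure SmoothOnPhase (a : Phase → ℂ) : Prop where
  continuous : Continuous a
  contDiff : ContDiff ℝ ∞ (lift a)
  extends_ : ∀ j : ℕ,
    ∃ g : Plane × Plane × EReal →
        ContinuousMultilinearMap ℝ (fun _ : Fin j => Plane × Plane × ℝ) ℂ,
      Continuous g ∧ ∀ (x ξ : Plane) (η : ℝ),
        g (x, ξ, (η : EReal)) = iteratedFDeriv ℝ j (lift a) (x, ξ, η)

/-- The space `C_c^∞(T*𝕋² × [-∞, +∞])` of test functions. -/
def testFunctions : Submodule ℂ (Phase → ℂ) where
  carrier := {a | SmoothOnPhase a ∧ HasCompactSupport a}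
  zero_mem' := by
    have h0 : lift 0 = fun _ => 0 := rfl
    refine ⟨⟨continuous_zero, ?_, fun j => ⟨fun _ => 0, continuous_const, fun x ξ η => ?_⟩⟩,
      HasCompactSupport.zero⟩
    · rw [h0]; exact contDiff_const
    · rw [h0]; simp
  add_mem' := by
    rintro a b ⟨ha, ha'⟩ ⟨hb, hb'⟩
    have hl : lift (a + b) = lift a + lift b := rfl
    refine ⟨⟨ha.continuous.add hb.continuous, ?_, fun j => ?_⟩, ha'.add hb'⟩
    · rw [hl]; exact ha.contDiff.add hb.contDiff
    · obtain ⟨f, hf, hfa⟩ := ha.extends_ j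
      obtain ⟨g, hg, hgb⟩ := hb.extends_ j
      refine ⟨fun p => f p + g p, hf.add hg, fun x ξ η => ?_⟩
      beta_reduce
      rw [hfa, hgb, hl, iteratedFDeriv_add_apply]
      · exact (ha.contDiff.of_le (by exact_mod_cast le_top)).contDiffAt
      · exact (hb.contDiff.of_le (by exact_mod_cast le_top)).contDiffAt
  smul_mem' := by
    rintro c a ⟨ha, ha'⟩
    have hl : lift (c • a) = c • lift a := rfl
    refine ⟨⟨ha.continuous.const_smul c, ?_, fun j => ?_⟩, ha'.smul_left (f := fun _ => c)⟩
    · rw [hl]; exact ha.contDiff.const_smul c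
    · obtain ⟨f, hf, hfa⟩ := ha.extends_ j
      refine ⟨fun p => c • f p, hf.const_smul c, fun x ξ η => ?_⟩
      beta_reduce
      rw [hfa, hl, iteratedFDeriv_const_smul_apply]
      exact (ha.contDiff.of_le (by exact_mod_cast le_top)).contDiffAt

/-- `ξ · ∂ₓ a`, the derivative of `a` along the geodesic flow `(x, ξ) ↦ (x + s ξ, ξ)`. -/
def geodesicDeriv (a : Phase → ℂ) (p : Phase) : ℂ :=
  fderiv ℝ (fun y : Plane => a (p.1 + toTorus y, p.2.1, p.2.2)) 0 p.2.1

/-- `‖a‖_𝓑 ≤ M`, where `𝓑 = C₀(ℝ² × [-∞, +∞], C³(𝕋²))`. -/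
def BNormLE (a : Phase → ℂ) (M : ℝ) : Prop :=
  ∀ j ≤ 3, ∀ (x ξ : Plane) (η : EReal),
    ‖iteratedFDeriv ℝ j (fun y : Plane => a (toTorus y, ξ, η)) x‖ ≤ M

/-- `μ` is an element of `L¹(ℝ, 𝓑)'`, i.e. a weakly-* measurable, essentially bounded family of
elements `μ(t)` of `𝓑'`. As the test functions are dense in `𝓑`, the elements of `𝓑'` are
the linear forms on test functions that are bounded for the norm of `𝓑`. -/
structure IsDualFamily (μ : ℝ → testFunctions →ₗ[ℂ] ℂ) : Prop where
  measurable : ∀ a : testFunctions, AEStronglyMeasurable (fun t => μ t a) volume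
  bounded : ∃ C : ℝ, ∀ᵐ t : ℝ, ∀ (a : testFunctions) (M : ℝ),
    BNormLE (a : Phase → ℂ) M → ‖μ t a‖ ≤ C * M

/-! ### Two-microlocal distributions and their limits -/

/-- The two-microlocal Wigner distribution `⟨v, Op_ħ(a(x, ξ, H_Λ(ξ)/ε)) v⟩`. -/
def twoMicrolocalWigner (e : Fin 2 → ℤ) (ħ ε : ℝ) (v : L2) (a : Phase → ℂ) : ℂ :=
  wigner ħ (fun x ξ => a (x, ξ, ((hamiltonian e ξ / ε : ℝ) : EReal))) v

/-- The set `𝓜_Λ(τ, ε)` of accumulation points of `t ↦ w_{Λ,ħ}(t τ_ħ)`, where `Λ = ℤ e`: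
limits along sequences `ħₙ → 0⁺`, for normalized initial data `uₙ` that oscillate at the
frequency `1/ħₙ`. -/
def accumulationPoints (V : Torus → ℝ) (e : Fin 2 → ℤ) (τ ε : ℝ → ℝ) :
    Set (ℝ → testFunctions →ₗ[ℂ] ℂ) :=
  {μ | IsDualFamily μ ∧
    ∃ (h : ℕ → ℝ) (u : ℕ → L2) (v : ℕ → ℝ → L2),
      (∀ n, 0 < h n) ∧ Tendsto h atTop (𝓝 0) ∧
      (∀ n, ‖u n‖ = 1) ∧ IsHOscillating h u ∧ IsStrictlyHOscillating h u ∧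
      (∀ n, IsSchrodingerSolution (h n) (ε (h n)) V (u n) (v n)) ∧
      ∀ (a : testFunctions) (θ : ℝ → ℂ), Integrable θ →
        Tendsto
          (fun n => ∫ t : ℝ,
            θ t * twoMicrolocalWigner e (h n) (ε (h n)) (v n (t * τ (h n))) (a : Phase → ℂ))
          atTop (𝓝 (∫ t : ℝ, θ t * μ t a))}

/-- The restriction of a measure to `T*𝕋² × ℝ`. -/
def finitePart (m : Measure Phase) : Measure Phase :=
  m.restrict {p | p.2.2 ≠ ⊥ ∧ p.2.2 ≠ ⊤}

/-- The restriction of a measure to `T*𝕋² × {±∞}`. -/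
def infinitePart (m : Measure Phase) : Measure Phase :=
  m.restrict {p | p.2.2 = ⊥ ∨ p.2.2 = ⊤}

end TwoMicrolocal

end

/-! Everything is done on Fourier coefficients. In the basis of exponentials the Weyl quantization
of `b` has matrix `b̂(m' - m, πħ(m + m'))` (`IsSymbol.weyl_matrix`), so each two-microlocal Wigner
distribution is a sesquilinear form whose kernel is dominated by a summable function of `m' - m`.
Schur's test then replaces pseudodifferential calculus, and all constants are uniform in `ħ` and
`ε`.

Invariance. Along the flow, the derivative of the form attached to `a` has two parts. The kinetic
part is exactly the form attached to `ξ·∂ₓa`, because the Weyl calculus is exact against a quadratic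
Hamiltonian (`energy_mul_symbolKernel`). The potential part is a commutator: shifting both indices
by `j` moves `ξ` by `2πħj` and `H_Λ(ξ)/ε` by at most `2πħ‖j‖/ε`, so by `norm_form_commutator_le` it
is `O(ε²(1 + 1/ε))` after division by `ħ`. Averaging over a time interval of length comparable to
`τ_ħ` leaves `O(1/τ_ħ + ε² + ε)`, which tends to `0` (`norm_integral_geodesicDeriv_le`).

Positivity. A nonnegative symbol is compared with an average, over boxes of frequencies, of
multiplications by nonnegative functions. The error is small once the box is large and then `ħ +
ħ/ε` is small (`exists_nonneg_near_twoMicrolocalWigner`).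

No mass at `ξ = 0`. The correlation `⟨v(s + ħσ), v(s)⟩` does not depend on `s`, and by Duhamel it is
the characteristic function of the kinetic energy distribution of `v(s)` up to `σ‖ε²V‖`. A Laplace
transform in `σ` turns this into a bound, uniform in time, of the low-energy mass of `v(s)` by that
of the initial datum (`IsFlow.low_energy_le`).

Localization. A symbol supported in `|H_Λ(ξ)| ≥ δ` and `|η| ≤ R` vanishes identically at `η =
H_Λ(ξ)/ε` once `εR < δ` (`SemiclassicalLimit.ae_eq_zero_of_vanishing`), so at finite `η` the limit
only sees `H_Λ(ξ) = 0`.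

These facts hold for each test function at almost every time. Separability for the norm of `𝓑` makes
the exceptional set of times independent of the test function (`IsDualFamily.ae_forall_mem`), and
the Riesz extension and representation theorems give the measure. Cutoffs in `η` commute with
`ξ·∂ₓ`, so the invariance passes separately to the parts at finite and infinite `η`. -/

noncomputable section

namespace TwoMicrolocal

open UnitAddTorus

/-! ### Sesquilinear forms with kernels dominated by a summable function of `m' - m` -/

section Forms

set_option linter.unusedSectionVars false

variable {G : Type} [AddCommGroup G]

/-- The sesquilinear form `∑ K(m, m') a(m) conj(b(m'))`. -/
def form (K : G → G → ℂ) (a b : G → ℂ) : ℂ :=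
  ∑' p : G × G, K p.1 p.2 * a p.1 * (starRingEnd ℂ) (b p.2)

/-- Domination of a kernel by a summable function of `m' - m`. -/
structure SchurBound (K : G → G → ℂ) (M : G → ℝ) : Prop where
  summable : Summable M
  le : ∀ m m', ‖K m m'‖ ≤ M (m' - m)

/-- Square-summability, with an explicit bound on the sum. -/
structure SqBound (a : G → ℂ) (A : ℝ) : Prop where
  summable : Summable fun m => ‖a m‖ ^ 2
  le : ∑' m, ‖a m‖ ^ 2 ≤ A

variable {K K' : G → G → ℂ} {M M' : G → ℝ} {a b : G → ℂ} {A B : ℝ}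

lemma SchurBound.nonneg (hK : SchurBound K M) (k : G) : 0 ≤ M k := by
  have := hK.le 0 k
  rw [sub_zero] at this
  exact (norm_nonneg _).trans this

lemma SchurBound.tsum_nonneg (hK : SchurBound K M) : 0 ≤ ∑' k, M k :=
  _root_.tsum_nonneg hK.nonneg

/-- The bijection `(m, m') ↦ (m' - m, m)` separates the variables and turns the sum into a product
of two sums. -/
lemma hasSum_shear_left (hM : Summable M) (h0 : ∀ k, 0 ≤ M k) {f : G → ℝ} (hf : Summable f)
    (hf0 : ∀ m, 0 ≤ f m) :
    HasSum (fun p : G × G => M (p.2 - p.1) * f p.1) ((∑' k, M k) * ∑' m, f m) := by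
  have h1 : HasSum (fun q : G × G => M q.1 * f q.2) ((∑' k, M k) * ∑' m, f m) :=
    hM.hasSum.mul hf.hasSum (hM.mul_of_nonneg hf h0 hf0)
  let e : G × G ≃ G × G :=
    { toFun := fun p => (p.2 - p.1, p.1)
      invFun := fun q => (q.2, q.1 + q.2)
      left_inv := fun p => by simp
      right_inv := fun q => by simp }
  exact (e.hasSum_iff (f := fun q : G × G => M q.1 * f q.2)).mpr h1

lemma hasSum_shear_right (hM : Summable M) (h0 : ∀ k, 0 ≤ M k) {f : G → ℝ} (hf : Summable f)
    (hf0 : ∀ m, 0 ≤ f m) :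
    HasSum (fun p : G × G => M (p.2 - p.1) * f p.2) ((∑' k, M k) * ∑' m, f m) := by
  have h1 : HasSum (fun q : G × G => M q.1 * f q.2) ((∑' k, M k) * ∑' m, f m) :=
    hM.hasSum.mul hf.hasSum (hM.mul_of_nonneg hf h0 hf0)
  let e : G × G ≃ G × G :=
    { toFun := fun p => (p.2 - p.1, p.2)
      invFun := fun q => (q.2 - q.1, q.2)
      left_inv := fun p => by simp
      right_inv := fun q => by simp }
  exact (e.hasSum_iff (f := fun q : G × G => M q.1 * f q.2)).mpr h1

lemma SchurBound.hasSum_majorant (hK : SchurBound K M) (ha : SqBound a A) (hb : SqBound b B) :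
    HasSum (fun p : G × G => M (p.2 - p.1) * ((‖a p.1‖ ^ 2 + ‖b p.2‖ ^ 2) / 2))
      ((∑' k, M k) * ((∑' m, ‖a m‖ ^ 2 + ∑' m, ‖b m‖ ^ 2) / 2)) := by
  have h1 := hasSum_shear_left hK.summable hK.nonneg ha.summable fun _ => sq_nonneg _
  have h2 := hasSum_shear_right hK.summable hK.nonneg hb.summable fun _ => sq_nonneg _
  convert! (h1.add h2).div_const 2 using 1
  · ext p; ring
  · ring

lemma SchurBound.term_le (hK : SchurBound K M) (p : G × G) :
    ‖K p.1 p.2 * a p.1 * (starRingEnd ℂ) (b p.2)‖ ≤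
      M (p.2 - p.1) * ((‖a p.1‖ ^ 2 + ‖b p.2‖ ^ 2) / 2) := by
  rw [norm_mul, norm_mul, RCLike.norm_conj, mul_assoc]
  refine mul_le_mul (hK.le _ _) ?_ (by positivity) (hK.nonneg _)
  nlinarith [sq_nonneg (‖a p.1‖ - ‖b p.2‖)]

lemma SchurBound.summable_norm (hK : SchurBound K M) (ha : SqBound a A) (hb : SqBound b B) :
    Summable fun p : G × G => ‖K p.1 p.2 * a p.1 * (starRingEnd ℂ) (b p.2)‖ :=
  Summable.of_nonneg_of_le (fun _ => norm_nonneg _) hK.term_le (hK.hasSum_majorant ha hb).summable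

lemma SchurBound.tsum_norm_le (hK : SchurBound K M) (ha : SqBound a A) (hb : SqBound b B) :
    ∑' p : G × G, ‖K p.1 p.2 * a p.1 * (starRingEnd ℂ) (b p.2)‖ ≤
      (∑' k, M k) * ((A + B) / 2) := by
  refine ((hK.summable_norm ha hb).tsum_le_tsum hK.term_le
    (hK.hasSum_majorant ha hb).summable).trans ?_
  rw [(hK.hasSum_majorant ha hb).tsum_eq]
  exact mul_le_mul_of_nonneg_left (by linarith [ha.le, hb.le]) hK.tsum_nonneg

lemma SchurBound.hasSum (hK : SchurBound K M) (ha : SqBound a A) (hb : SqBound b B) :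
    HasSum (fun p : G × G => K p.1 p.2 * a p.1 * (starRingEnd ℂ) (b p.2)) (form K a b) :=
  (hK.summable_norm ha hb).of_norm.hasSum

lemma SchurBound.norm_form_le (hK : SchurBound K M) (ha : SqBound a A) (hb : SqBound b B) :
    ‖form K a b‖ ≤ (∑' k, M k) * ((A + B) / 2) :=
  (norm_tsum_le_tsum_norm (hK.summable_norm ha hb)).trans (hK.tsum_norm_le ha hb)

lemma SchurBound.form_sub (hK : SchurBound K M) (hK' : SchurBound K' M') (ha : SqBound a A)
    (hb : SqBound b B) :
    form (fun m m' => K m m' - K' m m') a b = form K a b - form K' a b := by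
  rw [← ((hK.hasSum ha hb).sub (hK'.hasSum ha hb)).tsum_eq, form]
  congr 1; ext p; ring

/-- Square truncations suffice to recover the double series. This links the form to trigonometric
polynomials, and is how measurability in time, positivity and the identification with the Weyl
quantization are obtained. -/
lemma SchurBound.tendsto_finset (hK : SchurBound K M) (ha : SqBound a A) (hb : SqBound b B) :
    Tendsto (fun s : Finset G => ∑ m ∈ s, ∑ m' ∈ s, K m m' * a m * (starRingEnd ℂ) (b m')) atTop
      (𝓝 (form K a b)) := by
  have h := (hK.hasSum ha hb).comp tendsto_finsetProd_atTop
  have h2 : Tendsto (fun s : Finset G => (s, s)) atTop (atTop : Filter (Finset G × Finset G)) := by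
    rw [← prod_atTop_atTop_eq]
    exact tendsto_id.prodMk tendsto_id
  refine (h.comp h2).congr fun s => ?_
  simp [Finset.sum_product]

/-- The kernel of the identity. -/
def idKernel [DecidableEq G] (w : G → ℂ) (m m' : G) : ℂ := if m = m' then w m else 0

lemma schurBound_idKernel [DecidableEq G] {w : G → ℂ} {C : ℝ} (hw : ∀ m, ‖w m‖ ≤ C) :
    SchurBound (idKernel w) fun k => if k = 0 then C else 0 where
  summable := summable_of_ne_finset_zero (s := {0}) fun k hk => by
    rw [if_neg (by simpa using hk)]
  le m m' := by
    unfold idKernel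
    by_cases h : m = m'
    · simp [h, hw]
    · rw [if_neg h, if_neg (by rw [sub_eq_zero]; exact fun h' => h h'.symm), norm_zero]

lemma form_idKernel [DecidableEq G] {w : G → ℂ} :
    form (idKernel w) a b = ∑' m, w m * a m * (starRingEnd ℂ) (b m) := by
  let i : G → G × G := fun m => (m, m)
  have hi : Function.Injective i := fun m m' h => (Prod.mk.inj h).1
  rw [form, ← hi.tsum_eq]
  · simp [i, idKernel]
  · intro p hp
    by_contra h
    apply hp
    have : p.1 ≠ p.2 := fun h' => h ⟨p.1, by ext <;> simp [i, h']⟩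
    simp [idKernel, this]

lemma SqBound.mono (ha : SqBound a A) (h : A ≤ B) : SqBound a B := ⟨ha.summable, ha.le.trans h⟩

lemma SqBound.smul_le (ha : SqBound a A) (h : ∀ m, ‖b m‖ ≤ ‖a m‖) : SqBound b A := by
  have h' : ∀ m, ‖b m‖ ^ 2 ≤ ‖a m‖ ^ 2 := fun m => pow_le_pow_left₀ (norm_nonneg _) (h m) 2
  have hs := Summable.of_nonneg_of_le (fun m => sq_nonneg ‖b m‖) h' ha.summable
  exact ⟨hs, (hs.tsum_le_tsum h' ha.summable).trans ha.le⟩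

lemma SqBound.shift (ha : SqBound a A) (j : G) : SqBound (fun m => a (m + j)) A := by
  refine ⟨((Equiv.addRight j).summable_iff (f := fun m => ‖a m‖ ^ 2)).mpr ha.summable, ?_⟩
  exact ((Equiv.addRight j).tsum_eq (fun m => ‖a m‖ ^ 2)).trans_le ha.le

/-! ### Evolution of forms -/

/-- Each term `K(m, m') α(m) conj(β(m'))` has the derivative given by the product rule, the two
kinetic contributions combining into `E m - E m'`. The identity is proved in integrated form: the
fundamental theorem of calculus is applied to each term, and the sum is exchanged with the integral
thanks to the bound `D`, uniform in time, on the sum of the norms. The energies are unbounded, so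
the kernel multiplied by `E m - E m'` needs its own Schur bound. -/
lemma form_evolution [Countable G] {α β f g : ℝ → G → ℂ} {E : G → ℝ} {ħ s₁ s₂ C : ℝ} (hs : s₁ ≤ s₂)
    (hα : ∀ m s, HasDerivAt (fun s => α s m) ((E m * α s m + f s m) / (Complex.I * ħ)) s)
    (hβ : ∀ m s, HasDerivAt (fun s => β s m) ((E m * β s m + g s m) / (Complex.I * ħ)) s)
    (hf : ∀ m, Continuous fun s => f s m) (hg : ∀ m, Continuous fun s => g s m)
    (hαC : ∀ s ∈ Icc s₁ s₂, SqBound (α s) C) (hβC : ∀ s ∈ Icc s₁ s₂, SqBound (β s) C)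
    (hfC : ∀ s ∈ Icc s₁ s₂, SqBound (f s) C) (hgC : ∀ s ∈ Icc s₁ s₂, SqBound (g s) C)
    (hK : SchurBound K M)
    (hK' : SchurBound (fun m m' => ((E m - E m' : ℝ) : ℂ) / (Complex.I * ħ) * K m m') M') :
    IntervalIntegrable (fun s =>
        form (fun m m' => ((E m - E m' : ℝ) : ℂ) / (Complex.I * ħ) * K m m') (α s) (β s) +
        (form K (f s) (β s) - form K (α s) (g s)) / (Complex.I * ħ)) volume s₁ s₂ ∧
    form K (α s₂) (β s₂) - form K (α s₁) (β s₁) =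
      ∫ s in s₁..s₂,
        (form (fun m m' => ((E m - E m' : ℝ) : ℂ) / (Complex.I * ħ) * K m m') (α s) (β s) +
        (form K (f s) (β s) - form K (α s) (g s)) / (Complex.I * ħ)) := by
  set K₁ : G → G → ℂ := fun m m' => ((E m - E m' : ℝ) : ℂ) / (Complex.I * ħ) * K m m' with hK₁
  let F : G × G → ℝ → ℂ := fun p s => K p.1 p.2 * α s p.1 * (starRingEnd ℂ) (β s p.2)
  let F' : G × G → ℝ → ℂ := fun p s =>
    K₁ p.1 p.2 * α s p.1 * (starRingEnd ℂ) (β s p.2) +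
      (K p.1 p.2 * f s p.1 * (starRingEnd ℂ) (β s p.2) -
        K p.1 p.2 * α s p.1 * (starRingEnd ℂ) (g s p.2)) / (Complex.I * ħ)
  have hα' : ∀ m, Continuous fun s => α s m := fun m =>
    continuous_iff_continuousAt.2 fun s => (hα m s).continuousAt
  have hβ' : ∀ m, Continuous fun s => β s m := fun m =>
    continuous_iff_continuousAt.2 fun s => (hβ m s).continuousAt
  have hF : ∀ p s, HasDerivAt (F p) (F' p s) s := by
    intro p s
    have h1 := hα p.1 s
    have h2 : HasDerivAt (fun s => (starRingEnd ℂ) (β s p.2))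
        ((starRingEnd ℂ) ((E p.2 * β s p.2 + g s p.2) / (Complex.I * ħ))) s := (hβ p.2 s).star
    have h3 := (h1.const_mul (K p.1 p.2)).mul h2
    convert! h3 using 1
    simp only [F', hK₁, map_div₀, map_mul, map_add, Complex.conj_I, Complex.conj_ofReal]
    by_cases hħ : ħ = 0
    · simp [hħ]
    have : (ħ : ℂ) ≠ 0 := by exact_mod_cast hħ
    have := Complex.I_ne_zero
    push_cast
    field_simp
    ring
  have hcβ : ∀ m, Continuous fun s => (starRingEnd ℂ) (β s m) := fun m =>
    Complex.continuous_conj.comp (hβ' m)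
  have hcg : ∀ m, Continuous fun s => (starRingEnd ℂ) (g s m) := fun m =>
    Complex.continuous_conj.comp (hg m)
  have hF'c : ∀ p, Continuous (F' p) := by
    intro p
    exact ((continuous_const.mul (hα' _)).mul (hcβ _)).add
      ((((continuous_const.mul (hf _)).mul (hcβ _)).sub
        ((continuous_const.mul (hα' _)).mul (hcg _))).div_const _)
  have hsum : ∀ s ∈ Icc s₁ s₂, HasSum (fun p => F' p s)
      (form K₁ (α s) (β s) + (form K (f s) (β s) - form K (α s) (g s)) / (Complex.I * ħ)) := by
    intro s hs'
    exact (hK'.hasSum (hαC s hs') (hβC s hs')).add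
      (((hK.hasSum (hfC s hs') (hβC s hs')).sub (hK.hasSum (hαC s hs') (hgC s hs'))).div_const _)
  let D : ℝ := (∑' k, M' k) * ((C + C) / 2) +
    ((∑' k, M k) * ((C + C) / 2) + (∑' k, M k) * ((C + C) / 2)) / ‖Complex.I * ħ‖
  have hbound : ∀ s ∈ Icc s₁ s₂, ∀ S : Finset (G × G), ∑ p ∈ S, ‖F' p s‖ ≤ D := by
    intro s hs' S
    have e1 := ((hK'.summable_norm (hαC s hs') (hβC s hs')).sum_le_tsum S
      fun _ _ => norm_nonneg _).trans (hK'.tsum_norm_le (hαC s hs') (hβC s hs'))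
    have e2 := ((hK.summable_norm (hfC s hs') (hβC s hs')).sum_le_tsum S
      fun _ _ => norm_nonneg _).trans (hK.tsum_norm_le (hfC s hs') (hβC s hs'))
    have e3 := ((hK.summable_norm (hαC s hs') (hgC s hs')).sum_le_tsum S
      fun _ _ => norm_nonneg _).trans (hK.tsum_norm_le (hαC s hs') (hgC s hs'))
    calc ∑ p ∈ S, ‖F' p s‖ ≤ ∑ p ∈ S, (‖K₁ p.1 p.2 * α s p.1 * (starRingEnd ℂ) (β s p.2)‖ +
          (‖K p.1 p.2 * f s p.1 * (starRingEnd ℂ) (β s p.2)‖ +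
            ‖K p.1 p.2 * α s p.1 * (starRingEnd ℂ) (g s p.2)‖) / ‖Complex.I * ħ‖) := by
          refine Finset.sum_le_sum fun p _ => (norm_add_le _ _).trans ?_
          rw [norm_div]
          gcongr
          exact norm_sub_le _ _
      _ ≤ D := by
          rw [Finset.sum_add_distrib, ← Finset.sum_div, Finset.sum_add_distrib]
          simp only [D]
          gcongr
  have hint : ∀ p, IntegrableOn (F' p) (Ioc s₁ s₂) := fun p =>
    ((hF'c p).integrableOn_Icc).mono_set Ioc_subset_Icc_self
  have hS : Summable fun p => ∫ s in Ioc s₁ s₂, ‖F' p s‖ := by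
    refine summable_of_sum_le (c := D * (s₂ - s₁)) (fun p => integral_nonneg fun _ => norm_nonneg _)
      fun S => ?_
    rw [← integral_finsetSum S fun p _ => (hint p).norm]
    have : ∫ s in Ioc s₁ s₂, ∑ p ∈ S, ‖F' p s‖ ≤ ∫ _ in Ioc s₁ s₂, D :=
      setIntegral_mono_on (integrable_finsetSum S fun p _ => (hint p).norm)
        (integrableOn_const (by simp)) measurableSet_Ioc
        fun s hs' => hbound s (Ioc_subset_Icc_self hs') S
    simpa [hs, mul_comm] using this
  have hH := hasSum_integral_of_summable_integral_norm hint hS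
  have hI : ∀ s ∈ Ioc s₁ s₂, ∑' p, F' p s =
      form K₁ (α s) (β s) + (form K (f s) (β s) - form K (α s) (g s)) / (Complex.I * ħ) :=
    fun s hs' => (hsum s (Ioc_subset_Icc_self hs')).tsum_eq
  have hFS : HasSum (fun p => F p s₂ - F p s₁)
      (form K (α s₂) (β s₂) - form K (α s₁) (β s₁)) :=
    (hK.hasSum (hαC s₂ ⟨hs, le_rfl⟩) (hβC s₂ ⟨hs, le_rfl⟩)).sub
      (hK.hasSum (hαC s₁ ⟨le_rfl, hs⟩) (hβC s₁ ⟨le_rfl, hs⟩))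
  constructor
  · rw [intervalIntegrable_iff_integrableOn_Ioc_of_le hs]
    refine Integrable.of_bound ?_ D ?_
    · refine aestronglyMeasurable_of_tendsto_ae (u := (atTop : Filter (Finset (G × G))))
        (f := fun S s => ∑ p ∈ S, F' p s) (fun S => ?_) ?_
      · exact (continuous_finsetSum S fun p _ => hF'c p).aestronglyMeasurable
      · filter_upwards [ae_restrict_mem measurableSet_Ioc] with s hs'
        exact hsum s (Ioc_subset_Icc_self hs')
    · filter_upwards [ae_restrict_mem measurableSet_Ioc] with s hs'
      exact le_of_tendsto (hsum s (Ioc_subset_Icc_self hs')).norm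
        (Eventually.of_forall fun S => (norm_sum_le _ _).trans
          (hbound s (Ioc_subset_Icc_self hs') S))
  · rw [intervalIntegral.integral_of_le hs, ← setIntegral_congr_fun measurableSet_Ioc hI]
    refine hFS.unique ?_
    convert! hH using 1
    ext p
    rw [← intervalIntegral.integral_of_le hs, intervalIntegral.integral_eq_sub_of_hasDerivAt
      (fun s _ => hF p s) ((hF'c p).intervalIntegrable _ _)]

/-! ### Commutators with convolutions -/

lemma summable_conv_term (hK : SchurBound K M) (ha : SqBound a A) (hb : SqBound b B) {V : G → ℂ}
    (hV : Summable fun j => ‖V j‖) :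
    Summable fun q : G × (G × G) =>
      V q.1 * (K q.2.1 q.2.2 * a (q.2.1 - q.1) * (starRingEnd ℂ) (b q.2.2)) := by
  refine Summable.of_norm ?_
  have hfib : ∀ j, SqBound (fun m => a (m - j)) A := fun j => by
    simpa [sub_eq_add_neg] using ha.shift (-j)
  rw [summable_prod_of_nonneg (fun _ => norm_nonneg _)]
  refine ⟨fun j => ?_, ?_⟩
  · simp only [norm_mul (V j)]
    exact (hK.summable_norm (hfib j) hb).mul_left _
  · refine Summable.of_nonneg_of_le (fun j => tsum_nonneg fun _ => norm_nonneg _) (fun j => ?_)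
      (hV.mul_right ((∑' k, M k) * ((A + B) / 2)))
    simp only [norm_mul (V j)]
    rw [tsum_mul_left]
    exact mul_le_mul_of_nonneg_left (hK.tsum_norm_le (hfib j) hb) (norm_nonneg _)

/-- Fubini for an absolutely convergent triple series; a shift of `a` does not change its
square-summability bound. -/
lemma hasSum_form_conv (hK : SchurBound K M) (ha : SqBound a A) (hb : SqBound b B) {V f : G → ℂ}
    (hV : Summable fun j => ‖V j‖) (hf : ∀ m, HasSum (fun j => V j * a (m - j)) (f m)) :
    HasSum (fun j => V j * form K (fun m => a (m - j)) b) (form K f b) := by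
  let T : G → G × G → ℂ := fun j p =>
    V j * (K p.1 p.2 * a (p.1 - j) * (starRingEnd ℂ) (b p.2))
  have h : Summable (Function.uncurry T) := summable_conv_term hK ha hb hV
  have hj : ∀ j, SqBound (fun m => a (m - j)) A := fun j => by
    simpa [sub_eq_add_neg] using ha.shift (-j)
  have hfib : ∀ j, HasSum (T j) (V j * form K (fun m => a (m - j)) b) := fun j =>
    (hK.hasSum (hj j) hb).mul_left (V j)
  have h1 : HasSum (fun j => V j * form K (fun m => a (m - j)) b)
      (∑' q : G × (G × G), Function.uncurry T q) := h.hasSum.prod_fiberwise hfib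
  have h2 : ∑' q : G × (G × G), Function.uncurry T q = ∑' p, ∑' j, T j p :=
    h.tsum_prod.trans h.tsum_comm.symm
  have h3 : ∑' p, ∑' j, T j p = form K f b := by
    refine tsum_congr fun p => ?_
    have := ((hf p.1).mul_left (K p.1 p.2)).mul_right ((starRingEnd ℂ) (b p.2))
    rw [← this.tsum_eq]
    refine tsum_congr fun j => ?_
    simp only [T]
    ring
  rwa [h2, h3] at h1

lemma form_conj_swap : form K a b = (starRingEnd ℂ) (form (fun m m' => (starRingEnd ℂ) (K m' m)) b a) := by
  rw [form, form, Complex.conj_tsum, ← (Equiv.prodComm G G).tsum_eq]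
  refine tsum_congr fun p => ?_
  simp
  ring

lemma SchurBound.conj_swap (hK : SchurBound K M) :
    SchurBound (fun m m' => (starRingEnd ℂ) (K m' m)) fun k => M (-k) where
  summable := ((Equiv.neg G).summable_iff (f := M)).mpr hK.summable
  le m m' := by simpa using hK.le m' m

/-- The symmetry `V (-j) = conj (V j)` lets the convolution on `b` be written as `∑ V j form K a
(b(· + j))`. On the other side, a shift of `a` by `-j` becomes, after translating both indices, a
shift of the kernel and of `b` by `j`. The difference is thus a sum over `j` of forms with kernels
`K(m + j, m' + j) - K(m, m')`: only the variation of the kernel along the diagonal matters. -/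
lemma norm_form_commutator_le (hK : SchurBound K M) (ha : SqBound a A) (hb : SqBound b B)
    {V f g : G → ℂ} {L : G → ℝ} {S : ℝ}
    (hV : Summable fun j => ‖V j‖) (hVc : ∀ j, V (-j) = (starRingEnd ℂ) (V j))
    (hf : ∀ m, HasSum (fun j => V j * a (m - j)) (f m))
    (hg : ∀ m, HasSum (fun j => V j * b (m - j)) (g m))
    (hM' : Summable M')
    (hKL : ∀ j m m', ‖K (m + j) (m' + j) - K m m'‖ ≤ L j * M' (m' - m))
    (hS : HasSum (fun j => ‖V j‖ * L j) S) :
    ‖form K f b - form K a g‖ ≤ S * ((∑' k, M' k) * ((A + B) / 2)) := by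
  have h1 := hasSum_form_conv hK ha hb hV hf
  have h2 : HasSum (fun j => V j * form K a (fun m => b (m + j))) (form K a g) := by
    have := hasSum_form_conv hK.conj_swap hb ha hV hg
    rw [form_conj_swap (b := g)]
    have h3 := (Complex.hasSum_conj (f := fun j => V j *
      form (fun m m' => (starRingEnd ℂ) (K m' m)) (fun m => b (m - j)) a)).mpr
      (by rwa [Complex.conj_conj])
    rw [← (Equiv.neg G).hasSum_iff] at h3
    convert! h3 using 1
    ext j
    simp only [Function.comp, Equiv.neg_apply, map_mul, hVc, Complex.conj_conj, sub_neg_eq_add]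
    rw [form_conj_swap (K := K)]
  have h3 := h1.sub h2
  have hterm : ∀ j, ‖V j * form K (fun m => a (m - j)) b - V j * form K a (fun m => b (m + j))‖ ≤
      ‖V j‖ * L j * ((∑' k, M' k) * ((A + B) / 2)) := by
    intro j
    have hshift : form K (fun m => a (m - j)) b =
        form (fun m m' => K (m + j) (m' + j)) a (fun m => b (m + j)) := by
      rw [form, form, ← ((Equiv.addRight j).prodCongr (Equiv.addRight j)).tsum_eq]
      simp
    have hKj : SchurBound (fun m m' => K (m + j) (m' + j)) M :=
      ⟨hK.summable, fun m m' => by simpa using hK.le (m + j) (m' + j)⟩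
    have hd : SchurBound (fun m m' => K (m + j) (m' + j) - K m m') fun k => L j * M' k :=
      ⟨hM'.mul_left _, fun m m' => hKL j m m'⟩
    rw [hshift, ← mul_sub, ← hKj.form_sub hK ha (hb.shift j), norm_mul, mul_assoc]
    refine mul_le_mul_of_nonneg_left ?_ (norm_nonneg _)
    have := hd.norm_form_le ha (hb.shift j)
    rwa [tsum_mul_left, mul_assoc] at this
  have hs2 : HasSum (fun j => ‖V j‖ * L j * ((∑' k, M' k) * ((A + B) / 2)))
    (S * ((∑' k, M' k) * ((A + B) / 2))) := hS.mul_right _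
  rw [← h3.tsum_eq, ← hs2.tsum_eq]
  exact tsum_of_norm_bounded hs2.summable.hasSum hterm

end Forms

/-! ### Fourier series on the torus -/

instance : IsProbabilityMeasure torusMeasure := by unfold torusMeasure; infer_instance

instance : Measure.IsAddHaarMeasure torusMeasure := by unfold torusMeasure; infer_instance

lemma mFourierCoeff_eq (f : Torus → ℂ) (k : Fin 2 → ℤ) :
    mFourierCoeff f k = ∫ x, mFourier (-k) x * f x ∂torusMeasure := rfl

lemma toTorus_add (x y : Plane) : toTorus (x + y) = toTorus x + toTorus y := by
  ext i; simp [toTorus]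

lemma toTorus_zero : toTorus 0 = 0 := by
  ext i; simp [toTorus]

lemma toTorus_sub (x y : Plane) : toTorus (x - y) = toTorus x - toTorus y := by
  ext i; simp [toTorus]

lemma isOpenQuotientMap_toTorus : IsOpenQuotientMap toTorus := by
  have h1 : IsOpenQuotientMap (fun (x : Fin 2 → ℝ) (i : Fin 2) => (x i : UnitAddCircle)) :=
    IsOpenQuotientMap.piMap fun _ => QuotientAddGroup.isOpenQuotientMap_mk
  exact h1.comp (EuclideanSpace.equiv (Fin 2) ℝ).toHomeomorph.isOpenQuotientMap

lemma continuous_toTorus : Continuous toTorus := isOpenQuotientMap_toTorus.continuous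

lemma surjective_toTorus : Function.Surjective toTorus := isOpenQuotientMap_toTorus.surjective

lemma mFourier_toTorus (k : Fin 2 → ℤ) (y : Plane) :
    mFourier k (toTorus y) =
      Complex.exp (((2 * Real.pi * inner ℝ (latticeVec k) y : ℝ) : ℂ) * Complex.I) := by
  simp only [mFourier, ContinuousMap.coe_mk, toTorus, fourier_coe_apply, Fin.prod_univ_two,
    ← Complex.exp_add, latticeVec, PiLp.inner_apply, Fin.sum_univ_two]
  congr 1
  simp
  ring

lemma norm_mFourier_apply (k : Fin 2 → ℤ) (x : Torus) : ‖mFourier k x‖ = 1 := by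
  obtain ⟨y, rfl⟩ := surjective_toTorus x
  rw [mFourier_toTorus, Complex.norm_exp_ofReal_mul_I]

lemma mFourier_add_apply (k : Fin 2 → ℤ) (x y : Torus) :
    mFourier k (x + y) = mFourier k x * mFourier k y := by
  obtain ⟨x, rfl⟩ := surjective_toTorus x
  obtain ⟨y, rfl⟩ := surjective_toTorus y
  rw [← toTorus_add, mFourier_toTorus, mFourier_toTorus, mFourier_toTorus, ← Complex.exp_add,
    inner_add_right]
  congr 1; push_cast; ring

lemma latticeVec_add (k l : Fin 2 → ℤ) : latticeVec (k + l) = latticeVec k + latticeVec l := by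
  ext i; simp [latticeVec]

lemma latticeVec_neg (k : Fin 2 → ℤ) : latticeVec (-k) = -latticeVec k := by
  ext i; simp [latticeVec]

lemma latticeVec_sub (k l : Fin 2 → ℤ) : latticeVec (k - l) = latticeVec k - latticeVec l := by
  ext i; simp [latticeVec]

lemma inner_latticeVec (k : Fin 2 → ℤ) (y : Plane) :
    inner ℝ (latticeVec k) y = (k 0 : ℝ) * y 0 + (k 1 : ℝ) * y 1 := by
  simp [latticeVec, PiLp.inner_apply, Fin.sum_univ_two]
  ring

lemma inner_latticeVec_single (k : Fin 2 → ℤ) (i : Fin 2) :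
    inner ℝ (latticeVec k) (EuclideanSpace.single i (1 : ℝ)) = (k i : ℝ) := by
  rw [EuclideanSpace.inner_single_right]
  simp [latticeVec]

lemma integral_torus_add_right (f : Torus → ℂ) (a : Torus) :
    ∫ x, f (x + a) ∂torusMeasure = ∫ x, f x ∂torusMeasure :=
  integral_add_right_eq_self f a

lemma integral_mFourier (k : Fin 2 → ℤ) :
    ∫ x, mFourier k x ∂torusMeasure = if k = 0 then 1 else 0 := by
  have h := orthonormal_iff_ite.mp (orthonormal_mFourier (d := Fin 2)) 0 k
  rw [ContinuousMap.inner_toLp] at h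
  have h2 : ∫ x, mFourier k x ∂torusMeasure = if (0 : Fin 2 → ℤ) = k then (1 : ℂ) else 0 := by
    rw [← h]
    refine integral_congr_ae (Eventually.of_forall fun x => ?_)
    simp [mFourier_zero]
  rw [h2]
  simp [eq_comm]

lemma mFourierCoeff_mFourier_mul (f : Torus → ℂ) (j m : Fin 2 → ℤ) :
    mFourierCoeff (fun x => mFourier j x * f x) m = mFourierCoeff f (m - j) := by
  rw [mFourierCoeff_eq, mFourierCoeff_eq]
  congr 1; ext x
  rw [← mul_assoc, ← mFourier_add, neg_sub, sub_eq_add_neg, add_comm]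

/-- The orthonormal basis of exponentials. -/
def expBasis : HilbertBasis (Fin 2 → ℤ) ℂ L2 := mFourierBasis

/-- The exponentials, as elements of `L²`. -/
def expL2 (k : Fin 2 → ℤ) : L2 := mFourierLp 2 k

lemma coe_expBasis : ⇑expBasis = expL2 := coe_mFourierBasis

lemma expBasis_repr (u : L2) (m : Fin 2 → ℤ) : expBasis.repr u m = mFourierCoeff u m :=
  mFourierBasis_repr u m

lemma coeFn_expL2 (k : Fin 2 → ℤ) : expL2 k =ᵐ[torusMeasure] mFourier k :=
  coeFn_mFourierLp 2 k

lemma hasSum_expL2 (u : L2) : HasSum (fun m => mFourierCoeff u m • expL2 m) u :=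
  hasSum_mFourier_series_L2 u

lemma hasSum_sq_coeff (u : L2) : HasSum (fun m => ‖mFourierCoeff u m‖ ^ 2) (‖u‖ ^ 2) := by
  have h := lp.hasSum_norm (p := 2) (by norm_num) (expBasis.repr u)
  simpa [expBasis_repr] using h

lemma sqBound_coeff (u : L2) : SqBound (mFourierCoeff u) (‖u‖ ^ 2) :=
  ⟨(hasSum_sq_coeff u).summable, (hasSum_sq_coeff u).tsum_eq.le⟩

/-- The multiplication of a square-integrable function by a continuous function. -/
def mulL2 (g : C(Torus, ℂ)) (u : L2) : L2 :=
  MemLp.toLp (fun x => g x * u x) <| (Lp.memLp u).of_le_mul (c := ‖g‖)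
    (g.continuous.aestronglyMeasurable.mul (Lp.aestronglyMeasurable u)) <|
      Eventually.of_forall fun x => by
        rw [norm_mul]
        exact mul_le_mul_of_nonneg_right (g.norm_coe_le_norm x) (norm_nonneg _)

lemma coeFn_mulL2 (g : C(Torus, ℂ)) (u : L2) :
    mulL2 g u =ᵐ[torusMeasure] fun x => g x * u x := MemLp.coeFn_toLp _

lemma norm_mulL2_le (g : C(Torus, ℂ)) (u : L2) : ‖mulL2 g u‖ ≤ ‖g‖ * ‖u‖ := by
  refine Lp.norm_le_mul_norm_of_ae_le_mul ?_
  filter_upwards [coeFn_mulL2 g u] with x hx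
  rw [hx, norm_mul]
  exact mul_le_mul_of_nonneg_right (g.norm_coe_le_norm x) (norm_nonneg _)

lemma mFourierCoeff_mulL2 (g : C(Torus, ℂ)) (u : L2) (m : Fin 2 → ℤ) :
    mFourierCoeff (mulL2 g u) m = mFourierCoeff (fun x => g x * u x) m := by
  rw [mFourierCoeff_eq, mFourierCoeff_eq]
  refine integral_congr_ae ?_
  filter_upwards [coeFn_mulL2 g u] with x hx
  rw [hx]

/-- The integral against a continuous function, as a continuous linear form. -/
lemma exists_clm_integral (g : C(Torus, ℂ)) :
    ∃ ℓ : L2 →L[ℂ] ℂ, ∀ u : L2, ℓ u = ∫ x, g x * u x ∂torusMeasure := by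
  let w : L2 := ContinuousMap.toLp (E := ℂ) 2 torusMeasure ℂ (star g)
  refine ⟨innerSL ℂ w, fun u => ?_⟩
  rw [innerSL_apply_apply, L2.inner_def]
  refine integral_congr_ae ?_
  filter_upwards [ContinuousMap.coeFn_toLp (𝕜 := ℂ) (p := 2) torusMeasure (star g)] with x hx
  rw [RCLike.inner_apply, hx, ContinuousMap.star_apply, RCLike.star_def, RCLike.conj_conj,
    mul_comm]

lemma continuous_integral_mul (g : C(Torus, ℂ)) {v : ℝ → L2} (hv : Continuous v) :
    Continuous fun s => ∫ x, g x * v s x ∂torusMeasure := by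
  obtain ⟨ℓ, hℓ⟩ := exists_clm_integral g
  exact (ℓ.continuous.comp hv).congr fun s => hℓ (v s)

lemma continuous_mFourierCoeff {v : ℝ → L2} (hv : Continuous v) (m : Fin 2 → ℤ) :
    Continuous fun s => mFourierCoeff (v s) m := continuous_integral_mul (mFourier (-m)) hv

lemma continuous_mFourierCoeff_mulL2 (g : C(Torus, ℂ)) {v : ℝ → L2} (hv : Continuous v)
    (m : Fin 2 → ℤ) : Continuous fun s => mFourierCoeff (mulL2 g (v s)) m := by
  refine (continuous_integral_mul (mFourier (-m) * g) hv).congr fun s => ?_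
  rw [mFourierCoeff_mulL2, mFourierCoeff_eq]
  simp only [ContinuousMap.mul_apply, mul_assoc]

/-- The Fourier series of `g` converges absolutely and uniformly, so it may be integrated term by
term against `u`, for which square-integrability is enough. -/
lemma hasSum_mFourierCoeff_mulL2 {g : C(Torus, ℂ)} (hg : Summable (mFourierCoeff g)) (u : L2)
    (m : Fin 2 → ℤ) :
    HasSum (fun j => mFourierCoeff g j * mFourierCoeff u (m - j))
      (mFourierCoeff (mulL2 g u) m) := by
  have h1 := hasSum_mFourier_series_of_summable hg
  have hu : Integrable (fun x => u x) torusMeasure := (Lp.memLp u).integrable (by norm_num)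
  have h2 : ∀ j, Integrable (fun x => mFourier (-m) x * ((mFourierCoeff g j * mFourier j x) * u x))
      torusMeasure := fun j => by
    have hc : Continuous fun x => mFourier (-m) x * (mFourierCoeff g j * mFourier j x) := by fun_prop
    obtain ⟨c, hc'⟩ := (isCompact_range hc.norm).bddAbove
    have := hu.bdd_mul (c := c) hc.aestronglyMeasurable
      (Eventually.of_forall fun x => hc' ⟨x, rfl⟩)
    simpa only [mul_assoc] using this
  have h3 := hasSum_integral_of_summable_integral_norm (μ := torusMeasure) h2 ?_
  · rw [mFourierCoeff_mulL2, mFourierCoeff_eq]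
    convert! h3 using 1
    · ext j
      rw [← mFourierCoeff_mFourier_mul, mFourierCoeff_eq _ m, ← integral_const_mul]
      congr 1; ext x; ring
    · congr 1; ext x
      have := ((hasSum_mFourier_series_apply_of_summable hg x).mul_right (u x)).mul_left
        (mFourier (-m) x)
      rw [← this.tsum_eq]
      rfl
  · have : ∀ j, ∫ x, ‖mFourier (-m) x * ((mFourierCoeff g j * mFourier j x) * u x)‖ ∂torusMeasure =
        ‖mFourierCoeff g j‖ * ∫ x, ‖u x‖ ∂torusMeasure := fun j => by
      rw [← integral_const_mul]
      congr 1; ext x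
      simp [norm_mFourier_apply]
    simp only [this]
    exact hg.norm.mul_right _

/-! ### Derivatives and decay of the Fourier coefficients -/

/-- The derivative of a function on the torus in the direction `v`. -/
def dirDeriv (f : Torus → ℂ) (v : Plane) (x : Torus) : ℂ :=
  fderiv ℝ (fun y : Plane => f (x + toTorus y)) 0 v

lemma dirDeriv_toTorus (f : Torus → ℂ) (v x : Plane) :
    dirDeriv f v (toTorus x) = fderiv ℝ (fun y => f (toTorus y)) x v := by
  simp only [dirDeriv, ← toTorus_add]
  rw [fderiv_comp_add_left (f := fun y => f (toTorus y))]
  simp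

lemma SmoothOnTorus.dirDeriv {f : Torus → ℂ} (hf : SmoothOnTorus f) (v : Plane) :
    SmoothOnTorus (dirDeriv f v) := by
  unfold SmoothOnTorus
  simp only [dirDeriv_toTorus]
  exact (hf.fderiv_right (m := ∞) (by simp)).clm_apply contDiff_const

lemma SmoothOnTorus.continuous {f : Torus → ℂ} (hf : SmoothOnTorus f) : Continuous f :=
  isOpenQuotientMap_toTorus.isQuotientMap.continuous_iff.2 (ContDiff.continuous hf)

lemma SmoothOnTorus.hasDerivAt {f : Torus → ℂ} (hf : SmoothOnTorus f) (v : Plane) (x : Torus)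
    (s : ℝ) : HasDerivAt (fun s : ℝ => f (x + toTorus (s • v)))
      (TwoMicrolocal.dirDeriv f v (x + toTorus (s • v))) s := by
  obtain ⟨x, rfl⟩ := surjective_toTorus x
  simp only [← toTorus_add, dirDeriv_toTorus]
  have h1 : HasFDerivAt (fun y => f (toTorus y)) _ (x + s • v) :=
    (ContDiff.differentiable hf (by simp)).differentiableAt.hasFDerivAt
  have h2 : HasDerivAt (fun s : ℝ => x + s • v) v s := by
    simpa using ((hasDerivAt_id s).smul_const v).const_add x
  exact h1.comp_hasDerivAt s h2

lemma mFourierCoeff_translate (f : Torus → ℂ) (k : Fin 2 → ℤ) (a : Torus) :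
    ∫ x, mFourier (-k) x * f (x + a) ∂torusMeasure = mFourier k a * mFourierCoeff f k := by
  rw [mFourierCoeff_eq, ← integral_torus_add_right (fun x => mFourier (-k) x * f x) a,
    ← integral_const_mul]
  have h : mFourier k a * mFourier (-k) a = 1 := by
    rw [← mFourier_add]; simp [mFourier_zero]
  congr 1; ext x
  rw [mFourier_add_apply]
  linear_combination (-mFourier (-k) x * f (x + a)) * h

/-- Integration by parts through translation invariance: translating `f` by `s • v` multiplies its
coefficient by a character of `s`, and both sides are differentiated at `s = 0`. -/
lemma SmoothOnTorus.mFourierCoeff_dirDeriv {f : Torus → ℂ} (hf : SmoothOnTorus f) (v : Plane)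
    (k : Fin 2 → ℤ) :
    mFourierCoeff (TwoMicrolocal.dirDeriv f v) k =
      2 * Real.pi * Complex.I * (inner ℝ (latticeVec k) v : ℝ) * mFourierCoeff f k := by
  have hc := hf.continuous
  have hd := (hf.dirDeriv v).continuous
  obtain ⟨c, hc'⟩ := (isCompact_range hd.norm).bddAbove
  have hF : ∀ s : ℝ, Continuous fun x => mFourier (-k) x * f (x + toTorus (s • v)) := fun s => by
    fun_prop
  have hF' : ∀ s : ℝ, Continuous fun x =>
      mFourier (-k) x * TwoMicrolocal.dirDeriv f v (x + toTorus (s • v)) := fun s => by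
    fun_prop
  have h1 := (hasDerivAt_integral_of_dominated_loc_of_deriv_le (μ := torusMeasure) (𝕜 := ℝ)
    (F := fun (s : ℝ) x => mFourier (-k) x * f (x + toTorus (s • v)))
    (F' := fun (s : ℝ) x => mFourier (-k) x * TwoMicrolocal.dirDeriv f v (x + toTorus (s • v)))
    (x₀ := 0) (s := univ) (bound := fun _ => c) univ_mem
    (Eventually.of_forall fun s => (hF s).aestronglyMeasurable)
    ((hF 0).integrable_of_hasCompactSupport (HasCompactSupport.of_compactSpace _))
    (hF' 0).aestronglyMeasurable
    (Eventually.of_forall fun x s _ => by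
      rw [norm_mul, norm_mFourier_apply, one_mul]
      exact hc' ⟨_, rfl⟩)
    (integrable_const c)
    (Eventually.of_forall fun x s _ => (hf.hasDerivAt v x s).const_mul _)).2
  simp only [mFourierCoeff_translate, mFourier_toTorus] at h1
  have h2 : HasDerivAt (fun s : ℝ => Complex.exp
      (((2 * Real.pi * inner ℝ (latticeVec k) (s • v) : ℝ) : ℂ) * Complex.I) * mFourierCoeff f k)
      (2 * Real.pi * Complex.I * (inner ℝ (latticeVec k) v : ℝ) * mFourierCoeff f k) 0 := by
    have h3 : HasDerivAt (fun s : ℝ =>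
        ((2 * Real.pi * inner ℝ (latticeVec k) (s • v) : ℝ) : ℂ) * Complex.I)
        (2 * Real.pi * Complex.I * (inner ℝ (latticeVec k) v : ℝ)) 0 := by
      have h4 : HasDerivAt (fun s : ℝ => (2 * Real.pi * inner ℝ (latticeVec k) (s • v) : ℝ))
          (2 * Real.pi * inner ℝ (latticeVec k) v) 0 := by
        simp only [inner_smul_right]
        simpa using ((hasDerivAt_id (0 : ℝ)).mul_const
          (inner ℝ (latticeVec k) v)).const_mul (2 * Real.pi)
      convert! h4.ofReal_comp.mul_const Complex.I using 1
      push_cast; ring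
    simpa using h3.cexp.mul_const (mFourierCoeff f k)
  have h3 := h1.unique h2
  simpa [zero_smul, toTorus_zero, inner_zero_right, mFourier_zero] using h3

lemma SmoothOnTorus.pow_mul_norm_mFourierCoeff_le {f : Torus → ℂ} (hf : SmoothOnTorus f) (n : ℕ)
    {C : ℝ} (hC : ∀ x, ‖iteratedFDeriv ℝ n (fun y => f (toTorus y)) x‖ ≤ C) (v : Plane)
    (k : Fin 2 → ℤ) :
    |2 * Real.pi * inner ℝ (latticeVec k) v| ^ n * ‖mFourierCoeff f k‖ ≤ C * ‖v‖ ^ n := by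
  induction n generalizing f C with
  | zero =>
    simp only [norm_iteratedFDeriv_zero, pow_zero, one_mul, mul_one] at hC ⊢
    rw [mFourierCoeff_eq]
    refine (norm_integral_le_of_norm_le_const (C := C) (Eventually.of_forall fun x => ?_)).trans ?_
    · obtain ⟨y, rfl⟩ := surjective_toTorus x
      rw [norm_mul, norm_mFourier_apply, one_mul]
      exact hC y
    · simp
  | succ n ih =>
    have h1 := ih (hf.dirDeriv v) (C := C * ‖v‖) fun x => by
      simp only [dirDeriv_toTorus]
      have h2 : (fun y => fderiv ℝ (fun y => f (toTorus y)) y v) =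
          (ContinuousLinearMap.apply ℝ ℂ v) ∘ fderiv ℝ (fun y => f (toTorus y)) := rfl
      rw [h2]
      refine (ContinuousLinearMap.norm_iteratedFDeriv_comp_left _
        ((hf.fderiv_right (m := ∞) (by simp)).contDiffAt) (n := n) (by exact_mod_cast le_top)).trans ?_
      rw [norm_iteratedFDeriv_fderiv, mul_comm]
      refine mul_le_mul (hC x) ?_ (norm_nonneg _) ((norm_nonneg _).trans (hC x))
      exact ContinuousLinearMap.opNorm_le_bound _ (norm_nonneg _) fun L => by
        rw [ContinuousLinearMap.apply_apply, mul_comm]; exact L.le_opNorm v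
    rw [hf.mFourierCoeff_dirDeriv] at h1
    rw [pow_succ, pow_succ]
    calc _ = |2 * Real.pi * inner ℝ (latticeVec k) v| ^ n *
          ‖2 * Real.pi * Complex.I * (inner ℝ (latticeVec k) v : ℝ) * mFourierCoeff f k‖ := by
          simp only [norm_mul, abs_mul, Complex.norm_I, Complex.norm_real, Real.norm_eq_abs]
          simp
          ring
      _ ≤ _ := h1
      _ = _ := by ring

/-- A summable weight on `ℤ²`. -/
def weight (k : Fin 2 → ℤ) : ℝ := (1 + (k 0 : ℝ) ^ 2)⁻¹ * (1 + (k 1 : ℝ) ^ 2)⁻¹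

lemma weight_pos (k : Fin 2 → ℤ) : 0 < weight k := by unfold weight; positivity

lemma summable_weight : Summable weight := by
  have h1 : Summable fun k : ℤ => (1 + (k : ℝ) ^ 2)⁻¹ := by
    have := (Real.summable_one_div_int_pow (p := 2)).mpr (by norm_num)
    refine Summable.of_norm_bounded_eventually this ?_
    filter_upwards [(Set.finite_singleton (0 : ℤ)).compl_mem_cofinite] with k hk
    have hk : (k : ℝ) ≠ 0 := by exact_mod_cast hk
    rw [norm_inv, Real.norm_of_nonneg (by positivity), one_div]
    exact inv_anti₀ (by positivity) (by linarith)
  have h2 := h1.mul_of_nonneg h1 (fun _ => by positivity) (fun _ => by positivity)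
  exact (finTwoArrowEquiv ℤ).summable_iff.mpr h2

/-- Four derivatives are used because the weight decays like `k₀⁻² k₁⁻²`. The factor is `6 = 2·3`:
the product `(1 + k₀²)(1 + k₁²)` is at most `2(1 + k₀⁴ + k₁⁴)`, and each of the three terms is
absorbed by one bound `C`. -/
lemma SmoothOnTorus.norm_mFourierCoeff_le {f : Torus → ℂ} (hf : SmoothOnTorus f) {C : ℝ}
    (hC : ∀ n ≤ 4, ∀ x, ‖iteratedFDeriv ℝ n (fun y => f (toTorus y)) x‖ ≤ C) (k : Fin 2 → ℤ) :
    ‖mFourierCoeff f k‖ ≤ 6 * C * weight k := by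
  have h0 := hf.pow_mul_norm_mFourierCoeff_le 0 (hC 0 (by norm_num)) 0 k
  have h1 : ∀ i : Fin 2, (k i : ℝ) ^ 4 * ‖mFourierCoeff f k‖ ≤ C := fun i => by
    have h := hf.pow_mul_norm_mFourierCoeff_le 4 (hC 4 le_rfl) (EuclideanSpace.single i 1) k
    rw [inner_latticeVec_single, PiLp.norm_single, norm_one, one_pow, mul_one] at h
    refine le_trans (mul_le_mul_of_nonneg_right ?_ (norm_nonneg _)) h
    have : (k i : ℝ) ^ 4 = |(k i : ℝ)| ^ 4 := by rw [Even.pow_abs (by decide)]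
    rw [this]
    refine pow_le_pow_left₀ (abs_nonneg _) ?_ 4
    rw [abs_mul, abs_of_pos (by positivity : (0 : ℝ) < 2 * Real.pi)]
    nlinarith [Real.pi_gt_three, abs_nonneg (k i : ℝ)]
  have h2 := h1 0
  have h3 := h1 1
  simp only [pow_zero, one_mul, mul_one] at h0
  rw [weight, ← mul_inv, ← div_eq_mul_inv, le_div_iff₀ (by positivity)]
  have hn := norm_nonneg (mFourierCoeff f k)
  have : (1 + (k 0 : ℝ) ^ 2) * (1 + (k 1 : ℝ) ^ 2) ≤ 2 * (1 + (k 0 : ℝ) ^ 4 + (k 1 : ℝ) ^ 4) := by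
    nlinarith [sq_nonneg ((k 0 : ℝ) ^ 2 - 1), sq_nonneg ((k 1 : ℝ) ^ 2 - 1),
      sq_nonneg ((k 0 : ℝ) ^ 2 - (k 1 : ℝ) ^ 2)]
  calc _ ≤ ‖mFourierCoeff f k‖ * (2 * (1 + (k 0 : ℝ) ^ 4 + (k 1 : ℝ) ^ 4)) :=
        mul_le_mul_of_nonneg_left this hn
    _ ≤ _ := by linarith

/-- The derivative of the periodic lift is periodic, so it descends to a continuous function on the
compact torus, written `g` as a derivative at the origin of a translate. -/
lemma SmoothOnTorus.iteratedFDeriv_bounded {f : Torus → ℂ} (hf : SmoothOnTorus f) (n : ℕ) :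
    ∃ C : ℝ, ∀ x, ‖iteratedFDeriv ℝ n (fun y => f (toTorus y)) x‖ ≤ C := by
  let g : Torus → ContinuousMultilinearMap ℝ (fun _ : Fin n => Plane) ℂ := fun x =>
    iteratedFDeriv ℝ n (fun y => f (x + toTorus y)) 0
  have hg : ∀ x, g (toTorus x) = iteratedFDeriv ℝ n (fun y => f (toTorus y)) x := fun x => by
    simp only [g, ← toTorus_add]
    rw [iteratedFDeriv_comp_add_left (f := fun y => f (toTorus y))]
    simp
  have hc : Continuous g := isOpenQuotientMap_toTorus.isQuotientMap.continuous_iff.2 <| by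
    refine (ContDiff.continuous_iteratedFDeriv (m := n) (by exact_mod_cast le_top) hf).congr ?_
    exact fun x => (hg x).symm
  obtain ⟨C, hC⟩ := (isCompact_range hc.norm).bddAbove
  exact ⟨C, fun x => by rw [← hg]; exact hC ⟨_, rfl⟩⟩

lemma SmoothOnTorus.exists_norm_mFourierCoeff_le {f : Torus → ℂ} (hf : SmoothOnTorus f) :
    ∃ C : ℝ, ∀ k, ‖mFourierCoeff f k‖ ≤ C * weight k := by
  choose C hC using hf.iteratedFDeriv_bounded
  refine ⟨6 * ∑ n ∈ Finset.range 5, C n, fun k => hf.norm_mFourierCoeff_le (fun n hn x => ?_) k⟩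
  refine (hC n x).trans (Finset.single_le_sum (f := C) (fun i _ => (norm_nonneg _).trans (hC i 0)) ?_)
  simp; omega

lemma SmoothOnTorus.summable_mFourierCoeff {f : Torus → ℂ} (hf : SmoothOnTorus f) :
    Summable (mFourierCoeff f) := by
  obtain ⟨C, hC⟩ := hf.exists_norm_mFourierCoeff_le
  exact Summable.of_norm_bounded (summable_weight.mul_left C) hC

/-- The first moment of the Fourier series of the potential is what the commutator estimate
consumes, since shifting by `j` varies the symbol by an amount proportional to `‖latticeVec j‖`. -/
lemma SmoothOnTorus.summable_norm_mul_mFourierCoeff {f : Torus → ℂ} (hf : SmoothOnTorus f) :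
    Summable fun k => ‖mFourierCoeff f k‖ * ‖latticeVec k‖ := by
  have h1 : ∀ i : Fin 2, ∃ C : ℝ, ∀ k, |(k i : ℝ)| * ‖mFourierCoeff f k‖ ≤ C * weight k := by
    intro i
    obtain ⟨C, hC⟩ := (hf.dirDeriv (EuclideanSpace.single i 1)).exists_norm_mFourierCoeff_le
    refine ⟨C, fun k => le_trans ?_ (hC k)⟩
    rw [hf.mFourierCoeff_dirDeriv, norm_mul]
    refine mul_le_mul_of_nonneg_right ?_ (norm_nonneg _)
    rw [inner_latticeVec_single]
    simp only [norm_mul, Complex.norm_I, Complex.norm_real, Real.norm_eq_abs, Complex.norm_ofNat,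
      abs_of_pos Real.pi_pos]
    nlinarith [Real.pi_gt_three, abs_nonneg (k i : ℝ)]
  obtain ⟨C₀, h₀⟩ := h1 0
  obtain ⟨C₁, h₁⟩ := h1 1
  refine Summable.of_nonneg_of_le (fun k => by positivity) (fun k => ?_)
    ((summable_weight.mul_left C₀).add (summable_weight.mul_left C₁))
  have : ‖latticeVec k‖ ≤ |(k 0 : ℝ)| + |(k 1 : ℝ)| := by
    rw [EuclideanSpace.norm_eq]
    refine Real.sqrt_le_iff.2 ⟨by positivity, ?_⟩
    simp only [latticeVec, Fin.sum_univ_two, Real.norm_eq_abs]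
    nlinarith [abs_nonneg (k 0 : ℝ), abs_nonneg (k 1 : ℝ)]
  calc _ ≤ ‖mFourierCoeff f k‖ * (|(k 0 : ℝ)| + |(k 1 : ℝ)|) :=
        mul_le_mul_of_nonneg_left this (norm_nonneg _)
    _ ≤ _ := by linarith [h₀ k, h₁ k]

lemma smoothOnTorus_mFourier (k : Fin 2 → ℤ) : SmoothOnTorus (mFourier k) := by
  unfold SmoothOnTorus
  simp only [mFourier_toTorus]
  have h1 : ContDiff ℝ ∞ fun x : Plane => (2 * Real.pi * inner ℝ (latticeVec k) x : ℝ) :=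
    contDiff_const.mul (contDiff_const.inner ℝ contDiff_id)
  exact ((Complex.ofRealCLM.contDiff.comp h1).mul contDiff_const).cexp

lemma dirDeriv_mFourier (k : Fin 2 → ℤ) (v : Plane) :
    dirDeriv (mFourier k) v = fun x =>
      (2 * Real.pi * Complex.I * (inner ℝ (latticeVec k) v : ℝ)) * mFourier k x := by
  ext x
  obtain ⟨x, rfl⟩ := surjective_toTorus x
  have h := (smoothOnTorus_mFourier k).hasDerivAt v (toTorus x) 0
  rw [zero_smul, toTorus_zero, add_zero] at h
  refine h.unique ?_
  have h3 : HasDerivAt (fun s : ℝ =>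
      ((2 * Real.pi * inner ℝ (latticeVec k) (x + s • v) : ℝ) : ℂ) * Complex.I)
      (2 * Real.pi * Complex.I * (inner ℝ (latticeVec k) v : ℝ)) 0 := by
    have h4 : HasDerivAt (fun s : ℝ => (2 * Real.pi * inner ℝ (latticeVec k) (x + s • v) : ℝ))
        (2 * Real.pi * inner ℝ (latticeVec k) v) 0 := by
      simp only [inner_add_right, inner_smul_right]
      simpa using (((hasDerivAt_id (0 : ℝ)).mul_const
        (inner ℝ (latticeVec k) v)).const_add (inner ℝ (latticeVec k) x)).const_mul (2 * Real.pi)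
    convert! h4.ofReal_comp.mul_const Complex.I using 1
    push_cast; ring
  have h5 := h3.cexp
  simp only [← toTorus_add, mFourier_toTorus]
  convert! h5 using 1
  rw [zero_smul, add_zero, mul_comm]

lemma torusLaplacian_mFourier (k : Fin 2 → ℤ) (x : Torus) :
    torusLaplacian (mFourier k) x =
      -((4 * Real.pi ^ 2 * ((k 0 : ℝ) ^ 2 + (k 1 : ℝ) ^ 2) : ℝ) : ℂ) * mFourier k x := by
  obtain ⟨x, rfl⟩ := surjective_toTorus x
  unfold torusLaplacian
  rw [InnerProductSpace.laplacian_eq_iteratedFDeriv_orthonormalBasis _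
    (EuclideanSpace.basisFun (Fin 2) ℝ)]
  simp only [EuclideanSpace.basisFun_apply, Fin.sum_univ_two, ← toTorus_add]
  have key : ∀ v : Plane, iteratedFDeriv ℝ 2 (fun y => mFourier k (toTorus (x + y))) 0 ![v, v] =
      (2 * Real.pi * Complex.I * (inner ℝ (latticeVec k) v : ℝ)) *
        ((2 * Real.pi * Complex.I * (inner ℝ (latticeVec k) v : ℝ)) * mFourier k (toTorus x)) := by
    intro v
    have h1 : ContDiff ℝ ∞ fun y => mFourier k (toTorus y) := smoothOnTorus_mFourier k
    rw [iteratedFDeriv_comp_add_left (f := fun y => mFourier k (toTorus y)), iteratedFDeriv_two_apply,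
      add_zero]
    simp only [Matrix.cons_val_zero, Matrix.cons_val_one]
    have h2 : fderiv ℝ (fderiv ℝ fun y => mFourier k (toTorus y)) x v v =
        fderiv ℝ (fun z => fderiv ℝ (fun y => mFourier k (toTorus y)) z v) x v := by
      have hd : DifferentiableAt ℝ (fderiv ℝ fun y => mFourier k (toTorus y)) x :=
        ((h1.fderiv_right (m := ∞) (by simp)).differentiable (by simp)).differentiableAt
      rw [fderiv_clm_apply hd (differentiableAt_const v)]
      simp
    rw [h2]
    have h3 : (fun z => fderiv ℝ (fun y => mFourier k (toTorus y)) z v) = fun z =>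
        (2 * Real.pi * Complex.I * (inner ℝ (latticeVec k) v : ℝ)) * mFourier k (toTorus z) := by
      ext z
      rw [← dirDeriv_toTorus (mFourier k) v z, dirDeriv_mFourier]
    rw [h3, fderiv_const_mul (h1.differentiable (by simp)).differentiableAt]
    simp only [_root_.smul_apply, smul_eq_mul]
    rw [← dirDeriv_toTorus (mFourier k) v x, dirDeriv_mFourier]
  rw [key, key]
  rw [inner_latticeVec_single, inner_latticeVec_single]
  have := Complex.I_sq
  push_cast
  linear_combination (4 * (Real.pi : ℂ) ^ 2 * ((k 0 : ℂ) ^ 2 + (k 1 : ℂ) ^ 2) *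
    mFourier k (toTorus x)) * this

/-! ### The Schrödinger flow in Fourier variables -/

section HomogeneousBound

variable {G : Type} [AddCommGroup G] {K : G → G → ℂ} {M : G → ℝ} {a b : G → ℂ}

/-- Rescaling both vectors to unit size turns the arithmetic mean of Schur's test into a product.
The bound has to be linear in the size of the potential when Duhamel's formula is used. -/
lemma SchurBound.norm_form_le_mul (hK : SchurBound K M) {A B : ℝ} (hA : 0 < A) (hB : 0 < B)
    (ha : SqBound a (A ^ 2)) (hb : SqBound b (B ^ 2)) :
    ‖form K a b‖ ≤ (∑' k, M k) * (A * B) := by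
  have scale : ∀ {c : G → ℂ} {C : ℝ}, 0 < C → SqBound c (C ^ 2) →
      SqBound (fun m => (C : ℂ)⁻¹ * c m) 1 := by
    intro c C hC hc
    have e : ∀ m, ‖(C : ℂ)⁻¹ * c m‖ ^ 2 = (C ^ 2)⁻¹ * ‖c m‖ ^ 2 := fun m => by
      rw [norm_mul, norm_inv, Complex.norm_real, Real.norm_of_nonneg hC.le, mul_pow, inv_pow]
    constructor
    · simpa only [e] using hc.summable.mul_left _
    · simp only [e]
      rw [tsum_mul_left, inv_mul_le_iff₀ (by positivity), mul_one]
      exact hc.le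
  have h := hK.norm_form_le (scale hA ha) (scale hB hb)
  have e : form K a b = (A : ℂ) * B *
      form K (fun m => (A : ℂ)⁻¹ * a m) (fun m => (B : ℂ)⁻¹ * b m) := by
    have hA' : (A : ℂ) ≠ 0 := by exact_mod_cast hA.ne'
    have hB' : (B : ℂ) ≠ 0 := by exact_mod_cast hB.ne'
    rw [form, form, ← tsum_mul_left]
    refine tsum_congr fun p => ?_
    simp only [map_mul, map_inv₀, Complex.conj_ofReal]
    field_simp
  rw [e, norm_mul, norm_mul, Complex.norm_real, Complex.norm_real, Real.norm_of_nonneg hA.le,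
    Real.norm_of_nonneg hB.le]
  norm_num at h
  nlinarith [mul_pos hA hB]

end HomogeneousBound

/-- The symbol of `-ħ²Δ/2` in Fourier variables. -/
def energy (ħ : ℝ) (m : Fin 2 → ℤ) : ℝ := 2 * Real.pi ^ 2 * ħ ^ 2 * ((m 0 : ℝ) ^ 2 + (m 1 : ℝ) ^ 2)

/-- The Schrödinger equation with potential `g`, in Fourier variables. -/
structure IsFlow (ħ : ℝ) (g : C(Torus, ℂ)) (v : ℝ → L2) : Prop where
  continuous : Continuous v
  hasDerivAt : ∀ m s, HasDerivAt (fun s => mFourierCoeff (v s) m)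
    ((energy ħ m * mFourierCoeff (v s) m + mFourierCoeff (mulL2 g (v s)) m) / (Complex.I * ħ)) s

/-- Real potentials with a summable Fourier series. -/
structure IsPotential (g : C(Torus, ℂ)) : Prop where
  conj : ∀ x, (starRingEnd ℂ) (g x) = g x
  summable : Summable (mFourierCoeff g)

lemma IsPotential.coeff_neg {g : C(Torus, ℂ)} (hg : IsPotential g) (j : Fin 2 → ℤ) :
    mFourierCoeff g (-j) = (starRingEnd ℂ) (mFourierCoeff g j) := by
  rw [mFourierCoeff_eq, mFourierCoeff_eq, ← integral_conj]
  congr 1; ext x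
  rw [map_mul, hg.conj, ← mFourier_neg]

/-- The weak equation is tested on the exponential of frequency `-m`, which is an eigenfunction of
the Laplacian. -/
lemma IsSchrodingerSolution.isFlow {ħ ε : ℝ} (hħ : ħ ≠ 0) {V : Torus → ℝ} {u : L2} {v : ℝ → L2}
    (h : IsSchrodingerSolution ħ ε V u v) {g : C(Torus, ℂ)}
    (hg : ∀ x, g x = (ε : ℂ) ^ 2 * (V x : ℂ)) : IsFlow ħ g v := by
  refine ⟨h.continuous, fun m s => ?_⟩
  have h1 := h.equation (mFourier (-m)) (smoothOnTorus_mFourier _) s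
  have hI : (Complex.I * (ħ : ℂ)) ≠ 0 := mul_ne_zero Complex.I_ne_zero (by exact_mod_cast hħ)
  have h2 := h1.div_const (Complex.I * ħ)
  simp only [mul_div_cancel_left₀ _ hI] at h2
  convert! h2 using 1
  congr 1
  rw [mFourierCoeff_mulL2, mFourierCoeff_eq, mFourierCoeff_eq, ← integral_const_mul,
    ← integral_add]
  · congr 1; ext x
    rw [schrodingerOp, torusLaplacian_mFourier, hg, energy]
    simp only [Pi.neg_apply]
    push_cast
    ring
  · have hu : Integrable (fun x => v s x) torusMeasure := (Lp.memLp (v s)).integrable (by norm_num)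
    exact (hu.bdd_mul (c := 1) (mFourier (-m)).continuous.aestronglyMeasurable
      (Eventually.of_forall fun x => (norm_mFourier_apply _ x).le)).const_mul _
  · have hu : Integrable (fun x => g x * v s x) torusMeasure :=
      ((Lp.memLp (mulL2 g (v s))).integrable (by norm_num)).congr (coeFn_mulL2 g (v s))
    exact hu.bdd_mul (c := 1) (mFourier (-m)).continuous.aestronglyMeasurable
      (Eventually.of_forall fun x => (norm_mFourier_apply _ x).le)

lemma IsFlow.shift {ħ : ℝ} {g : C(Torus, ℂ)} {v : ℝ → L2} (h : IsFlow ħ g v) (r : ℝ) :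
    IsFlow ħ g fun s => v (s + r) :=
  ⟨h.continuous.comp (continuous_id.add continuous_const), fun m s =>
    (h.hasDerivAt m (s + r)).comp_add_const s r⟩

lemma exists_sqBound {g : C(Torus, ℂ)} {v : ℝ → L2} (hv : Continuous v) (s₁ s₂ : ℝ) :
    ∃ C, ∀ s ∈ Icc s₁ s₂, SqBound (mFourierCoeff (v s)) C ∧
      SqBound (mFourierCoeff (mulL2 g (v s))) C := by
  obtain ⟨c, hc⟩ := (isCompact_Icc (a := s₁) (b := s₂)).bddAbove_image hv.norm.continuousOn
  refine ⟨c ^ 2 + (‖g‖ * c) ^ 2, fun s hs => ?_⟩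
  have h1 : ‖v s‖ ≤ c := hc ⟨s, hs, rfl⟩
  have h2 : ‖v s‖ ^ 2 ≤ c ^ 2 := pow_le_pow_left₀ (norm_nonneg _) h1 2
  have h3 : ‖mulL2 g (v s)‖ ^ 2 ≤ (‖g‖ * c) ^ 2 := pow_le_pow_left₀ (norm_nonneg _)
    ((norm_mulL2_le g (v s)).trans (mul_le_mul_of_nonneg_left h1 (norm_nonneg _))) 2
  exact ⟨(sqBound_coeff _).mono (by nlinarith [sq_nonneg (‖g‖ * c)]),
    (sqBound_coeff _).mono (by nlinarith [sq_nonneg c])⟩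

lemma schurBound_one : SchurBound (G := Fin 2 → ℤ) (idKernel 1) fun k => if k = 0 then 1 else 0 :=
  schurBound_idKernel fun m => by simp

lemma schurBound_energy_one (ħ : ℝ) :
    SchurBound (fun m m' => ((energy ħ m - energy ħ m' : ℝ) : ℂ) / (Complex.I * ħ) * idKernel 1 m m')
      fun _ => 0 where
  summable := summable_zero
  le m m' := by
    by_cases h : m = m'
    · simp [h]
    · simp [idKernel, h]

lemma energy_mul_idKernel (ħ : ℝ) :
    (fun m m' : Fin 2 → ℤ =>
      ((energy ħ m - energy ħ m' : ℝ) : ℂ) / (Complex.I * ħ) * idKernel 1 m m') = fun _ _ => 0 := by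
  ext m m'
  by_cases h : m = m'
  · simp [h]
  · simp [idKernel, h]

lemma form_zero {a b : (Fin 2 → ℤ) → ℂ} : form (fun _ _ => 0) a b = 0 := by simp [form]

/-- Unitarity. The kernel of the identity is diagonal, which kills the kinetic term, and invariant
under simultaneous shifts, which kills the commutator with a real potential. Two different solutions
are allowed, so that a solution can be paired with its own time translate. -/
lemma IsFlow.form_one_const {ħ : ℝ} {g : C(Torus, ℂ)} {v w : ℝ → L2} (hg : IsPotential g)
    (hv : IsFlow ħ g v) (hw : IsFlow ħ g w) (s₁ s₂ : ℝ) :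
    form (idKernel 1) (mFourierCoeff (v s₁)) (mFourierCoeff (w s₁)) =
      form (idKernel 1) (mFourierCoeff (v s₂)) (mFourierCoeff (w s₂)) := by
  wlog hs : s₁ ≤ s₂ generalizing s₁ s₂
  · exact (this s₂ s₁ (le_of_not_ge hs)).symm
  obtain ⟨C₁, h₁⟩ := exists_sqBound (g := g) hv.continuous s₁ s₂
  obtain ⟨C₂, h₂⟩ := exists_sqBound (g := g) hw.continuous s₁ s₂
  have h := (form_evolution (C := max C₁ C₂) hs hv.hasDerivAt hw.hasDerivAt
    (continuous_mFourierCoeff_mulL2 g hv.continuous)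
    (continuous_mFourierCoeff_mulL2 g hw.continuous)
    (fun s hs => (h₁ s hs).1.mono (le_max_left _ _))
    (fun s hs => (h₂ s hs).1.mono (le_max_right _ _))
    (fun s hs => (h₁ s hs).2.mono (le_max_left _ _))
    (fun s hs => (h₂ s hs).2.mono (le_max_right _ _))
    schurBound_one (schurBound_energy_one ħ)).2
  have h0 : ∀ s, form (idKernel 1) (mFourierCoeff (mulL2 g (v s))) (mFourierCoeff (w s)) -
      form (idKernel 1) (mFourierCoeff (v s)) (mFourierCoeff (mulL2 g (w s))) = 0 := fun s => by
    have := norm_form_commutator_le (M' := fun _ => 0) (L := fun _ => 0) (S := 0) schurBound_one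
      (sqBound_coeff (v s)) (sqBound_coeff (w s)) hg.summable.norm hg.coeff_neg
      (hasSum_mFourierCoeff_mulL2 hg.summable (v s)) (hasSum_mFourierCoeff_mulL2 hg.summable (w s))
      summable_zero (fun j m m' => by simp [idKernel]) (by simp)
    rw [zero_mul] at this
    exact norm_le_zero_iff.1 this
  simp only [energy_mul_idKernel, form_zero, h0, zero_div, add_zero,
    intervalIntegral.integral_zero] at h
  exact (sub_eq_zero.1 h).symm

lemma form_one_self (u : L2) :
    form (idKernel 1) (mFourierCoeff u) (mFourierCoeff u) = ((‖u‖ ^ 2 : ℝ) : ℂ) := by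
  rw [form_idKernel, ← (hasSum_sq_coeff u).tsum_eq, Complex.ofReal_tsum]
  refine tsum_congr fun m => ?_
  rw [Pi.one_apply, one_mul, Complex.mul_conj, Complex.normSq_eq_norm_sq]

lemma IsFlow.norm_eq {ħ : ℝ} {g : C(Torus, ℂ)} {v : ℝ → L2} (hg : IsPotential g)
    (hv : IsFlow ħ g v) (s : ℝ) : ‖v s‖ = ‖v 0‖ := by
  have h := hv.form_one_const hg hv s 0
  rw [form_one_self, form_one_self, Complex.ofReal_inj] at h
  exact (pow_left_inj₀ (norm_nonneg _) (norm_nonneg _) two_ne_zero).1 h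

/-! ### Energy localization -/

/-- The characteristic function of the energy distribution. -/
def energyChar (ħ : ℝ) (u : L2) (σ : ℝ) : ℂ :=
  ∑' m, ((‖mFourierCoeff u m‖ ^ 2 : ℝ) : ℂ) * Complex.exp (-(Complex.I * (energy ħ m * σ : ℝ)))

/-- Duhamel's formula: the pairing of the solution with a free solution evolves only through the
potential, at speed at most `B / ħ`, during a time `ħ σ`. -/
lemma IsFlow.norm_energyChar_sub_le {ħ : ℝ} (hħ : 0 < ħ) {g : C(Torus, ℂ)} {v : ℝ → L2}
    (hg : IsPotential g) (hv : IsFlow ħ g v) (h0 : ‖v 0‖ = 1) {B : ℝ} (hB : 0 < B) (hgB : ‖g‖ ≤ B)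
    (s : ℝ) {σ : ℝ} (hσ : 0 ≤ σ) :
    ‖form (idKernel 1) (mFourierCoeff (v (s + ħ * σ))) (mFourierCoeff (v s)) -
      energyChar ħ (v s) σ‖ ≤ σ * B := by
  have hu : ∀ s, ‖v s‖ = 1 := fun s => (hv.norm_eq hg s).trans h0
  let r := ħ * σ
  have hr : 0 ≤ r := by positivity
  have hħ' : (ħ : ℂ) ≠ 0 := by exact_mod_cast hħ.ne'
  -- The free solution equal to `v s` at time `r = ħ σ`. Paired with `v (r' + s)`, it gives the time
  -- correlation at `r' = r` and the characteristic function of the energy at `r' = 0`.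
  let β : ℝ → (Fin 2 → ℤ) → ℂ := fun r' m =>
    Complex.exp (-(Complex.I * ((energy ħ m / ħ * (r' - r) : ℝ) : ℂ))) * mFourierCoeff (v s) m
  have hβd : ∀ m r', HasDerivAt (fun r' => β r' m)
      ((energy ħ m * β r' m + 0) / (Complex.I * ħ)) r' := by
    intro m r'
    have h1 : HasDerivAt (fun r' : ℝ => (energy ħ m / ħ * (r' - r) : ℝ)) (energy ħ m / ħ) r' := by
      simpa using ((hasDerivAt_id r').sub_const r).const_mul (energy ħ m / ħ)
    have h2 := ((h1.ofReal_comp.const_mul Complex.I).neg.cexp).mul_const (mFourierCoeff (v s) m)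
    convert! h2 using 1
    have hI2 := Complex.I_sq
    have hI := Complex.I_ne_zero
    simp only [β, Pi.neg_apply]
    push_cast
    field_simp
    rw [hI2]
    ring
  have hvs := hv.shift s
  have hβn : ∀ r' m, ‖β r' m‖ = ‖mFourierCoeff (v s) m‖ := fun r' m => by
    simp only [β]
    rw [norm_mul, mul_comm Complex.I, ← neg_mul, ← Complex.ofReal_neg,
      Complex.norm_exp_ofReal_mul_I, one_mul]
  have hαb : ∀ r', SqBound (mFourierCoeff (v (r' + s))) 1 := fun r' => by
    simpa [hu] using sqBound_coeff (v (r' + s))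
  have hβb : ∀ r', SqBound (β r') 1 := fun r' =>
    SqBound.smul_le (by simpa [hu] using sqBound_coeff (v s)) fun m => (hβn r' m).le
  have hfb : ∀ r', SqBound (mFourierCoeff (mulL2 g (v (r' + s)))) (B ^ 2) := fun r' =>
    (sqBound_coeff _).mono <| pow_le_pow_left₀ (norm_nonneg _)
      ((norm_mulL2_le g _).trans (by rwa [hu, mul_one])) 2
  have hzb : SqBound (fun _ : Fin 2 → ℤ => (0 : ℂ)) (max 1 (B ^ 2)) :=
    ⟨by simp, by simp⟩
  have h := (form_evolution (C := max 1 (B ^ 2)) (g := fun _ _ => 0) hr hvs.hasDerivAt hβd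
    (continuous_mFourierCoeff_mulL2 g hvs.continuous) (fun _ => continuous_const)
    (fun r' _ => (hαb r').mono (le_max_left _ _)) (fun r' _ => (hβb r').mono (le_max_left _ _))
    (fun r' _ => (hfb r').mono (le_max_right _ _)) (fun _ _ => hzb)
    schurBound_one (schurBound_energy_one ħ)).2
  have e1 : form (idKernel 1) (mFourierCoeff (v (r + s))) (β r) =
      form (idKernel 1) (mFourierCoeff (v (s + ħ * σ))) (mFourierCoeff (v s)) := by
    have : β r = mFourierCoeff (v s) := by ext m; simp [β]
    rw [this, add_comm r s]
  have e2 : form (idKernel 1) (mFourierCoeff (v (0 + s))) (β 0) = energyChar ħ (v s) σ := by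
    rw [form_idKernel, zero_add, energyChar]
    refine tsum_congr fun m => ?_
    simp only [β, Pi.one_apply, one_mul, map_mul, ← Complex.exp_conj, map_neg, Complex.conj_I,
      Complex.conj_ofReal]
    rw [mul_comm (Complex.exp _), ← mul_assoc, Complex.mul_conj, Complex.normSq_eq_norm_sq]
    congr 2
    have : energy ħ m / ħ * (0 - r) = -(energy ħ m * σ) := by
      simp only [r]; field_simp; ring
    rw [this]
    push_cast
    ring
  rw [e1, e2] at h
  rw [h]
  have h3 := intervalIntegral.norm_integral_le_of_norm_le_const (a := 0) (b := r) (C := B / ħ)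
    (f := fun s_1 => form (fun m m' : Fin 2 → ℤ => ((energy ħ m - energy ħ m' : ℝ) : ℂ) /
        (Complex.I * ħ) * idKernel 1 m m') (mFourierCoeff (v (s_1 + s))) (β s_1) +
      (form (idKernel 1) (mFourierCoeff (mulL2 g (v (s_1 + s)))) (β s_1) -
        form (idKernel 1) (mFourierCoeff (v (s_1 + s))) fun _ => 0) / (Complex.I * ħ))
    fun r' _ => by
      have hz : form (idKernel 1) (mFourierCoeff (v (r' + s))) (fun _ => 0) = 0 := by simp [form]
      rw [energy_mul_idKernel, form_zero, zero_add, hz, sub_zero, norm_div, norm_mul,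
        Complex.norm_I, one_mul, Complex.norm_real, Real.norm_of_nonneg hħ.le]
      gcongr
      have := schurBound_one.norm_form_le_mul hB one_pos (hfb r') (by simpa using hβb r')
      simpa using this
  refine h3.trans (le_of_eq ?_)
  rw [sub_zero, abs_of_nonneg hr]
  simp only [r]
  field_simp

/-- The Laplace transform at `M` of `exp(-iEσ)` is `1 / (M + iE)`, whose real part is `M / (M² +
E²)`: a nonnegative weight concentrated on energies at most of order `M`. -/
lemma integral_exp_mul_energyChar {ħ M : ℝ} (hM : 0 < M) (u : L2) :
    IntegrableOn (fun σ : ℝ => (Real.exp (-M * σ) : ℂ) * energyChar ħ u σ) (Ioi 0) ∧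
    (∫ σ in Ioi (0 : ℝ), (Real.exp (-M * σ) : ℂ) * energyChar ħ u σ).re =
      M⁻¹ * ∑' m, ‖mFourierCoeff u m‖ ^ 2 * (M ^ 2 / (M ^ 2 + energy ħ m ^ 2)) := by
  let F : (Fin 2 → ℤ) → ℝ → ℂ := fun m σ => ((‖mFourierCoeff u m‖ ^ 2 : ℝ) : ℂ) *
    Complex.exp ((-(M + Complex.I * energy ħ m)) * σ)
  have hre : ∀ m, (-(M + Complex.I * energy ħ m) : ℂ).re < 0 := fun m => by simp [hM]
  have hFi : ∀ m, IntegrableOn (F m) (Ioi 0) := fun m =>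
    (integrableOn_exp_mul_complex_Ioi (hre m) 0).const_mul _
  have hnorm : ∀ m σ, ‖F m σ‖ = ‖mFourierCoeff u m‖ ^ 2 * Real.exp (-M * σ) := fun m σ => by
    simp only [F]
    rw [norm_mul, Complex.norm_real, Real.norm_of_nonneg (sq_nonneg _), Complex.norm_exp]
    congr 2
    simp
  have hsN : Summable fun m => ∫ σ in Ioi (0 : ℝ), ‖F m σ‖ := by
    simp only [hnorm, integral_const_mul]
    exact (hasSum_sq_coeff u).summable.mul_right _
  have hts : ∀ σ, ∑' m, F m σ = (Real.exp (-M * σ) : ℂ) * energyChar ħ u σ := fun σ => by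
    rw [energyChar, ← tsum_mul_left]
    refine tsum_congr fun m => ?_
    simp only [F]
    rw [mul_left_comm]
    congr 1
    rw [Complex.ofReal_exp, ← Complex.exp_add]
    congr 1
    push_cast
    ring
  have h1 := hasSum_integral_of_summable_integral_norm hFi hsN
  simp only [hts] at h1
  have hval : ∀ m, (∫ σ in Ioi (0 : ℝ), F m σ).re =
      M⁻¹ * (‖mFourierCoeff u m‖ ^ 2 * (M ^ 2 / (M ^ 2 + energy ħ m ^ 2))) := fun m => by
    simp only [F]
    rw [integral_const_mul, integral_exp_mul_complex_Ioi (hre m), Complex.re_ofReal_mul]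
    have hpos : 0 < M ^ 2 + energy ħ m ^ 2 := by positivity
    have : (-Complex.exp (-(M + Complex.I * energy ħ m) * (0 : ℝ)) /
        (-(M + Complex.I * energy ħ m)) : ℂ).re = M / (M ^ 2 + energy ħ m ^ 2) := by
      rw [Complex.ofReal_zero, mul_zero, Complex.exp_zero, neg_div_neg_eq, one_div, Complex.inv_re,
        Complex.normSq_apply]
      simp
      ring
    rw [this]
    field_simp
  constructor
  · refine ⟨?_, ?_⟩
    · refine aestronglyMeasurable_of_tendsto_ae (u := (atTop : Filter (Finset (Fin 2 → ℤ))))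
        (f := fun S σ => ∑ m ∈ S, F m σ) (fun S => ?_) ?_
      · exact (integrable_finsetSum S fun m _ => hFi m).aestronglyMeasurable
      · refine Eventually.of_forall fun σ => ?_
        rw [← hts]
        have : Summable fun m => F m σ := by
          refine Summable.of_norm ?_
          simp only [hnorm]
          exact (hasSum_sq_coeff u).summable.mul_right _
        exact this.hasSum
    · have hb : ∀ σ, ‖(Real.exp (-M * σ) : ℂ) * energyChar ħ u σ‖ ≤
          ‖u‖ ^ 2 * Real.exp (-M * σ) := fun σ => by
        rw [← hts]
        refine (tsum_of_norm_bounded ((hasSum_sq_coeff u).mul_right (Real.exp (-M * σ))) ?_)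
        exact fun m => (hnorm m σ).le
      have hi : IntegrableOn (fun σ : ℝ => ‖u‖ ^ 2 * Real.exp (-M * σ)) (Ioi 0) :=
        (integrableOn_exp_mul_Ioi (neg_lt_zero.2 hM) 0).const_mul _
      exact hi.hasFiniteIntegral.mono (Eventually.of_forall fun σ => (hb σ).trans (le_abs_self _))
  · have h2 := Complex.hasSum_re h1
    simp only [hval] at h2
    rw [← tsum_mul_left]
    exact h2.tsum_eq.symm

/-- The characteristic functions of the energy at times `s` and `0` are both close to the same time
correlation, so they differ by at most `2Bσ` for every `s`. Integrating against `exp(-Mσ)` gives an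
estimate that does not deteriorate at long times, which is needed since the solution is observed at
times of order `τ_ħ`. -/
lemma IsFlow.low_energy_le {ħ : ℝ} (hħ : 0 < ħ) {g : C(Torus, ℂ)} {v : ℝ → L2}
    (hg : IsPotential g) (hv : IsFlow ħ g v) (h0 : ‖v 0‖ = 1) {B : ℝ} (hB : 0 < B) (hgB : ‖g‖ ≤ B)
    {M : ℝ} (hM : 0 < M) (s : ℝ) :
    ∑' m, ‖mFourierCoeff (v s) m‖ ^ 2 * (M ^ 2 / (M ^ 2 + energy ħ m ^ 2)) ≤
      ∑' m, ‖mFourierCoeff (v 0) m‖ ^ 2 * (M ^ 2 / (M ^ 2 + energy ħ m ^ 2)) + 2 * B / M := by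
  have hd : ∀ σ ∈ Ioi (0 : ℝ), ‖energyChar ħ (v s) σ - energyChar ħ (v 0) σ‖ ≤ 2 * B * σ := by
    intro σ hσ
    have h1 := hv.norm_energyChar_sub_le hħ hg h0 hB hgB s (le_of_lt hσ)
    have h2 := hv.norm_energyChar_sub_le hħ hg h0 hB hgB 0 (le_of_lt hσ)
    -- The pairing of the solution with its translate by `ħ σ` is conserved, so it may be evaluated
    -- at time `0`.
    have h3 := (hv.shift (ħ * σ)).form_one_const hg hv s 0
    rw [h3] at h1
    calc _ = ‖(form (idKernel 1) (mFourierCoeff (v (0 + ħ * σ))) (mFourierCoeff (v 0)) -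
          energyChar ħ (v 0) σ) - (form (idKernel 1) (mFourierCoeff (v (0 + ħ * σ)))
          (mFourierCoeff (v 0)) - energyChar ħ (v s) σ)‖ := by congr 1; ring
      _ ≤ σ * B + σ * B := (norm_sub_le _ _).trans (add_le_add h2 h1)
      _ = _ := by ring
  obtain ⟨i1, e1⟩ := integral_exp_mul_energyChar (ħ := ħ) hM (v s)
  obtain ⟨i2, e2⟩ := integral_exp_mul_energyChar (ħ := ħ) hM (v 0)
  have hG : ∫ σ in Ioi (0 : ℝ), σ * Real.exp (-M * σ) = 1 / M ^ 2 := by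
    have := Real.integral_rpow_mul_exp_neg_mul_Ioi (a := 2) (r := M) (by norm_num) hM
    norm_num at this
    rw [one_div, ← this]
    refine setIntegral_congr_fun measurableSet_Ioi fun σ _ => by simp
  -- Integrability is read off the value of the integral: the integral of a non-integrable function
  -- is `0` by convention, whereas here it is `1 / M²`.
  have hGi : IntegrableOn (fun σ : ℝ => σ * Real.exp (-M * σ)) (Ioi 0) := by
    by_contra h
    rw [integral_undef h] at hG
    exact (by positivity : (1 / M ^ 2 : ℝ) ≠ 0) hG.symm
  have key : ‖∫ σ in Ioi (0 : ℝ), ((Real.exp (-M * σ) : ℂ) * energyChar ħ (v s) σ -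
      (Real.exp (-M * σ) : ℂ) * energyChar ħ (v 0) σ)‖ ≤ 2 * B * (1 / M ^ 2) := by
    rw [← hG, ← integral_const_mul]
    refine norm_integral_le_of_norm_le (hGi.const_mul _) ?_
    filter_upwards [ae_restrict_mem measurableSet_Ioi] with σ hσ
    rw [← mul_sub, norm_mul, Complex.norm_real, Real.norm_of_nonneg (Real.exp_pos _).le]
    have := mul_le_mul_of_nonneg_left (hd σ hσ) (Real.exp_pos (-M * σ)).le
    linarith
  rw [integral_sub i1 i2] at key
  have h4 := (Complex.abs_re_le_norm _).trans key
  rw [Complex.sub_re, e1, e2, ← mul_sub] at h4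
  have h5 := (le_abs_self _).trans h4
  rw [inv_mul_le_iff₀ hM] at h5
  have : M * (2 * B * (1 / M ^ 2)) = 2 * B / M := by field_simp
  linarith

/-! ### The Weyl quantization in Fourier variables -/

section Weyl

open scoped FourierTransform

/-! ### Derivatives of partial functions on a product. -/

section Slices

variable {E F G : Type} [NormedAddCommGroup E] [NormedSpace ℝ E] [NormedAddCommGroup F]
  [NormedSpace ℝ F] [NormedAddCommGroup G] [NormedSpace ℝ G]

lemma iteratedFDeriv_slice_right {f : E × F → G} (hf : ContDiff ℝ ∞ f) (j : ℕ) (y : E) (ξ : F) :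
    iteratedFDeriv ℝ j (fun ξ => f (y, ξ)) ξ =
      (iteratedFDeriv ℝ j f (y, ξ)).compContinuousLinearMap
        fun _ => ContinuousLinearMap.inr ℝ E F := by
  have h1 : (fun ξ => f (y, ξ)) =
      (fun p : E × F => f ((y, 0) + p)) ∘ ContinuousLinearMap.inr ℝ E F := by
    ext ξ; simp
  have h2 : ContDiff ℝ ∞ fun p : E × F => f ((y, 0) + p) := hf.comp (contDiff_const.add contDiff_id)
  rw [h1, ContinuousLinearMap.iteratedFDeriv_comp_right _ h2 _ (by exact_mod_cast le_top),
    iteratedFDeriv_comp_add_left]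
  simp

lemma iteratedFDeriv_slice_left {f : E × F → G} (hf : ContDiff ℝ ∞ f) (j : ℕ) (y : E) (ξ : F) :
    iteratedFDeriv ℝ j (fun y => f (y, ξ)) y =
      (iteratedFDeriv ℝ j f (y, ξ)).compContinuousLinearMap
        fun _ => ContinuousLinearMap.inl ℝ E F := by
  have h1 : (fun y => f (y, ξ)) =
      (fun p : E × F => f ((0, ξ) + p)) ∘ ContinuousLinearMap.inl ℝ E F := by
    ext y; simp
  have h2 : ContDiff ℝ ∞ fun p : E × F => f ((0, ξ) + p) := hf.comp (contDiff_const.add contDiff_id)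
  rw [h1, ContinuousLinearMap.iteratedFDeriv_comp_right _ h2 _ (by exact_mod_cast le_top),
    iteratedFDeriv_comp_add_left]
  simp

lemma norm_compContinuousLinearMap_inl_le {j : ℕ}
    (g : ContinuousMultilinearMap ℝ (fun _ : Fin j => E × F) G) :
    ‖g.compContinuousLinearMap fun _ => ContinuousLinearMap.inl ℝ E F‖ ≤ ‖g‖ := by
  refine (g.norm_compContinuousLinearMap_le _).trans ?_
  refine mul_le_of_le_one_right (norm_nonneg _) ?_
  exact Finset.prod_le_one (fun _ _ => norm_nonneg _) fun _ _ =>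
    ContinuousLinearMap.norm_inl_le_one ℝ E F

lemma norm_compContinuousLinearMap_inr_le {j : ℕ}
    (g : ContinuousMultilinearMap ℝ (fun _ : Fin j => E × F) G) :
    ‖g.compContinuousLinearMap fun _ => ContinuousLinearMap.inr ℝ E F‖ ≤ ‖g‖ := by
  refine (g.norm_compContinuousLinearMap_le _).trans ?_
  refine mul_le_of_le_one_right (norm_nonneg _) ?_
  exact Finset.prod_le_one (fun _ _ => norm_nonneg _) fun _ _ =>
    ContinuousLinearMap.norm_inr_le_one ℝ E F

end Slices

/-- Smooth symbols on `T*𝕋²`, compactly supported in `ξ`. -/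
structure IsSymbol (b : Torus → Plane → ℂ) : Prop where
  contDiff : ContDiff ℝ ∞ fun q : Plane × Plane => b (toTorus q.1) q.2
  support : ∃ R : ℝ, ∀ x ξ, R < ‖ξ‖ → b x ξ = 0

variable {b : Torus → Plane → ℂ}

lemma IsSymbol.continuous (hb : IsSymbol b) : Continuous fun p : Torus × Plane => b p.1 p.2 :=
  (isOpenQuotientMap_toTorus.prodMap IsOpenQuotientMap.id).isQuotientMap.continuous_iff.2
    hb.contDiff.continuous

lemma IsSymbol.iteratedFDeriv_bounded (hb : IsSymbol b) (j : ℕ) :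
    ∃ C : ℝ, ∀ x ξ, ‖iteratedFDeriv ℝ j (b x) ξ‖ ≤ C := by
  obtain ⟨R, hR⟩ := hb.support
  let g : Torus × Plane → ContinuousMultilinearMap ℝ (fun _ : Fin j => Plane × Plane) ℂ := fun p =>
    iteratedFDeriv ℝ j (fun q : Plane × Plane => b (p.1 + toTorus q.1) q.2) (0, p.2)
  have hg : ∀ x ξ, g (toTorus x, ξ) =
      iteratedFDeriv ℝ j (fun q : Plane × Plane => b (toTorus q.1) q.2) (x, ξ) := fun x ξ => by
    simp only [g, ← toTorus_add]
    have := iteratedFDeriv_comp_add_left (𝕜 := ℝ)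
      (f := fun q : Plane × Plane => b (toTorus q.1) q.2) j ((x, 0) : Plane × Plane) (0, ξ)
    simpa using this
  have hc : Continuous g :=
    (isOpenQuotientMap_toTorus.prodMap IsOpenQuotientMap.id).isQuotientMap.continuous_iff.2 <| by
      refine (hb.contDiff.continuous_iteratedFDeriv (m := j) (by exact_mod_cast le_top)).congr ?_
      exact fun x => (hg x.1 x.2).symm
  obtain ⟨C, hC⟩ := ((isCompact_univ (X := Torus)).prod
    (isCompact_closedBall (0 : Plane) R)).bddAbove_image hc.norm.continuousOn
  refine ⟨max C 0, fun x ξ => ?_⟩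
  obtain ⟨x, rfl⟩ := surjective_toTorus x
  by_cases hξ : ‖ξ‖ ≤ R
  · refine le_trans ?_ (le_max_left _ _)
    have h1 := iteratedFDeriv_slice_right hb.contDiff j x ξ
    simp only at h1
    rw [h1]
    refine (norm_compContinuousLinearMap_inr_le _).trans ?_
    rw [← hg]
    exact hC ⟨(toTorus x, ξ), ⟨mem_univ _, by simpa using hξ⟩, rfl⟩
  · refine le_trans (le_of_eq ?_) (le_max_right _ _)
    have : b (toTorus x) =ᶠ[𝓝 ξ] fun _ => 0 := by
      filter_upwards [continuous_norm.isOpen_preimage _ isOpen_Ioi |>.mem_nhds (not_le.1 hξ)] with η hη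
      exact hR _ _ hη
    rw [(Filter.EventuallyEq.iteratedFDeriv (𝕜 := ℝ) this j).eq_of_nhds]
    have h0 : (fun _ : Plane => (0 : ℂ)) = 0 := rfl
    rw [h0, iteratedFDeriv_zero, Pi.zero_apply, norm_zero]

lemma IsSymbol.contDiff_slice (hb : IsSymbol b) (x : Torus) : ContDiff ℝ ∞ (b x) := by
  obtain ⟨x, rfl⟩ := surjective_toTorus x
  exact hb.contDiff.comp (contDiff_const.prodMk contDiff_id)

/-- The exponent `3` exceeds the dimension `2`, so the bound is integrable. It comes from three
derivatives in `ξ`, uniformly in `x` because the support in `ξ` and the derivatives are uniformly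
bounded. -/
lemma IsSymbol.norm_fourier_le (hb : IsSymbol b) :
    ∃ C : ℝ, 0 ≤ C ∧ ∀ x w, ‖𝓕 (b x) w‖ ≤ C * (1 + ‖w‖) ^ (-3 : ℝ) := by
  obtain ⟨R, hR⟩ := hb.support
  choose D hD using hb.iteratedFDeriv_bounded
  have hD0 : ∀ j, 0 ≤ D j := fun j => (norm_nonneg _).trans (hD j 0 0)
  have hsupp : ∀ j x ξ, ξ ∉ Metric.closedBall (0 : Plane) R → iteratedFDeriv ℝ j (b x) ξ = 0 := by
    intro j x ξ hξ
    have : b x =ᶠ[𝓝 ξ] fun _ => 0 := by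
      filter_upwards [Metric.isClosed_closedBall.isOpen_compl.mem_nhds hξ] with η hη
      exact hR _ _ (by simpa using hη)
    rw [(Filter.EventuallyEq.iteratedFDeriv (𝕜 := ℝ) this j).eq_of_nhds]
    have h0 : (fun _ : Plane => (0 : ℂ)) = 0 := rfl
    rw [h0, iteratedFDeriv_zero, Pi.zero_apply]
  have hcs : ∀ j x, HasCompactSupport (iteratedFDeriv ℝ j (b x)) := fun j x =>
    HasCompactSupport.intro (isCompact_closedBall (0 : Plane) R) (hsupp j x)
  have hci : ∀ j x, Continuous (iteratedFDeriv ℝ j (b x)) := fun j x =>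
    (hb.contDiff_slice x).continuous_iteratedFDeriv (by exact_mod_cast le_top)
  have hint : ∀ x (k n : ℕ), Integrable (fun v => ‖v‖ ^ k * ‖iteratedFDeriv ℝ n (b x) v‖) :=
    fun x k n => Continuous.integrable_of_hasCompactSupport
      ((continuous_norm.pow k).mul (hci n x).norm) (hcs n x).norm.mul_left
  let vol : ℝ := volume.real (Metric.closedBall (0 : Plane) R)
  have hle : ∀ x j, ∫ v : Plane, ‖iteratedFDeriv ℝ j (b x) v‖ ≤ D j * vol := fun x j => by
    rw [← setIntegral_eq_integral_of_forall_compl_eq_zero (s := Metric.closedBall (0 : Plane) R)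
      fun v hv => by rw [hsupp j x v hv, norm_zero]]
    have := setIntegral_mono_on (μ := volume) (s := Metric.closedBall (0 : Plane) R)
      (f := fun v => ‖iteratedFDeriv ℝ j (b x) v‖) (g := fun _ => D j)
      (by simpa using (hint x 0 j).integrableOn)
      (integrableOn_const (by exact (isCompact_closedBall (0 : Plane) R).measure_lt_top.ne))
      Metric.isClosed_closedBall.measurableSet fun v _ => hD j x v
    simpa [vol, mul_comm] using this
  have hn : ∀ n x w, ‖w‖ ^ n * ‖𝓕 (b x) w‖ ≤
      2 ^ n * ∑ j ∈ Finset.range (n + 1), D j * vol := by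
    intro n x w
    have h := Real.pow_mul_norm_iteratedFDeriv_fourier_le (K := ⊤) (N := ⊤) (k := 0) (n := n)
      (hb.contDiff_slice x) (fun k n _ _ => hint x k n) le_top le_top w
    simp only [norm_iteratedFDeriv_zero] at h
    refine h.trans ?_
    rw [Finset.sum_product]
    simp only [pow_zero, Nat.cast_zero, mul_zero, zero_add, one_mul, Finset.range_one,
      Finset.sum_singleton]
    gcongr with j _
    exact hle x j
  have hvol : 0 ≤ vol := measureReal_nonneg
  refine ⟨8 * (2 ^ 0 * ∑ j ∈ Finset.range (0 + 1), D j * vol +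
    2 ^ 3 * ∑ j ∈ Finset.range (3 + 1), D j * vol), ?_, fun x w => ?_⟩
  · have : ∀ n, 0 ≤ ∑ j ∈ Finset.range n, D j * vol := fun n =>
      Finset.sum_nonneg fun j _ => mul_nonneg (hD0 j) hvol
    have h1 := this (0 + 1)
    have h2 := this (3 + 1)
    positivity
  · have h0 := hn 0 x w
    have h3 := hn 3 x w
    rw [pow_zero, one_mul] at h0
    have hw : 0 < 1 + ‖w‖ := by positivity
    rw [Real.rpow_neg hw.le, ← div_eq_mul_inv, le_div_iff₀ (by positivity)]
    have e : (1 + ‖w‖) ^ (3 : ℝ) = (1 + ‖w‖) ^ 3 := by norm_cast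
    rw [e]
    have hle : (1 + ‖w‖) ^ 3 ≤ 8 * (1 + ‖w‖ ^ 3) := by
      have := norm_nonneg w
      nlinarith [mul_nonneg (sq_nonneg (‖w‖ - 1)) this, sq_nonneg (‖w‖ - 1),
        mul_nonneg (sq_nonneg (‖w‖ - 1)) (by positivity : 0 ≤ ‖w‖ + 1)]
    calc ‖𝓕 (b x) w‖ * (1 + ‖w‖) ^ 3 ≤ ‖𝓕 (b x) w‖ * (8 * (1 + ‖w‖ ^ 3)) :=
          mul_le_mul_of_nonneg_left hle (norm_nonneg _)
      _ = 8 * (‖𝓕 (b x) w‖ + ‖w‖ ^ 3 * ‖𝓕 (b x) w‖) := by ring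
      _ ≤ _ := by linarith

lemma IsSymbol.norm_fourierInv_le (hb : IsSymbol b) :
    ∃ C : ℝ, 0 ≤ C ∧ ∀ x w, ‖𝓕⁻ (b x) w‖ ≤ C * (1 + ‖w‖) ^ (-3 : ℝ) := by
  obtain ⟨C, hC0, hC⟩ := hb.norm_fourier_le
  refine ⟨C, hC0, fun x w => ?_⟩
  rw [Real.fourierInv_eq_fourier_neg]
  simpa using hC x (-w)

/-- The oscillatory integral in the kernel of the Weyl quantization. -/
def oscKernel (ħ : ℝ) (b : Torus → Plane → ℂ) (y : Torus) (z : Plane) : ℂ :=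
  ∫ ξ : Plane, Complex.exp (Complex.I * ((inner ℝ z ξ / ħ : ℝ) : ℂ)) * b y ξ

lemma oscKernel_eq (ħ : ℝ) (b : Torus → Plane → ℂ) (y : Torus) (z : Plane) :
    oscKernel ħ b y z = 𝓕⁻ (b y) ((2 * Real.pi * ħ)⁻¹ • z) := by
  rw [Real.fourierInv_eq', oscKernel]
  congr 1; ext ξ
  rw [smul_eq_mul, inner_smul_right, real_inner_comm z ξ, mul_comm Complex.I]
  congr 4
  have := Real.pi_pos.ne'
  by_cases hħ : ħ = 0
  · simp [hħ]
  field_simp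

lemma IsSymbol.continuous_oscKernel (hb : IsSymbol b) (ħ : ℝ) :
    Continuous fun p : Torus × Plane => oscKernel ħ b p.1 p.2 := by
  obtain ⟨R, hR⟩ := hb.support
  obtain ⟨C, hC⟩ := hb.iteratedFDeriv_bounded 0
  simp only [norm_iteratedFDeriv_zero] at hC
  have hc := hb.continuous
  refine continuous_of_dominated (bound := (Metric.closedBall (0 : Plane) R).indicator fun _ => C)
    (fun p => ?_) (fun p => Eventually.of_forall fun ξ => ?_) ?_
    (Eventually.of_forall fun ξ => ?_)
  · have : Continuous fun ξ => b p.1 ξ := hc.comp (continuous_const.prodMk continuous_id)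
    exact Continuous.aestronglyMeasurable (by fun_prop)
  · rw [norm_mul, mul_comm Complex.I, Complex.norm_exp_ofReal_mul_I, one_mul]
    by_cases hξ : ξ ∈ Metric.closedBall (0 : Plane) R
    · rw [indicator_of_mem hξ]; exact hC _ _
    · rw [indicator_of_notMem hξ, hR _ _ (by simpa using hξ), norm_zero]
  · rw [integrable_indicator_iff Metric.isClosed_closedBall.measurableSet]
    exact integrableOn_const (by exact (isCompact_closedBall (0 : Plane) R).measure_lt_top.ne)
  · have : Continuous fun p : Torus × Plane => b p.1 ξ :=
      hc.comp (continuous_fst.prodMk continuous_const)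
    fun_prop

/-! ### Boundedness on `L²` of the Weyl form at fixed `ħ`. -/

lemma measurePreserving_shear :
    MeasurePreserving (fun p : Torus × Plane => (p.1 - toTorus p.2, p.2))
      (torusMeasure.prod volume) (torusMeasure.prod volume) := by
  have h1 : MeasurePreserving (fun p : Plane × Torus => (p.1, p.2 - toTorus p.1))
      ((volume : Measure Plane).prod torusMeasure) ((volume : Measure Plane).prod torusMeasure) := by
    refine MeasurePreserving.skew_product (g := fun z x => x - toTorus z)
      (MeasurePreserving.id _) ?_ ?_
    · exact (Continuous.sub continuous_snd (continuous_toTorus.comp continuous_fst)).measurable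
    · exact Eventually.of_forall fun z => (measurePreserving_sub_right torusMeasure (toTorus z)).map_eq
  exact (Measure.measurePreserving_swap (μ := (volume : Measure Plane)) (ν := torusMeasure)).comp
    (h1.comp Measure.measurePreserving_swap)

/-- The integrand of the sesquilinear form of the Weyl quantization. -/
def weylIntegrand (ħ : ℝ) (b : Torus → Plane → ℂ) (f g : Torus → ℂ) (p : Torus × Plane) : ℂ :=
  (starRingEnd ℂ) (f p.1) * (oscKernel ħ b (p.1 - toTorus ((2⁻¹ : ℝ) • p.2)) p.2 *
    g (p.1 - toTorus p.2))

/-- The oscillatory kernel is dominated by an integrable function `κ` of `z` alone, whatever its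
base point. Young's inequality splits the product of the two functions, and the shear `(x, z) ↦ (x -
z, z)` preserves the product measure. The constant may depend on `ħ`: it only serves the density
argument that identifies the form. -/
lemma IsSymbol.weylIntegrand_bound (hb : IsSymbol b) {ħ : ℝ} (hħ : 0 < ħ) :
    ∃ C : ℝ, 0 ≤ C ∧ ∀ f g : Torus → ℂ, MemLp f 2 torusMeasure → MemLp g 2 torusMeasure →
      Integrable (weylIntegrand ħ b f g) (torusMeasure.prod volume) ∧
      ‖∫ p, weylIntegrand ħ b f g p ∂(torusMeasure.prod volume)‖ ≤
        C * ((∫ x, ‖f x‖ ^ 2 ∂torusMeasure + ∫ x, ‖g x‖ ^ 2 ∂torusMeasure) / 2) := by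
  obtain ⟨C, hC0, hC⟩ := hb.norm_fourierInv_le
  let κ : Plane → ℝ := fun z => C * (1 + ‖(2 * Real.pi * ħ)⁻¹ • z‖) ^ (-3 : ℝ)
  have hκ0 : ∀ z, 0 ≤ κ z := fun z => by positivity
  have hκ : Integrable κ := by
    have h1 : Integrable (fun w : Plane => (1 + ‖w‖) ^ (-3 : ℝ)) :=
      integrable_one_add_norm (by simp; norm_num)
    exact (h1.comp_smul (R := (2 * Real.pi * ħ)⁻¹) (by positivity)).const_mul C
  have hk : ∀ y z, ‖oscKernel ħ b y z‖ ≤ κ z := fun y z => by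
    rw [oscKernel_eq]; exact hC _ _
  refine ⟨∫ z, κ z, integral_nonneg hκ0, fun f g hf hg => ?_⟩
  have hf2 : Integrable (fun x => ‖f x‖ ^ 2) torusMeasure := hf.integrable_norm_pow (by norm_num)
  have hg2 : Integrable (fun x => ‖g x‖ ^ 2) torusMeasure := hg.integrable_norm_pow (by norm_num)
  have i1 : Integrable (fun p : Torus × Plane => ‖f p.1‖ ^ 2 * κ p.2) (torusMeasure.prod volume) :=
    hf2.mul_prod hκ
  have i2' : Integrable (fun p : Torus × Plane => ‖g p.1‖ ^ 2 * κ p.2)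
      (torusMeasure.prod volume) := hg2.mul_prod hκ
  have i2 : Integrable (fun p : Torus × Plane => ‖g (p.1 - toTorus p.2)‖ ^ 2 * κ p.2)
      (torusMeasure.prod volume) := measurePreserving_shear.integrable_comp_of_integrable i2'
  have e2 : ∫ p : Torus × Plane, ‖g (p.1 - toTorus p.2)‖ ^ 2 * κ p.2 ∂(torusMeasure.prod volume) =
      ∫ p : Torus × Plane, ‖g p.1‖ ^ 2 * κ p.2 ∂(torusMeasure.prod volume) := by
    have := integral_map (μ := torusMeasure.prod (volume : Measure Plane))
      measurePreserving_shear.measurable.aemeasurable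
      (f := fun p : Torus × Plane => ‖g p.1‖ ^ 2 * κ p.2)
      (by rw [measurePreserving_shear.map_eq]; exact i2'.aestronglyMeasurable)
    rw [measurePreserving_shear.map_eq] at this
    exact this.symm
  have hmaj : ∀ p, ‖weylIntegrand ħ b f g p‖ ≤
      (‖f p.1‖ ^ 2 * κ p.2 + ‖g (p.1 - toTorus p.2)‖ ^ 2 * κ p.2) / 2 := fun p => by
    unfold weylIntegrand
    rw [norm_mul, norm_mul, RCLike.norm_conj]
    have h1 := hk (p.1 - toTorus ((2⁻¹ : ℝ) • p.2)) p.2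
    have h2 : ‖oscKernel ħ b (p.1 - toTorus ((2⁻¹ : ℝ) • p.2)) p.2‖ *
        (‖f p.1‖ * ‖g (p.1 - toTorus p.2)‖) ≤ κ p.2 * (‖f p.1‖ * ‖g (p.1 - toTorus p.2)‖) :=
      mul_le_mul_of_nonneg_right h1 (by positivity)
    nlinarith [mul_nonneg (hκ0 p.2) (sq_nonneg (‖f p.1‖ - ‖g (p.1 - toTorus p.2)‖))]
  have hmeas : AEStronglyMeasurable (weylIntegrand ħ b f g) (torusMeasure.prod volume) := by
    refine AEStronglyMeasurable.mul ?_ (AEStronglyMeasurable.mul ?_ ?_)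
    · exact Complex.continuous_conj.comp_aestronglyMeasurable
        (hf.1.comp_quasiMeasurePreserving Measure.quasiMeasurePreserving_fst)
    · have h1 : Continuous fun p : Torus × Plane =>
          (p.1 - toTorus ((2⁻¹ : ℝ) • p.2), p.2) := by
        have := continuous_toTorus
        fun_prop
      exact ((hb.continuous_oscKernel ħ).comp h1).aestronglyMeasurable
    · exact hg.1.comp_quasiMeasurePreserving (Measure.quasiMeasurePreserving_fst.comp
        measurePreserving_shear.quasiMeasurePreserving)
  have hI := (i1.add i2).div_const 2
  refine ⟨hI.mono' hmeas (Eventually.of_forall hmaj), ?_⟩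
  refine (norm_integral_le_of_norm_le hI (Eventually.of_forall hmaj)).trans (le_of_eq ?_)
  have e3 : ∀ φ : Torus → ℝ, ∫ p : Torus × Plane, φ p.1 * κ p.2 ∂(torusMeasure.prod volume) =
      (∫ x, φ x ∂torusMeasure) * ∫ z, κ z := fun φ => integral_prod_mul φ κ
  have e4 : ∫ p : Torus × Plane, ((fun p : Torus × Plane => ‖f p.1‖ ^ 2 * κ p.2) +
      fun p : Torus × Plane => ‖g (p.1 - toTorus p.2)‖ ^ 2 * κ p.2) p / 2
      ∂(torusMeasure.prod volume) =
      (∫ p : Torus × Plane, ‖f p.1‖ ^ 2 * κ p.2 ∂(torusMeasure.prod volume) +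
      ∫ p : Torus × Plane, ‖g (p.1 - toTorus p.2)‖ ^ 2 * κ p.2 ∂(torusMeasure.prod volume)) / 2 := by
    rw [integral_div]
    congr 1
    exact integral_add i1 i2
  rw [e4, e2, e3 fun x => ‖f x‖ ^ 2, e3 fun x => ‖g x‖ ^ 2]
  ring

/-- The matrix of the Weyl quantization in the basis of exponentials. -/
def symbolKernel (ħ : ℝ) (b : Torus → Plane → ℂ) (m m' : Fin 2 → ℤ) : ℂ :=
  mFourierCoeff (fun x => b x ((Real.pi * ħ) • latticeVec (m + m'))) (m' - m)

lemma memLp_of_continuous {f : Torus → ℂ} (hf : Continuous f) : MemLp f 2 torusMeasure :=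
  hf.memLp_of_hasCompactSupport (HasCompactSupport.of_compactSpace _)

lemma IsSymbol.integral_mFourier_mul_oscKernel (hb : IsSymbol b) (ħ : ℝ) (k : Fin 2 → ℤ)
    (z : Plane) :
    ∫ x, mFourier (-k) x * oscKernel ħ b x z ∂torusMeasure =
      𝓕⁻ (fun ξ => mFourierCoeff (fun x => b x ξ) k) ((2 * Real.pi * ħ)⁻¹ • z) := by
  obtain ⟨R, hR⟩ := hb.support
  obtain ⟨C, hC⟩ := hb.iteratedFDeriv_bounded 0
  simp only [norm_iteratedFDeriv_zero] at hC
  simp only [oscKernel_eq, Real.fourierInv_eq', smul_eq_mul, mFourierCoeff_eq,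
    ← integral_const_mul]
  rw [integral_integral_swap]
  · refine integral_congr_ae (Eventually.of_forall fun ξ => ?_)
    refine integral_congr_ae (Eventually.of_forall fun x => ?_)
    simp only
    ring
  · refine Continuous.integrable_of_hasCompactSupport ?_ ?_
    · have := hb.continuous
      unfold Function.uncurry
      fun_prop
    · refine HasCompactSupport.intro ((isCompact_univ (X := Torus)).prod
        (isCompact_closedBall (0 : Plane) R)) fun p hp => ?_
      have : R < ‖p.2‖ := by simpa using hp
      simp [Function.uncurry, hR _ _ this]

/-- Translating `x` by `z/2` centres the symbol at `x`. The exponentials then combine into the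
character of frequency `m - m'` in `x` and a phase in `z` with frequency proportional to the
midpoint `(m + m')/2`. With `w = z/(2πħ)` the remaining integral is a Fourier transform of an
inverse Fourier transform, evaluated at `πħ(m + m')`, and the Jacobian in dimension two cancels the
prefactor. -/
lemma IsSymbol.weyl_matrix (hb : IsSymbol b) {ħ : ℝ} (hħ : 0 < ħ) (m m' : Fin 2 → ℤ) :
    (((2 * Real.pi * ħ) ^ 2 : ℝ) : ℂ)⁻¹ *
      ∫ p, weylIntegrand ħ b (mFourier m') (mFourier m) p ∂(torusMeasure.prod volume) =
      symbolKernel ħ b m m' := by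
  obtain ⟨C, -, hC⟩ := hb.weylIntegrand_bound hħ
  have hint := (hC _ _ (memLp_of_continuous (mFourier m').continuous)
    (memLp_of_continuous (mFourier m).continuous)).1
  let β : Plane → ℂ := fun ξ => mFourierCoeff (fun x => b x ξ) (m' - m)
  have h1 : ∀ z : Plane, ∫ x, weylIntegrand ħ b (mFourier m') (mFourier m) (x, z) ∂torusMeasure =
      Complex.exp (((-2 * Real.pi * inner ℝ ((2 * Real.pi * ħ)⁻¹ • z)
        ((Real.pi * ħ) • latticeVec (m + m')) : ℝ) : ℂ) * Complex.I) *
        𝓕⁻ β ((2 * Real.pi * ħ)⁻¹ • z) := by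
    intro z
    rw [← hb.integral_mFourier_mul_oscKernel, ← integral_const_mul,
      ← integral_torus_add_right _ (toTorus ((2⁻¹ : ℝ) • z))]
    refine integral_congr_ae (Eventually.of_forall fun x => ?_)
    simp only [weylIntegrand, add_sub_cancel_right]
    obtain ⟨x, rfl⟩ := surjective_toTorus x
    have e : ∀ A B C D E : ℂ, A * C = D * E → A * (B * C) = D * (E * B) := by
      intro A B C D E h
      linear_combination B * h
    refine e _ _ _ _ _ ?_
    rw [← toTorus_add, ← toTorus_sub, ← mFourier_neg, mFourier_toTorus, mFourier_toTorus,
      mFourier_toTorus, ← Complex.exp_add, ← Complex.exp_add]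
    congr 1
    rw [latticeVec_neg, latticeVec_neg, latticeVec_sub, latticeVec_add]
    have hπ := Real.pi_pos.ne'
    have hi : inner ℝ ((2 * Real.pi * ħ)⁻¹ • z) ((Real.pi * ħ) • (latticeVec m + latticeVec m')) =
        2⁻¹ * (inner ℝ (latticeVec m) z + inner ℝ (latticeVec m') z) := by
      rw [real_inner_comm, inner_smul_left, inner_smul_right, inner_add_left]
      simp only [conj_trivial]
      field_simp
    rw [hi]
    simp only [inner_neg_left, inner_sub_left, inner_sub_right, inner_add_right, inner_smul_right]
    push_cast
    ring
  have hβc : Continuous β := by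
    have := hb.continuous
    simp only [β, mFourierCoeff_eq]
    obtain ⟨D, hD⟩ := hb.iteratedFDeriv_bounded 0
    simp only [norm_iteratedFDeriv_zero] at hD
    refine continuous_of_dominated (bound := fun _ => D) (fun ξ => ?_)
      (fun ξ => Eventually.of_forall fun x => ?_) (integrable_const _)
      (Eventually.of_forall fun x => ?_)
    · exact Continuous.aestronglyMeasurable (by fun_prop)
    · rw [norm_mul, norm_mFourier_apply, one_mul]; exact hD _ _
    · fun_prop
  obtain ⟨R, hR⟩ := hb.support
  have hβi : Integrable β := by
    refine hβc.integrable_of_hasCompactSupport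
      (HasCompactSupport.intro (isCompact_closedBall (0 : Plane) R) fun ξ hξ => ?_)
    have : R < ‖ξ‖ := by simpa using hξ
    simp [β, mFourierCoeff_eq, hR _ _ this]
  -- The inverse transform of `β` is an average over `x` of the oscillatory kernel against a
  -- character, so it inherits the decay of the kernel and `β` need not be differentiated.
  have hinv : ∀ w, ‖𝓕⁻ β w‖ ≤ hb.norm_fourierInv_le.choose * (1 + ‖w‖) ^ (-3 : ℝ) := by
    intro w
    have hbd := hb.norm_fourierInv_le.choose_spec.2
    have e := hb.integral_mFourier_mul_oscKernel ħ (m' - m) ((2 * Real.pi * ħ) • w)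
    rw [smul_smul, inv_mul_cancel₀ (by positivity), one_smul] at e
    rw [← e]
    refine (norm_integral_le_of_norm_le_const (C := hb.norm_fourierInv_le.choose *
      (1 + ‖w‖) ^ (-3 : ℝ)) (Eventually.of_forall fun x => ?_)).trans (by simp)
    rw [norm_mul, norm_mFourier_apply, one_mul, oscKernel_eq, smul_smul,
      inv_mul_cancel₀ (by positivity), one_smul]
    exact hbd x w
  have hfc : Continuous (𝓕 β) := VectorFourier.fourierIntegral_continuous
    Real.continuous_fourierChar (by exact continuous_inner) hβi
  have hfi : Integrable (𝓕 β) := by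
    have h1 : Integrable (fun w : Plane => hb.norm_fourierInv_le.choose * (1 + ‖w‖) ^ (-3 : ℝ)) :=
      (integrable_one_add_norm (by simp; norm_num)).const_mul _
    refine h1.mono' hfc.aestronglyMeasurable (Eventually.of_forall fun w => ?_)
    have := hinv (-w)
    rwa [Real.fourierInv_eq_fourier_neg, neg_neg, norm_neg] at this
  have hfin := hβc.fourier_fourierInv_eq hβi hfi
  rw [integral_prod_symm _ hint]
  simp only [h1]
  rw [Measure.integral_comp_smul volume (fun w : Plane => Complex.exp (((-2 * Real.pi * inner ℝ w
        ((Real.pi * ħ) • latticeVec (m + m')) : ℝ) : ℂ) * Complex.I) * 𝓕⁻ β w)]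
  have h2 := congrFun hfin ((Real.pi * ħ) • latticeVec (m + m'))
  rw [Real.fourier_eq'] at h2
  simp only [smul_eq_mul] at h2
  rw [h2]
  simp only [β, symbolKernel, finrank_euclideanSpace, Fintype.card_fin]
  rw [Complex.real_smul, ← mul_assoc, inv_pow, inv_inv, abs_of_pos (by positivity),
    inv_mul_cancel₀, one_mul]
  have : (2 * Real.pi * ħ) ^ 2 ≠ 0 := by positivity
  exact_mod_cast this

/-- The Weyl quantization as a sesquilinear form on functions. -/
def weylForm (ħ : ℝ) (b : Torus → Plane → ℂ) (f g : Torus → ℂ) : ℂ :=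
  (((2 * Real.pi * ħ) ^ 2 : ℝ) : ℂ)⁻¹ *
    ∫ p, weylIntegrand ħ b f g p ∂(torusMeasure.prod volume)

lemma IsSymbol.wigner_eq_weylForm (hb : IsSymbol b) {ħ : ℝ} (hħ : 0 < ħ) (u : L2) :
    wigner ħ b u = weylForm ħ b u u := by
  obtain ⟨C, -, hC⟩ := hb.weylIntegrand_bound hħ
  have hint := (hC u u (Lp.memLp u) (Lp.memLp u)).1
  rw [weylForm, integral_prod _ hint, wigner, ← integral_const_mul]
  refine integral_congr_ae (Eventually.of_forall fun x => ?_)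
  simp only [weyl, weylIntegrand, oscKernel]
  rw [integral_const_mul]
  ring

/-- Partial sums of a Fourier series. -/
def expSum (s : Finset (Fin 2 → ℤ)) (c : (Fin 2 → ℤ) → ℂ) (x : Torus) : ℂ :=
  ∑ m ∈ s, c m * mFourier m x

lemma continuous_expSum (s : Finset (Fin 2 → ℤ)) (c : (Fin 2 → ℤ) → ℂ) :
    Continuous (expSum s c) := by
  unfold expSum
  fun_prop

lemma IsSymbol.weylForm_expSum (hb : IsSymbol b) {ħ : ℝ} (hħ : 0 < ħ) (s : Finset (Fin 2 → ℤ))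
    (c : (Fin 2 → ℤ) → ℂ) :
    weylForm ħ b (expSum s c) (expSum s c) =
      ∑ m ∈ s, ∑ m' ∈ s, symbolKernel ħ b m m' * c m * (starRingEnd ℂ) (c m') := by
  obtain ⟨C, -, hC⟩ := hb.weylIntegrand_bound hħ
  have hint := fun m m' => (hC _ _ (memLp_of_continuous (mFourier m').continuous)
    (memLp_of_continuous (mFourier m).continuous)).1
  have e : weylIntegrand ħ b (expSum s c) (expSum s c) = fun p => ∑ m ∈ s, ∑ m' ∈ s,
      (c m * (starRingEnd ℂ) (c m')) * weylIntegrand ħ b (mFourier m') (mFourier m) p := by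
    ext p
    simp only [weylIntegrand, expSum, map_sum, map_mul]
    rw [Finset.sum_mul, Finset.sum_comm]
    refine Finset.sum_congr rfl fun m _ => ?_
    rw [Finset.mul_sum, Finset.mul_sum]
    refine Finset.sum_congr rfl fun m' _ => ?_
    ring
  rw [weylForm, e, integral_finsetSum _ fun m _ => integrable_finsetSum _ fun m' _ =>
    (hint m m').const_mul _, Finset.mul_sum]
  refine Finset.sum_congr rfl fun m _ => ?_
  rw [integral_finsetSum _ fun m' _ => (hint m m').const_mul _, Finset.mul_sum]
  refine Finset.sum_congr rfl fun m' _ => ?_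
  rw [integral_const_mul, ← hb.weyl_matrix hħ]
  ring

lemma tendsto_integral_sub_expSum (u : L2) :
    Tendsto (fun s => ∫ x, ‖u x - expSum s (mFourierCoeff u) x‖ ^ 2 ∂torusMeasure) atTop (𝓝 0) := by
  have h1 : Tendsto (fun s : Finset (Fin 2 → ℤ) => ‖u - ∑ m ∈ s, mFourierCoeff u m • expL2 m‖ ^ 2)
      atTop (𝓝 0) := by
    have h := (hasSum_expL2 u).const_sub u |>.norm.pow 2
    simpa using h
  refine h1.congr fun s => ?_
  have hn : ∀ w : L2, ‖w‖ ^ 2 = ∫ x, ‖w x‖ ^ 2 ∂torusMeasure := fun w => by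
    have h2 : RCLike.re (inner ℂ w w) = ‖w‖ ^ 2 := inner_self_eq_norm_sq (𝕜 := ℂ) w
    rw [← h2, L2.inner_def, ← integral_re (L2.integrable_inner w w)]
    refine integral_congr_ae (Eventually.of_forall fun x => ?_)
    exact inner_self_eq_norm_sq (𝕜 := ℂ) (w x)
  rw [hn]
  refine integral_congr_ae ?_
  have h3 : ∀ s : Finset (Fin 2 → ℤ), ⇑(∑ m ∈ s, mFourierCoeff u m • expL2 m : L2)
      =ᵐ[torusMeasure] expSum s (mFourierCoeff u) := by
    intro s
    classical
    induction s using Finset.induction_on with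
    | empty =>
      filter_upwards [Lp.coeFn_zero ℂ 2 torusMeasure] with x _
      simp [expSum]
    | insert m s hm ih =>
      rw [Finset.sum_insert hm]
      filter_upwards [ih, Lp.coeFn_add (mFourierCoeff u m • expL2 m)
        (∑ m ∈ s, mFourierCoeff u m • expL2 m), Lp.coeFn_smul (mFourierCoeff u m) (expL2 m),
        coeFn_expL2 m] with x h1 h2 h3 h4
      rw [h2, Pi.add_apply, h1, h3, Pi.smul_apply, h4, expSum, expSum, Finset.sum_insert hm,
        smul_eq_mul]
  filter_upwards [Lp.coeFn_sub u (∑ m ∈ s, mFourierCoeff u m • expL2 m), h3 s] with x h4 h5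
  rw [h4, Pi.sub_apply, h5]

/-- The basic bound is a half-sum of squared norms, which is not small when only one argument is.
Replacing `(f, g)` by `(t f, t⁻¹ g)` leaves the form unchanged and weights the two norms by `t²` and
`t⁻²`. -/
lemma IsSymbol.tendsto_weylForm (hb : IsSymbol b) {ħ : ℝ} (hħ : 0 < ħ) (u : L2) :
    Tendsto (fun s => weylForm ħ b (expSum s (mFourierCoeff u)) (expSum s (mFourierCoeff u))) atTop
      (𝓝 (weylForm ħ b u u)) := by
  obtain ⟨C, hC0, hC⟩ := hb.weylIntegrand_bound hħ
  set c : ℂ := (((2 * Real.pi * ħ) ^ 2 : ℝ) : ℂ)⁻¹ with hc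
  have hLp : ∀ s, MemLp (expSum s (mFourierCoeff u)) 2 torusMeasure := fun s =>
    memLp_of_continuous (continuous_expSum _ _)
  have hr : ∀ s, MemLp (fun x => u x - expSum s (mFourierCoeff u) x) 2 torusMeasure := fun s =>
    (Lp.memLp u).sub (hLp s)
  have bound : ∀ (t : ℝ) (f g : Torus → ℂ), 0 < t → MemLp f 2 torusMeasure →
      MemLp g 2 torusMeasure → ‖weylForm ħ b f g‖ ≤
        ‖c‖ * (C * ((t ^ 2 * ∫ x, ‖f x‖ ^ 2 ∂torusMeasure +
          (t ^ 2)⁻¹ * ∫ x, ‖g x‖ ^ 2 ∂torusMeasure) / 2)) := by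
    intro t f g ht hf hg
    have h := (hC (fun x => (t : ℂ) * f x) (fun x => (t : ℂ)⁻¹ * g x) (hf.const_mul _)
      (hg.const_mul _)).2
    have e1 : weylIntegrand ħ b (fun x => (t : ℂ) * f x) (fun x => (t : ℂ)⁻¹ * g x) =
        weylIntegrand ħ b f g := by
      ext p
      have ht' : (t : ℂ) ≠ 0 := by exact_mod_cast ht.ne'
      simp only [weylIntegrand, map_mul, Complex.conj_ofReal]
      field_simp
    have e2 : ∀ (a : ℂ) (f : Torus → ℂ), ∫ x, ‖a * f x‖ ^ 2 ∂torusMeasure =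
        ‖a‖ ^ 2 * ∫ x, ‖f x‖ ^ 2 ∂torusMeasure := fun a f => by
      rw [← integral_const_mul]
      simp only [norm_mul, mul_pow]
    rw [e1, e2, e2, norm_inv, Complex.norm_real, Real.norm_of_nonneg ht.le, inv_pow] at h
    rw [weylForm, norm_mul]
    exact mul_le_mul_of_nonneg_left h (norm_nonneg _)
  have split : ∀ s, weylForm ħ b u u -
      weylForm ħ b (expSum s (mFourierCoeff u)) (expSum s (mFourierCoeff u)) =
      weylForm ħ b (fun x => u x - expSum s (mFourierCoeff u) x) u +
        weylForm ħ b (expSum s (mFourierCoeff u)) (fun x => u x - expSum s (mFourierCoeff u) x) := by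
    intro s
    simp only [weylForm]
    rw [← mul_sub, ← mul_add, ← integral_sub (hC _ _ (Lp.memLp u) (Lp.memLp u)).1
      (hC _ _ (hLp s) (hLp s)).1, ← integral_add (hC _ _ (hr s) (Lp.memLp u)).1
      (hC _ _ (hLp s) (hr s)).1]
    congr 2
    ext p
    simp only [weylIntegrand, map_sub]
    ring
  rw [tendsto_iff_norm_sub_tendsto_zero]
  set ρ := fun s => ∫ x, ‖u x - expSum s (mFourierCoeff u) x‖ ^ 2 ∂torusMeasure with hρ
  have hρt := tendsto_integral_sub_expSum u
  have hρ0 : ∀ s, 0 ≤ ρ s := fun s => integral_nonneg fun _ => sq_nonneg _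
  set U := ∫ x, ‖u x‖ ^ 2 ∂torusMeasure with hU
  have hU0 : 0 ≤ U := integral_nonneg fun _ => sq_nonneg _
  have hp : ∀ s, ∫ x, ‖expSum s (mFourierCoeff u) x‖ ^ 2 ∂torusMeasure ≤ 2 * U + 2 * ρ s := by
    intro s
    have i1 := (Lp.memLp u).integrable_norm_pow (p := 2) (by norm_num)
    have i2 := (hr s).integrable_norm_pow (p := 2) (by norm_num)
    rw [hU, hρ, ← integral_const_mul, ← integral_const_mul,
      ← integral_add (i1.const_mul _) (i2.const_mul _)]
    refine integral_mono ((hLp s).integrable_norm_pow (p := 2) (by norm_num))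
      ((i1.const_mul _).add (i2.const_mul _)) fun x => ?_
    have : ‖expSum s (mFourierCoeff u) x‖ ≤ ‖u x‖ + ‖u x - expSum s (mFourierCoeff u) x‖ := by
      rw [norm_sub_rev]; exact norm_le_insert' _ _
    simp only
    nlinarith [sq_nonneg (‖u x‖ - ‖u x - expSum s (mFourierCoeff u) x‖), norm_nonneg (u x),
      norm_nonneg (u x - expSum s (mFourierCoeff u) x), norm_nonneg (expSum s (mFourierCoeff u) x)]
  have main : ∀ t : ℝ, 0 < t → ∀ s,
      ‖weylForm ħ b (expSum s (mFourierCoeff u)) (expSum s (mFourierCoeff u)) - weylForm ħ b u u‖ ≤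
        ‖c‖ * (C * ((t ^ 2)⁻¹ * ρ s)) + ‖c‖ * (C * (t ^ 2 * (2 * U + ρ s))) := by
    intro t ht s
    rw [norm_sub_rev, split]
    refine (norm_add_le _ _).trans ?_
    have b1 := bound t⁻¹ _ _ (inv_pos.2 ht) (hr s) (Lp.memLp u)
    have b2 := bound t _ _ ht (hLp s) (hr s)
    rw [inv_pow, inv_inv] at b1
    refine (add_le_add b1 b2).trans ?_
    rw [← mul_add, ← mul_add, ← mul_add, ← mul_add]
    refine mul_le_mul_of_nonneg_left (mul_le_mul_of_nonneg_left ?_ hC0) (norm_nonneg _)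
    have h3 := mul_le_mul_of_nonneg_left (hp s) (sq_nonneg t)
    have h4 := mul_nonneg (sq_nonneg t) hU0
    have h5 := mul_nonneg (sq_nonneg t) (hρ0 s)
    have h6 := mul_nonneg (inv_nonneg.2 (sq_nonneg t)) (hρ0 s)
    simp only [hρ, hU] at h3 h4 h5 h6 ⊢
    linarith
  refine Metric.tendsto_atTop.2 fun δ hδ => ?_
  have hlim : ∀ t : ℝ, Tendsto (fun s => ‖c‖ * (C * ((t ^ 2)⁻¹ * ρ s)) +
      ‖c‖ * (C * (t ^ 2 * (2 * U + ρ s)))) atTop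
      (𝓝 (‖c‖ * (C * ((t ^ 2)⁻¹ * 0)) + ‖c‖ * (C * (t ^ 2 * (2 * U + 0))))) := fun t =>
    (((hρt.const_mul _).const_mul _).const_mul _).add
      ((((hρt.const_add _).const_mul _).const_mul _).const_mul _)
  have hD : 0 ≤ ‖c‖ * (C * (2 * U)) := by positivity
  -- The weight `t` is fixed first, so that the non-small argument contributes less than `δ`; only
  -- then does the truncation error `ρ s` tend to zero, absorbing the factor `t⁻²`.
  obtain ⟨t, ht, htδ⟩ : ∃ t : ℝ, 0 < t ∧ t ^ 2 * (‖c‖ * (C * (2 * U))) < δ := by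
    refine ⟨Real.sqrt (δ / (‖c‖ * (C * (2 * U)) + 1)), by positivity, ?_⟩
    rw [Real.sq_sqrt (by positivity), div_mul_eq_mul_div, div_lt_iff₀ (by positivity)]
    nlinarith
  have hev := (hlim t).eventually_lt_const (u := δ) (by
    rw [mul_zero, mul_zero, mul_zero, zero_add, add_zero]
    calc _ = t ^ 2 * (‖c‖ * (C * (2 * U))) := by ring
      _ < δ := htδ)
  obtain ⟨s₀, hs₀⟩ := eventually_atTop.1 hev
  refine ⟨s₀, fun s hs => ?_⟩
  rw [Real.dist_eq, sub_zero, abs_of_nonneg (norm_nonneg _)]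
  exact (main t ht s).trans_lt (hs₀ s hs)

theorem IsSymbol.wigner_eq_form (hb : IsSymbol b) {ħ : ℝ} (hħ : 0 < ħ) {M : (Fin 2 → ℤ) → ℝ}
    (hM : SchurBound (symbolKernel ħ b) M) (u : L2) :
    wigner ħ b u = form (symbolKernel ħ b) (mFourierCoeff u) (mFourierCoeff u) := by
  rw [hb.wigner_eq_weylForm hħ]
  refine tendsto_nhds_unique (hb.tendsto_weylForm hħ u) ?_
  refine (hM.tendsto_finset (sqBound_coeff u) (sqBound_coeff u)).congr fun s => ?_
  rw [hb.weylForm_expSum hħ]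

end Weyl

/-! ### Smooth functions on `T*𝕋² × [-∞, +∞]` -/

section Extension

set_option linter.unusedSectionVars false

variable {E F G H : Type} [NormedAddCommGroup E] [NormedSpace ℝ E]
  [NormedAddCommGroup F] [NormedSpace ℝ F]
  [NormedAddCommGroup G] [NormedSpace ℝ G] [NormedAddCommGroup H] [NormedSpace ℝ H]

/-- Functions of `(x, ξ, η)` which extend continuously to `η = ±∞`. -/
def HasExt (f : Plane × Plane × ℝ → F) : Prop :=
  ∃ g : Plane × Plane × EReal → F, Continuous g ∧
    ∀ (x ξ : Plane) (η : ℝ), g (x, ξ, (η : EReal)) = f (x, ξ, η)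

lemma HasExt.comp {f : Plane × Plane × ℝ → F} (hf : HasExt f) {φ : F → G} (hφ : Continuous φ) :
    HasExt fun q => φ (f q) := by
  obtain ⟨g, hg, h⟩ := hf
  exact ⟨fun p => φ (g p), hφ.comp hg, fun x ξ η => by simp only [h]⟩

lemma HasExt.comp₂ {f : Plane × Plane × ℝ → F} {f' : Plane × Plane × ℝ → G} (hf : HasExt f)
    (hf' : HasExt f') {φ : F → G → H} (hφ : Continuous fun p : F × G => φ p.1 p.2) :
    HasExt fun q => φ (f q) (f' q) := by
  obtain ⟨g, hg, h⟩ := hf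
  obtain ⟨g', hg', h'⟩ := hf'
  exact ⟨fun p => φ (g p) (g' p), hφ.comp (hg.prodMk hg'), fun x ξ η => by simp only [h, h']⟩

lemma hasExt_iteratedFDeriv_zero {f : Plane × Plane × ℝ → F} :
    HasExt (iteratedFDeriv ℝ 0 f) ↔ HasExt f := by
  constructor
  · intro h
    exact (h.comp (continuousMultilinearCurryFin0 ℝ (Plane × Plane × ℝ) F).continuous)
  · intro h
    exact (h.comp (continuousMultilinearCurryFin0 ℝ (Plane × Plane × ℝ) F).symm.continuous)

lemma hasExt_iteratedFDeriv_succ {f : Plane × Plane × ℝ → F} {n : ℕ} :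
    HasExt (iteratedFDeriv ℝ (n + 1) f) ↔ HasExt (iteratedFDeriv ℝ n (fderiv ℝ f)) := by
  have e : iteratedFDeriv ℝ (n + 1) f = fun q =>
      (continuousMultilinearCurryRightEquiv' ℝ n (Plane × Plane × ℝ) F).symm
        (iteratedFDeriv ℝ n (fderiv ℝ f) q) := by
    ext1 q
    exact iteratedFDeriv_succ_eq_comp_right
  let c := continuousMultilinearCurryRightEquiv' ℝ n (Plane × Plane × ℝ) F
  rw [e]
  constructor
  · intro h
    obtain ⟨g, hg, hgf⟩ := h
    refine ⟨fun p => c (g p), c.continuous.comp hg, fun x ξ η => ?_⟩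
    change c (g _) = _
    rw [hgf]
    exact c.apply_symm_apply _
  · intro h
    obtain ⟨g, hg, hgf⟩ := h
    refine ⟨fun p => c.symm (g p), c.symm.continuous.comp hg, fun x ξ η => ?_⟩
    change c.symm (g _) = _
    rw [hgf]

/-- Smooth functions of `(x, ξ, η)` all of whose derivatives extend continuously to
`η = ±∞`. -/
structure SmoothExt (f : Plane × Plane × ℝ → F) : Prop where
  contDiff : ContDiff ℝ ∞ f
  hasExt : ∀ j : ℕ, HasExt (iteratedFDeriv ℝ j f)

lemma SmoothExt.fderiv {f : Plane × Plane × ℝ → F} (hf : SmoothExt f) :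
    SmoothExt (fderiv ℝ f) :=
  ⟨hf.contDiff.fderiv_right (by simp), fun j => hasExt_iteratedFDeriv_succ.1 (hf.hasExt (j + 1))⟩

lemma SmoothExt.clm_comp {f : Plane × Plane × ℝ → F} (hf : SmoothExt f) (L : F →L[ℝ] G) :
    SmoothExt fun q => L (f q) := by
  refine ⟨L.contDiff.comp hf.contDiff, fun j => ?_⟩
  have e : iteratedFDeriv ℝ j (fun q => L (f q)) = fun q =>
      L.compContinuousMultilinearMap (iteratedFDeriv ℝ j f q) := by
    ext1 q
    exact L.iteratedFDeriv_comp_left hf.contDiff.contDiffAt (by exact_mod_cast le_top)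
  rw [e]
  exact (hf.hasExt j).comp
    (ContinuousLinearMap.compContinuousMultilinearMapL ℝ _ F G L).continuous

lemma SmoothExt.add {f g : Plane × Plane × ℝ → F} (hf : SmoothExt f) (hg : SmoothExt g) :
    SmoothExt fun q => f q + g q := by
  refine ⟨hf.contDiff.add hg.contDiff, fun j => ?_⟩
  have e : iteratedFDeriv ℝ j (fun q => f q + g q) = fun q =>
      iteratedFDeriv ℝ j f q + iteratedFDeriv ℝ j g q := by
    ext1 q
    exact iteratedFDeriv_add_apply (hf.contDiff.of_le (by exact_mod_cast le_top)).contDiffAt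
      (hg.contDiff.of_le (by exact_mod_cast le_top)).contDiffAt
  rw [e]
  exact (hf.hasExt j).comp₂ (hg.hasExt j) continuous_add

/-- Leibniz rule by induction on the order. The derivative of `B(f, g)` is a sum of bilinear
expressions with values in other spaces, hence the quantification over the spaces inside the
induction. -/
lemma hasExt_bilinear (n : ℕ) : ∀ {F G H : Type} [NormedAddCommGroup F] [NormedSpace ℝ F]
    [NormedAddCommGroup G] [NormedSpace ℝ G] [NormedAddCommGroup H] [NormedSpace ℝ H]
    (B : F →L[ℝ] G →L[ℝ] H) {f : Plane × Plane × ℝ → F} {g : Plane × Plane × ℝ → G},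
    SmoothExt f → SmoothExt g → HasExt (iteratedFDeriv ℝ n fun q => B (f q) (g q)) := by
  induction n with
  | zero =>
    intro F G H _ _ _ _ _ _ B f g hf hg
    rw [hasExt_iteratedFDeriv_zero]
    refine (hasExt_iteratedFDeriv_zero.1 (hf.hasExt 0)).comp₂
      (hasExt_iteratedFDeriv_zero.1 (hg.hasExt 0)) (φ := fun a b => B a b) ?_
    exact B.isBoundedBilinearMap.continuous
  | succ n ih =>
    intro F G H _ _ _ _ _ _ B f g hf hg
    rw [hasExt_iteratedFDeriv_succ]
    have e : fderiv ℝ (fun q => B (f q) (g q)) = fun q =>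
        B.precompR _ (f q) (fderiv ℝ g q) + B.precompL _ (fderiv ℝ f q) (g q) := by
      ext1 q
      exact B.fderiv_of_bilinear (hf.contDiff.differentiable (by simp)).differentiableAt
        (hg.contDiff.differentiable (by simp)).differentiableAt
    have hc1 : ContDiff ℝ ∞ fun q => B.precompR (Plane × Plane × ℝ) (f q) (fderiv ℝ g q) :=
      (B.precompR (Plane × Plane × ℝ)).isBoundedBilinearMap.contDiff.comp₂ hf.contDiff
        hg.fderiv.contDiff
    have hc2 : ContDiff ℝ ∞ fun q => B.precompL (Plane × Plane × ℝ) (fderiv ℝ f q) (g q) :=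
      (B.precompL (Plane × Plane × ℝ)).isBoundedBilinearMap.contDiff.comp₂ hf.fderiv.contDiff
        hg.contDiff
    have e2 : iteratedFDeriv ℝ n (fderiv ℝ fun q => B (f q) (g q)) = fun q =>
        iteratedFDeriv ℝ n (fun q => B.precompR _ (f q) (fderiv ℝ g q)) q +
        iteratedFDeriv ℝ n (fun q => B.precompL _ (fderiv ℝ f q) (g q)) q := by
      ext1 q
      rw [e]
      exact iteratedFDeriv_add_apply (hc1.of_le (by exact_mod_cast le_top)).contDiffAt
        (hc2.of_le (by exact_mod_cast le_top)).contDiffAt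
    rw [e2]
    have i1 : HasExt (iteratedFDeriv ℝ n fun q =>
        B.precompR (Plane × Plane × ℝ) (f q) (fderiv ℝ g q)) :=
      ih (B.precompR (Plane × Plane × ℝ)) hf hg.fderiv
    have i2 : HasExt (iteratedFDeriv ℝ n fun q =>
        B.precompL (Plane × Plane × ℝ) (fderiv ℝ f q) (g q)) :=
      ih (B.precompL (Plane × Plane × ℝ)) hf.fderiv hg
    exact HasExt.comp₂ (φ := fun a b => a + b) i1 i2 continuous_add

lemma SmoothExt.mul {f g : Plane × Plane × ℝ → ℂ} (hf : SmoothExt f) (hg : SmoothExt g) :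
    SmoothExt fun q => f q * g q :=
  ⟨hf.contDiff.mul hg.contDiff, fun j => hasExt_bilinear j (ContinuousLinearMap.mul ℝ ℂ) hf hg⟩

lemma smoothExt_of_xi {φ : Plane → F} (hφ : ContDiff ℝ ∞ φ) :
    SmoothExt fun q : Plane × Plane × ℝ => φ q.2.1 := by
  let L : Plane × Plane × ℝ →L[ℝ] Plane :=
    (ContinuousLinearMap.fst ℝ Plane ℝ).comp (ContinuousLinearMap.snd ℝ Plane (Plane × ℝ))
  refine ⟨hφ.comp L.contDiff, fun j => ?_⟩
  refine ⟨fun p => (iteratedFDeriv ℝ j φ p.2.1).compContinuousLinearMap fun _ => L, ?_,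
    fun x ξ η => ?_⟩
  · exact (ContinuousMultilinearMap.compContinuousLinearMapL (𝕜 := ℝ) (F := F)
      (fun _ : Fin j => L)).continuous.comp
      ((hφ.continuous_iteratedFDeriv (by exact_mod_cast le_top)).comp
        (continuous_fst.comp continuous_snd))
  · exact (L.iteratedFDeriv_comp_right hφ (x, ξ, η) (by exact_mod_cast le_top)).symm

lemma exists_extend_zero {h : ℝ → F} (hc : Continuous h) (hs : HasCompactSupport h) :
    ∃ k : EReal → F, Continuous k ∧ (∀ η : ℝ, k η = h η) ∧ k ⊤ = 0 ∧ k ⊥ = 0 := by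
  obtain ⟨N, hN⟩ := hs.isBounded.subset_closedBall 0
  have h0 : ∀ η : ℝ, N < |η| → h η = 0 := fun η hη => by
    by_contra hne
    have := hN (subset_tsupport h hne)
    rw [mem_closedBall_zero_iff, Real.norm_eq_abs] at this
    linarith
  let k : EReal → F := fun η => if η = ⊤ ∨ η = ⊥ then 0 else h η.toReal
  have hk : ∀ η : ℝ, k η = h η := fun η => by simp [k]
  refine ⟨k, continuous_iff_continuousAt.2 fun η => ?_, hk, by simp [k], by simp [k]⟩
  induction η with
  | bot =>
    have : k =ᶠ[𝓝 ⊥] fun _ => 0 := by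
      filter_upwards [Iio_mem_nhds (EReal.bot_lt_coe (-|N|))] with η hη
      induction η with
      | bot => simp [k]
      | top => simp [k]
      | coe η =>
        rw [hk]
        have : η < -|N| := EReal.coe_lt_coe_iff.1 hη
        exact h0 η (by
          have := le_abs_self N
          have := neg_abs_le η
          have := neg_le_abs η
          linarith)
    exact this.continuousAt
  | top =>
    have : k =ᶠ[𝓝 ⊤] fun _ => 0 := by
      filter_upwards [Ioi_mem_nhds (EReal.coe_lt_top |N|)] with η hη
      induction η with
      | bot => simp [k]
      | top => simp [k]
      | coe η =>
        rw [hk]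
        have : |N| < η := EReal.coe_lt_coe_iff.1 hη
        exact h0 η (by linarith [le_abs_self N, le_abs_self η])
    exact this.continuousAt
  | coe η =>
    rw [← EReal.isOpenEmbedding_coe.continuousAt_iff]
    have : k ∘ Real.toEReal = h := funext hk
    rw [this]
    exact hc.continuousAt

lemma smoothExt_of_eta {ψ : ℝ → F} (hψ : ContDiff ℝ ∞ ψ) (hs : HasCompactSupport ψ) :
    SmoothExt fun q : Plane × Plane × ℝ => ψ q.2.2 := by
  let L : Plane × Plane × ℝ →L[ℝ] ℝ :=
    (ContinuousLinearMap.snd ℝ Plane ℝ).comp (ContinuousLinearMap.snd ℝ Plane (Plane × ℝ))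
  refine ⟨hψ.comp L.contDiff, fun j => ?_⟩
  obtain ⟨k, hk, hkψ, -, -⟩ := exists_extend_zero
    (hψ.continuous_iteratedFDeriv (m := j) (by exact_mod_cast le_top)) (hs.iteratedFDeriv j)
  refine ⟨fun p => (k p.2.2).compContinuousLinearMap fun _ => L, ?_, fun x ξ η => ?_⟩
  · exact (ContinuousMultilinearMap.compContinuousLinearMapL (𝕜 := ℝ) (F := F)
      (fun _ : Fin j => L)).continuous.comp (hk.comp (continuous_snd.comp continuous_snd))
  · simp only [hkψ]
    exact (L.iteratedFDeriv_comp_right hψ (x, ξ, η) (by exact_mod_cast le_top)).symm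

lemma denseRange_coe_real : DenseRange Real.toEReal := by
  intro η
  induction η with
  | coe η => exact subset_closure ⟨η, rfl⟩
  | top => exact mem_closure_of_tendsto (EReal.tendsto_coe_nhds_top_iff.2 tendsto_id)
             (Eventually.of_forall mem_range_self)
  | bot => exact mem_closure_of_tendsto (EReal.tendsto_coe_nhds_bot_iff.2 tendsto_id)
             (Eventually.of_forall mem_range_self)

/-- Finite values of `η` are dense in the extended line. By currying, the continuous function `f'`
converges locally uniformly in `x` as `η` converges, and a locally uniform limit of derivatives is
the derivative of the limit. -/
lemma hasFDerivAt_of_finite {f : E × EReal → F} {f' : E × EReal → E →L[ℝ] F} [LocallyCompactSpace E]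
    (hf : Continuous f) (hf' : Continuous f')
    (h : ∀ (η : ℝ) (x : E), HasFDerivAt (fun y => f (y, (η : EReal))) (f' (x, (η : EReal))) x)
    (η : EReal) (x : E) : HasFDerivAt (fun y => f (y, η)) (f' (x, η)) x := by
  have hd : DenseRange Real.toEReal := denseRange_coe_real
  let l : Filter ℝ := comap Real.toEReal (𝓝 η)
  have hl : l.NeBot := comap_neBot fun t ht => by
    obtain ⟨_, h1, s, rfl⟩ := mem_closure_iff_nhds.1 (hd η) t ht
    exact ⟨s, h1⟩
  have ht : Tendsto Real.toEReal l (𝓝 η) := tendsto_comap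
  let Φ : C(EReal × E, E →L[ℝ] F) := ⟨fun p => f' (p.2, p.1), hf'.comp continuous_swap⟩
  have h1 : Tendsto (fun s : ℝ => Φ.curry (s : EReal)) l (𝓝 (Φ.curry η)) :=
    (Φ.curry.continuous.tendsto η).comp ht
  rw [ContinuousMap.tendsto_iff_tendstoLocallyUniformly] at h1
  refine hasFDerivAt_of_tendstoLocallyUniformlyOn (l := l) isOpen_univ
    (f := fun s y => f (y, (s : EReal))) (f' := fun s y => f' (y, (s : EReal)))
    (g' := fun y => f' (y, η)) ?_ (fun s y _ => h s y) (fun y _ => ?_) (mem_univ x)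
  · exact tendstoLocallyUniformlyOn_univ.2 h1
  · exact ((hf.comp (continuous_const.prodMk continuous_id)).tendsto η).comp ht

end Extension

lemma SmoothOnPhase.smoothExt {a : Phase → ℂ} (ha : SmoothOnPhase a) : SmoothExt (lift a) :=
  ⟨ha.contDiff, ha.extends_⟩

lemma isOpenQuotientMap_phase : IsOpenQuotientMap
    fun p : Plane × Plane × EReal => ((toTorus p.1, p.2.1, p.2.2) : Phase) :=
  isOpenQuotientMap_toTorus.prodMap IsOpenQuotientMap.id

lemma smoothOnPhase_iff {a : Phase → ℂ} :
    SmoothOnPhase a ↔ Continuous a ∧ SmoothExt (lift a) :=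
  ⟨fun h => ⟨h.continuous, h.smoothExt⟩, fun h => ⟨h.1, h.2.contDiff, h.2.hasExt⟩⟩

lemma SmoothOnPhase.contDiff_slice {a : Phase → ℂ} (ha : SmoothOnPhase a) (ξ : Plane) (η : ℝ) :
    ContDiff ℝ ∞ fun y => a (toTorus y, ξ, (η : EReal)) := by
  have h : ContDiff ℝ ∞ fun y : Plane => ((y, ξ, η) : Plane × Plane × ℝ) :=
    contDiff_id.prodMk contDiff_const
  exact ha.contDiff.comp h

/-- The definition of a test function only speaks of derivatives at finite `η`. The derivatives in
`x` at `η = ±∞` do exist and are the continuous extensions, by induction on the order; this gives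
meaning to `ξ·∂ₓa` and to the norm of `𝓑` there. -/
lemma SmoothOnPhase.exists_slice_jet {a : Phase → ℂ} (ha : SmoothOnPhase a) (j : ℕ) :
    ∃ P : Plane × Plane × EReal → ContinuousMultilinearMap ℝ (fun _ : Fin j => Plane) ℂ,
      Continuous P ∧ ∀ x ξ η, iteratedFDeriv ℝ j (fun y => a (toTorus y, ξ, η)) x = P (x, ξ, η) := by
  have jet : ∀ j, ∃ P : Plane × Plane × EReal → ContinuousMultilinearMap ℝ (fun _ : Fin j => Plane) ℂ,
      Continuous P ∧ ∀ (x ξ : Plane) (η : ℝ),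
        iteratedFDeriv ℝ j (fun y => a (toTorus y, ξ, (η : EReal))) x = P (x, ξ, (η : EReal)) := by
    intro j
    obtain ⟨g, hg, hga⟩ := ha.extends_ j
    refine ⟨fun p => (g p).compContinuousLinearMap
      fun _ => ContinuousLinearMap.inl ℝ Plane (Plane × ℝ), ?_, fun x ξ η => ?_⟩
    · exact (ContinuousMultilinearMap.compContinuousLinearMapL (𝕜 := ℝ) (F := ℂ)
        (fun _ : Fin j => ContinuousLinearMap.inl ℝ Plane (Plane × ℝ))).continuous.comp hg
    · simp only [hga]
      exact iteratedFDeriv_slice_left ha.contDiff j x (ξ, η)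
  induction j with
  | zero =>
    refine ⟨fun p => (continuousMultilinearCurryFin0 ℝ Plane ℂ).symm (a (toTorus p.1, p.2)),
      (continuousMultilinearCurryFin0 ℝ Plane ℂ).symm.continuous.comp
        (ha.continuous.comp isOpenQuotientMap_phase.continuous), fun x ξ η => ?_⟩
    rw [iteratedFDeriv_zero_eq_comp]
    rfl
  | succ j ih =>
    obtain ⟨P, hP, hPa⟩ := ih
    obtain ⟨Q, hQ, hQa⟩ := jet (j + 1)
    refine ⟨Q, hQ, fun x ξ η => ?_⟩
    let e := continuousMultilinearCurryLeftEquiv ℝ (fun _ : Fin (j + 1) => Plane) ℂ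
    have hs : ∀ η : EReal, iteratedFDeriv ℝ (j + 1) (fun y => a (toTorus y, ξ, η)) x =
        e.symm (fderiv ℝ (iteratedFDeriv ℝ j fun y => a (toTorus y, ξ, η)) x) := fun η => by
      rw [iteratedFDeriv_succ_eq_comp_left]
      rfl
    have hd : HasFDerivAt (fun y => P (y, ξ, η)) (e (Q (x, ξ, η))) x := by
      refine hasFDerivAt_of_finite (f := fun p : Plane × EReal => P (p.1, ξ, p.2))
        (f' := fun p : Plane × EReal => e (Q (p.1, ξ, p.2))) (by fun_prop)
        (e.continuous.comp (by fun_prop)) (fun η x => ?_) η x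
      have h1 : (fun y => P (y, ξ, (η : EReal))) =
          iteratedFDeriv ℝ j fun y => a (toTorus y, ξ, (η : EReal)) := by
        ext1 y; rw [hPa]
      have h2 : e (Q (x, ξ, (η : EReal))) =
          fderiv ℝ (iteratedFDeriv ℝ j fun y => a (toTorus y, ξ, (η : EReal))) x := by
        rw [← hQa, iteratedFDeriv_succ_eq_comp_left]
        exact e.apply_symm_apply _
      simp only [h1, h2]
      exact (((ha.contDiff_slice ξ η).differentiable_iteratedFDeriv
        (by exact_mod_cast WithTop.coe_lt_top j)).differentiableAt).hasFDerivAt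
    have h3 : iteratedFDeriv ℝ j (fun y => a (toTorus y, ξ, η)) = fun y => P (y, ξ, η) := by
      ext1 y; rw [hPa]
    rw [hs, h3, hd.fderiv]
    exact e.symm_apply_apply _

/-- The derivative in `x` in the direction `v`. -/
def phaseDeriv (a : Phase → ℂ) (v : Plane) (p : Phase) : ℂ := dirDeriv (fun x => a (x, p.2)) v p.1

lemma lift_phaseDeriv {a : Phase → ℂ} (ha : SmoothOnPhase a) (v : Plane) :
    lift (phaseDeriv a v) = fun q => fderiv ℝ (lift a) q (v, 0, 0) := by
  ext ⟨x, ξ, η⟩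
  simp only [lift, phaseDeriv]
  rw [dirDeriv_toTorus]
  have h1 : HasFDerivAt (lift a) (fderiv ℝ (lift a) (x, ξ, η)) (x, ξ, η) :=
    (ha.contDiff.differentiable (by simp)).differentiableAt.hasFDerivAt
  have h2 : HasFDerivAt (fun y : Plane => ((y, ξ, η) : Plane × Plane × ℝ))
      (ContinuousLinearMap.inl ℝ Plane (Plane × ℝ)) x := hasFDerivAt_prodMk_left x (ξ, η)
  have h3 := h1.comp x h2
  exact (congrArg (fun L : Plane →L[ℝ] ℂ => L v) h3.fderiv).trans rfl

lemma SmoothOnPhase.phaseDeriv {a : Phase → ℂ} (ha : SmoothOnPhase a) (v : Plane) :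
    SmoothOnPhase (phaseDeriv a v) := by
  refine smoothOnPhase_iff.2 ⟨?_, ?_⟩
  · refine isOpenQuotientMap_phase.isQuotientMap.continuous_iff.2 ?_
    obtain ⟨P, hP, hPa⟩ := ha.exists_slice_jet 1
    have : Continuous fun p : Plane × Plane × EReal => P p ![v] :=
      hP.eval_const _
    refine this.congr fun p => ?_
    simp only [Function.comp, TwoMicrolocal.phaseDeriv]
    rw [dirDeriv_toTorus, ← hPa p.1 p.2.1 p.2.2, iteratedFDeriv_one_apply]
    rfl
  · rw [lift_phaseDeriv ha]
    exact ha.smoothExt.fderiv.clm_comp (ContinuousLinearMap.apply ℝ ℂ ((v, 0, 0) : Plane × Plane × ℝ))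

lemma SmoothOnPhase.mul {a b : Phase → ℂ} (ha : SmoothOnPhase a) (hb : SmoothOnPhase b) :
    SmoothOnPhase fun p => a p * b p :=
  smoothOnPhase_iff.2 ⟨ha.continuous.mul hb.continuous, ha.smoothExt.mul hb.smoothExt⟩

lemma SmoothOnPhase.clm_comp {a : Phase → ℂ} (ha : SmoothOnPhase a) (L : ℂ →L[ℝ] ℂ) :
    SmoothOnPhase fun p => L (a p) :=
  smoothOnPhase_iff.2 ⟨L.continuous.comp ha.continuous, ha.smoothExt.clm_comp L⟩

lemma smoothOnPhase_xi {φ : Plane → ℂ} (hφ : ContDiff ℝ ∞ φ) :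
    SmoothOnPhase fun p : Phase => φ p.2.1 :=
  smoothOnPhase_iff.2 ⟨hφ.continuous.comp (continuous_fst.comp continuous_snd), smoothExt_of_xi hφ⟩

lemma exists_smoothOnPhase_eta {ψ : ℝ → ℂ} (hψ : ContDiff ℝ ∞ ψ) (hs : HasCompactSupport ψ) :
    ∃ k : EReal → ℂ, (∀ η : ℝ, k η = ψ η) ∧ k ⊤ = 0 ∧ k ⊥ = 0 ∧
      SmoothOnPhase fun p : Phase => k p.2.2 := by
  obtain ⟨k, hk, hkψ, h1, h2⟩ := exists_extend_zero hψ.continuous hs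
  refine ⟨k, hkψ, h1, h2, smoothOnPhase_iff.2 ⟨hk.comp (continuous_snd.comp continuous_snd), ?_⟩⟩
  have : (lift fun p : Phase => k p.2.2) = fun q => ψ q.2.2 := by
    ext q; exact hkψ _
  rw [this]
  exact smoothExt_of_eta hψ hs

lemma hasCompactSupport_of_xi {a : Phase → ℂ} {R : ℝ} (h : ∀ p : Phase, R < ‖p.2.1‖ → a p = 0) :
    HasCompactSupport a := by
  refine HasCompactSupport.intro ((isCompact_univ (X := Torus)).prod
    ((isCompact_closedBall (0 : Plane) R).prod (isCompact_univ (X := EReal)))) fun p hp => ?_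
  exact h p (by simpa using hp)

lemma exists_xi_bound {a : Phase → ℂ} (h : HasCompactSupport a) :
    ∃ R : ℝ, ∀ p : Phase, R < ‖p.2.1‖ → a p = 0 := by
  have hc : Continuous fun p : Phase => ‖p.2.1‖ := by fun_prop
  obtain ⟨R, hR⟩ := h.isCompact.bddAbove_image hc.continuousOn
  refine ⟨R, fun p hp => ?_⟩
  by_contra hne
  exact absurd (hR ⟨p, subset_tsupport a hne, rfl⟩) (not_le.2 hp)

lemma phaseDeriv_eq_zero {a : Phase → ℂ} {p : Phase} {v : Plane} (h : ∀ x, a (x, p.2) = 0) :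
    phaseDeriv a v p = 0 := by
  unfold phaseDeriv dirDeriv
  simp [h]

/-- With coordinates, the direction of differentiation no longer depends on the point, and
membership in the space of test functions reduces to products and directional derivatives. -/
lemma geodesicDeriv_eq {a : Phase → ℂ} (p : Phase) :
    geodesicDeriv a p = (p.2.1 0 : ℂ) * phaseDeriv a (EuclideanSpace.single 0 1) p +
      (p.2.1 1 : ℂ) * phaseDeriv a (EuclideanSpace.single 1 1) p := by
  have e : p.2.1 = p.2.1 0 • EuclideanSpace.single 0 1 + p.2.1 1 • EuclideanSpace.single 1 1 := by
    ext i; fin_cases i <;> simp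
  unfold geodesicDeriv phaseDeriv dirDeriv
  have h (L : Plane →L[ℝ] ℂ) : L p.2.1 = (p.2.1 0 : ℂ) * L (EuclideanSpace.single 0 1) +
      (p.2.1 1 : ℂ) * L (EuclideanSpace.single 1 1) := by
    conv_lhs => rw [e]
    rw [map_add, map_smul, map_smul, Complex.real_smul, Complex.real_smul]
  exact h _

lemma SmoothOnPhase.add {a b : Phase → ℂ} (ha : SmoothOnPhase a) (hb : SmoothOnPhase b) :
    SmoothOnPhase fun p => a p + b p :=
  smoothOnPhase_iff.2 ⟨ha.continuous.add hb.continuous, ha.smoothExt.add hb.smoothExt⟩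

lemma contDiff_coord (i : Fin 2) : ContDiff ℝ ∞ fun ξ : Plane => (ξ i : ℂ) :=
  Complex.ofRealCLM.contDiff.comp (EuclideanSpace.proj i : Plane →L[ℝ] ℝ).contDiff

lemma geodesicDeriv_mem {a : Phase → ℂ} (ha : a ∈ testFunctions) :
    geodesicDeriv a ∈ testFunctions := by
  obtain ⟨h1, h2⟩ := ha
  obtain ⟨R, hR⟩ := exists_xi_bound h2
  refine ⟨?_, hasCompactSupport_of_xi (R := R) fun p hp => ?_⟩
  · have e : geodesicDeriv a = fun p => (p.2.1 0 : ℂ) * phaseDeriv a (EuclideanSpace.single 0 1) p +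
        (p.2.1 1 : ℂ) * phaseDeriv a (EuclideanSpace.single 1 1) p := funext geodesicDeriv_eq
    rw [e]
    exact ((smoothOnPhase_xi (contDiff_coord 0)).mul (h1.phaseDeriv _)).add
      ((smoothOnPhase_xi (contDiff_coord 1)).mul (h1.phaseDeriv _))
  · rw [geodesicDeriv_eq, phaseDeriv_eq_zero fun x => hR (x, p.2) hp,
      phaseDeriv_eq_zero fun x => hR (x, p.2) hp]
    simp

lemma mul_mem {a b : Phase → ℂ} (ha : a ∈ testFunctions) (hb : SmoothOnPhase b) :
    (fun p => a p * b p) ∈ testFunctions :=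
  ⟨ha.1.mul hb, ha.2.mul_right⟩

lemma clm_comp_mem {a : Phase → ℂ} (ha : a ∈ testFunctions) (L : ℂ →L[ℝ] ℂ) :
    (fun p => L (a p)) ∈ testFunctions :=
  ⟨ha.1.clm_comp L, ha.2.comp_left (map_zero L)⟩

lemma xi_mem {φ : Plane → ℂ} (hφ : ContDiff ℝ ∞ φ) (hs : HasCompactSupport φ) :
    (fun p : Phase => φ p.2.1) ∈ testFunctions := by
  obtain ⟨R, hR⟩ := hs.isBounded.subset_closedBall 0
  refine ⟨smoothOnPhase_xi hφ, hasCompactSupport_of_xi (R := R) fun p hp => ?_⟩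
  by_contra hne
  have := hR (subset_tsupport φ hne)
  rw [mem_closedBall_zero_iff] at this
  linarith

/-! ### Bounds on the derivatives -/

lemma toTorus_latticeVec (k : Fin 2 → ℤ) : toTorus (latticeVec k) = 0 := by
  ext i
  simp [toTorus, latticeVec]

lemma exists_lattice_near (x : Plane) : ∃ k : Fin 2 → ℤ, ‖x - latticeVec k‖ ≤ 2 := by
  refine ⟨fun i => ⌊x i⌋, ?_⟩
  rw [EuclideanSpace.norm_eq]
  refine Real.sqrt_le_iff.2 ⟨by norm_num, ?_⟩
  simp only [latticeVec, Fin.sum_univ_two, PiLp.sub_apply, Real.norm_eq_abs, sq_abs]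
  have h : ∀ t : ℝ, (t - ⌊t⌋) ^ 2 ≤ 1 := fun t => by
    nlinarith [Int.floor_le t, Int.lt_floor_add_one t]
  have h0 := h (x 0)
  have h1 := h (x 1)
  nlinarith

lemma iteratedFDeriv_lift_periodic (a : Phase → ℂ) (j : ℕ) (x ξ : Plane) (η : ℝ)
    (k : Fin 2 → ℤ) :
    iteratedFDeriv ℝ j (lift a) (x - latticeVec k, ξ, η) =
      iteratedFDeriv ℝ j (lift a) (x, ξ, η) := by
  have h1 : (fun q : Plane × Plane × ℝ => lift a ((-latticeVec k, 0, 0) + q)) = lift a := by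
    ext q
    have : toTorus (-latticeVec k + q.1) = toTorus q.1 := by
      rw [neg_add_eq_sub, toTorus_sub, toTorus_latticeVec, sub_zero]
    simp [lift, this]
  have h2 := iteratedFDeriv_comp_add_left (𝕜 := ℝ) (f := lift a) j
    ((-latticeVec k, 0, 0) : Plane × Plane × ℝ) (x, ξ, η)
  rw [h1] at h2
  rw [h2]
  congr 1
  ext <;> simp [neg_add_eq_sub]

/-- Compactness in all variables: periodicity brings `x` into a ball of radius `2`, the support
bounds `ξ`, and the continuous extension of the derivatives makes the extended line of `η`
available. -/
lemma iteratedFDeriv_lift_bounded {a : Phase → ℂ} (ha : a ∈ testFunctions) (j : ℕ) :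
    ∃ C : ℝ, 0 ≤ C ∧ ∀ q, ‖iteratedFDeriv ℝ j (lift a) q‖ ≤ C := by
  obtain ⟨h1, h2⟩ := ha
  obtain ⟨R, hR⟩ := exists_xi_bound h2
  obtain ⟨g, hg, hga⟩ := h1.extends_ j
  obtain ⟨C, hC⟩ := ((isCompact_closedBall (0 : Plane) 2).prod
    ((isCompact_closedBall (0 : Plane) R).prod
      (isCompact_univ (X := EReal)))).bddAbove_image hg.norm.continuousOn
  refine ⟨max C 0, le_max_right _ _, fun ⟨x, ξ, η⟩ => ?_⟩
  by_cases hξ : ‖ξ‖ ≤ R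
  · obtain ⟨k, hk⟩ := exists_lattice_near x
    rw [← iteratedFDeriv_lift_periodic a j x ξ η k, ← hga]
    exact le_max_of_le_left (hC ⟨_, ⟨by simpa using hk, by simpa using hξ, mem_univ _⟩, rfl⟩)
  · refine le_trans (le_of_eq ?_) (le_max_right _ _)
    have : lift a =ᶠ[𝓝 (x, ξ, η)] fun _ => 0 := by
      have hc : Continuous fun q : Plane × Plane × ℝ => ‖q.2.1‖ := by fun_prop
      filter_upwards [(isOpen_Ioi.preimage hc).mem_nhds (show (x, ξ, η) ∈ _ from not_le.1 hξ)]
        with q hq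
      exact hR _ hq
    rw [(Filter.EventuallyEq.iteratedFDeriv (𝕜 := ℝ) this j).eq_of_nhds]
    have h0 : (fun _ : Plane × Plane × ℝ => (0 : ℂ)) = 0 := rfl
    rw [h0, iteratedFDeriv_zero, Pi.zero_apply, norm_zero]

/-! ### Matrix elements of two-microlocal symbols -/

/-- The Fourier coefficients in `x` of a function on `T*𝕋² × ℝ`. -/
def phaseCoeff (a : Phase → ℂ) (k : Fin 2 → ℤ) (ξ : Plane) (η : ℝ) : ℂ :=
  mFourierCoeff (fun x => a (x, ξ, (η : EReal))) k

lemma SmoothOnPhase.smoothOnTorus {a : Phase → ℂ} (ha : SmoothOnPhase a) (ξ : Plane) (η : ℝ) :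
    SmoothOnTorus fun x => a (x, ξ, (η : EReal)) := ha.contDiff_slice ξ η

lemma norm_iteratedFDeriv_lift_sub_le {a : Phase → ℂ} (ha : SmoothOnPhase a) {j : ℕ} {C : ℝ}
    (hC : ∀ q, ‖iteratedFDeriv ℝ (j + 1) (lift a) q‖ ≤ C) (q q' : Plane × Plane × ℝ) :
    ‖iteratedFDeriv ℝ j (lift a) q - iteratedFDeriv ℝ j (lift a) q'‖ ≤ C * ‖q - q'‖ := by
  refine Convex.norm_image_sub_le_of_norm_fderiv_le (𝕜 := ℝ) (s := univ) (fun p _ => ?_)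
    (fun p _ => ?_) convex_univ (mem_univ q') (mem_univ q)
  · exact (ha.contDiff.differentiable_iteratedFDeriv
      (by exact_mod_cast WithTop.coe_lt_top j)).differentiableAt
  · rw [norm_fderiv_iteratedFDeriv]
    exact hC p

lemma exists_phaseCoeff_bound {a : Phase → ℂ} (ha : a ∈ testFunctions) :
    ∃ C : ℝ, 0 ≤ C ∧ (∀ k ξ η, ‖phaseCoeff a k ξ η‖ ≤ C * weight k) ∧
      ∀ k ξ η ξ' η', ‖phaseCoeff a k ξ η - phaseCoeff a k ξ' η'‖ ≤
        C * weight k * (‖ξ - ξ'‖ + |η - η'|) := by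
  choose C hC0 hC using iteratedFDeriv_lift_bounded ha
  -- Orders `0` to `5`: four derivatives in `x` for the decay in `k`, and one more for the Lipschitz
  -- bound in `(ξ, η)`.
  let D := ∑ j ∈ Finset.range 6, C j
  have hD : ∀ j < 6, C j ≤ D := fun j hj =>
    Finset.single_le_sum (f := C) (fun i _ => hC0 i) (Finset.mem_range.2 hj)
  have hD0 : 0 ≤ D := Finset.sum_nonneg fun j _ => hC0 j
  refine ⟨6 * D, by positivity, fun k ξ η => ?_, fun k ξ η ξ' η' => ?_⟩
  · refine (ha.1.smoothOnTorus ξ η).norm_mFourierCoeff_le (fun n hn x => ?_) k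
    have := iteratedFDeriv_slice_left ha.1.contDiff n x (ξ, η)
    refine (congrArg norm this).trans_le ?_
    exact (norm_compContinuousLinearMap_inl_le _).trans ((hC n _).trans (hD n (by omega)))
  · have h1 := ha.1.smoothOnTorus ξ η
    have h2 := ha.1.smoothOnTorus ξ' η'
    have hs : SmoothOnTorus fun x => a (x, ξ, (η : EReal)) - a (x, ξ', (η' : EReal)) :=
      ContDiff.sub h1 h2
    have e : phaseCoeff a k ξ η - phaseCoeff a k ξ' η' =
        mFourierCoeff (fun x => a (x, ξ, (η : EReal)) - a (x, ξ', (η' : EReal))) k := by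
      simp only [phaseCoeff, mFourierCoeff_eq, mul_sub]
      rw [integral_sub]
      · exact (((mFourier (-k)).continuous.mul h1.continuous)).integrable_of_hasCompactSupport
          (HasCompactSupport.of_compactSpace _)
      · exact (((mFourier (-k)).continuous.mul h2.continuous)).integrable_of_hasCompactSupport
          (HasCompactSupport.of_compactSpace _)
    rw [e]
    refine (hs.norm_mFourierCoeff_le (C := D * (‖ξ - ξ'‖ + |η - η'|)) (fun n hn x => ?_) k).trans
      (le_of_eq (by ring))
    have e1 := iteratedFDeriv_slice_left ha.1.contDiff n x (ξ, η)
    have e2 := iteratedFDeriv_slice_left ha.1.contDiff n x (ξ', η')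
    have e3 : iteratedFDeriv ℝ n
        (fun y => a (toTorus y, ξ, (η : EReal)) - a (toTorus y, ξ', (η' : EReal))) x =
        iteratedFDeriv ℝ n (fun y => lift a (y, ξ, η)) x -
          iteratedFDeriv ℝ n (fun y => lift a (y, ξ', η')) x :=
      iteratedFDeriv_sub_apply (ContDiff.contDiffAt (ContDiff.of_le h1 (by exact_mod_cast le_top)))
        (ContDiff.contDiffAt (ContDiff.of_le h2 (by exact_mod_cast le_top)))
    rw [e3, e1, e2]
    have e4 : ∀ P Q : ContinuousMultilinearMap ℝ (fun _ : Fin n => Plane × Plane × ℝ) ℂ,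
        P.compContinuousLinearMap (fun _ => ContinuousLinearMap.inl ℝ Plane (Plane × ℝ)) -
        Q.compContinuousLinearMap (fun _ => ContinuousLinearMap.inl ℝ Plane (Plane × ℝ)) =
        (P - Q).compContinuousLinearMap fun _ => ContinuousLinearMap.inl ℝ Plane (Plane × ℝ) :=
      fun P Q => rfl
    rw [e4]
    refine (norm_compContinuousLinearMap_inl_le _).trans ?_
    refine (norm_iteratedFDeriv_lift_sub_le ha.1 (hC (n + 1)) _ _).trans ?_
    refine mul_le_mul (hD _ (by omega)) ?_ (norm_nonneg _) hD0
    simp only [Prod.mk_sub_mk, sub_self, Prod.norm_mk, norm_zero, Real.norm_eq_abs]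
    refine max_le (by positivity) (max_le ?_ ?_)
    · linarith [abs_nonneg (η - η')]
    · linarith [norm_nonneg (ξ - ξ')]

/-- The semiclassical symbol `a(x, ξ, H_Λ(ξ)/ε)`. -/
def rescaledSymbol (e : Fin 2 → ℤ) (ε : ℝ) (a : Phase → ℂ) (x : Torus) (ξ : Plane) : ℂ :=
  a (x, ξ, ((hamiltonian e ξ / ε : ℝ) : EReal))

lemma hamiltonian_sub (e : Fin 2 → ℤ) (ξ ξ' : Plane) :
    hamiltonian e ξ - hamiltonian e ξ' = hamiltonian e (ξ - ξ') := by
  unfold hamiltonian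
  rw [inner_sub_left]
  ring

lemma abs_hamiltonian_le (e : Fin 2 → ℤ) (ξ : Plane) : |hamiltonian e ξ| ≤ ‖ξ‖ := by
  unfold hamiltonian
  rw [abs_div, abs_norm]
  refine div_le_of_le_mul₀ (norm_nonneg _) (norm_nonneg _) ?_
  exact abs_real_inner_le_norm _ _

lemma contDiff_hamiltonian (e : Fin 2 → ℤ) : ContDiff ℝ ∞ (hamiltonian e) := by
  unfold hamiltonian
  exact (contDiff_id.inner ℝ contDiff_const).div_const _

lemma isSymbol_rescaledSymbol {a : Phase → ℂ} (ha : a ∈ testFunctions) (e : Fin 2 → ℤ) (ε : ℝ) :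
    IsSymbol (rescaledSymbol e ε a) := by
  obtain ⟨R, hR⟩ := exists_xi_bound ha.2
  refine ⟨?_, R, fun x ξ hξ => hR _ hξ⟩
  have h : ContDiff ℝ ∞ fun q : Plane × Plane =>
      ((q.1, q.2, hamiltonian e q.2 / ε) : Plane × Plane × ℝ) :=
    contDiff_fst.prodMk (contDiff_snd.prodMk
      (((contDiff_hamiltonian e).comp contDiff_snd).div_const ε))
  exact ha.1.contDiff.comp h

lemma symbolKernel_rescaledSymbol (a : Phase → ℂ) (e : Fin 2 → ℤ) (ħ ε : ℝ) (m m' : Fin 2 → ℤ) :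
    symbolKernel ħ (rescaledSymbol e ε a) m m' =
      phaseCoeff a (m' - m) ((Real.pi * ħ) • latticeVec (m + m'))
        (hamiltonian e ((Real.pi * ħ) • latticeVec (m + m')) / ε) := rfl

/-- Substituting `η = H_Λ(ξ)/ε` costs a factor `ε⁻¹` in the Lipschitz constant in `ξ`; this is the
source of every `1 + ε⁻¹` below. -/
lemma norm_phaseCoeff_sub_le {a : Phase → ℂ} {C : ℝ} (hC0 : 0 ≤ C)
    (hC : ∀ k ξ η ξ' η', ‖phaseCoeff a k ξ η - phaseCoeff a k ξ' η'‖ ≤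
        C * weight k * (‖ξ - ξ'‖ + |η - η'|)) (e : Fin 2 → ℤ) {ε : ℝ} (hε : 0 < ε)
    (k : Fin 2 → ℤ) (ξ ξ' : Plane) :
    ‖phaseCoeff a k ξ (hamiltonian e ξ / ε) - phaseCoeff a k ξ' (hamiltonian e ξ' / ε)‖ ≤
      C * weight k * ((1 + ε⁻¹) * ‖ξ - ξ'‖) := by
  refine (hC _ _ _ _ _).trans (mul_le_mul_of_nonneg_left ?_ (mul_nonneg hC0 (weight_pos k).le))
  rw [← sub_div, hamiltonian_sub, abs_div, abs_of_pos hε, div_eq_inv_mul, add_mul, one_mul]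
  have := mul_le_mul_of_nonneg_left (abs_hamiltonian_le e (ξ - ξ')) (inv_pos.2 hε).le
  linarith

lemma schurBound_symbolKernel {a : Phase → ℂ} {C : ℝ}
    (hC : ∀ k ξ η, ‖phaseCoeff a k ξ η‖ ≤ C * weight k) (e : Fin 2 → ℤ) (ħ ε : ℝ) :
    SchurBound (symbolKernel ħ (rescaledSymbol e ε a)) fun k => C * weight k :=
  ⟨summable_weight.mul_left C, fun _ _ => hC _ _ _⟩

lemma twoMicrolocalWigner_eq {a : Phase → ℂ} (ha : a ∈ testFunctions) (e : Fin 2 → ℤ) {ħ : ℝ}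
    (hħ : 0 < ħ) (ε : ℝ) (u : L2) :
    twoMicrolocalWigner e ħ ε u a =
      form (symbolKernel ħ (rescaledSymbol e ε a)) (mFourierCoeff u) (mFourierCoeff u) := by
  obtain ⟨C, -, hC, -⟩ := exists_phaseCoeff_bound ha
  exact (isSymbol_rescaledSymbol ha e ε).wigner_eq_form hħ (schurBound_symbolKernel hC e ħ ε) u

lemma norm_twoMicrolocalWigner_le {a : Phase → ℂ} (ha : a ∈ testFunctions) {C : ℝ}
    (hC : ∀ k ξ η, ‖phaseCoeff a k ξ η‖ ≤ C * weight k) (e : Fin 2 → ℤ) {ħ : ℝ}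
    (hħ : 0 < ħ) (ε : ℝ) {u : L2} (hu : ‖u‖ = 1) :
    ‖twoMicrolocalWigner e ħ ε u a‖ ≤ C * ∑' k, weight k := by
  rw [twoMicrolocalWigner_eq ha e hħ]
  have hb : SqBound (mFourierCoeff u) 1 := by simpa [hu] using sqBound_coeff u
  have := (schurBound_symbolKernel hC e ħ ε).norm_form_le hb hb
  rw [tsum_mul_left] at this
  linarith

lemma measurable_form {K : (Fin 2 → ℤ) → (Fin 2 → ℤ) → ℂ} {M : (Fin 2 → ℤ) → ℝ}
    (hK : SchurBound K M) {v : ℝ → L2} (hv : Continuous v) :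
    Measurable fun s => form K (mFourierCoeff (v s)) (mFourierCoeff (v s)) := by
  refine measurable_of_tendsto_metrizable' (u := (atTop : Filter (Finset (Fin 2 → ℤ))))
    (f := fun S s => ∑ m ∈ S, ∑ m' ∈ S, K m m' * mFourierCoeff (v s) m *
      (starRingEnd ℂ) (mFourierCoeff (v s) m')) (fun S => ?_) ?_
  · refine Continuous.measurable ?_
    refine continuous_finsetSum _ fun m _ => continuous_finsetSum _ fun m' _ => ?_
    exact (continuous_const.mul (continuous_mFourierCoeff hv m)).mul
      (Complex.continuous_conj.comp (continuous_mFourierCoeff hv m'))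
  · exact tendsto_pi_nhds.2 fun s => hK.tendsto_finset (sqBound_coeff _) (sqBound_coeff _)

lemma measurable_twoMicrolocalWigner {a : Phase → ℂ} (ha : a ∈ testFunctions) (e : Fin 2 → ℤ)
    {ħ : ℝ} (hħ : 0 < ħ) (ε : ℝ) {v : ℝ → L2} (hv : Continuous v) :
    Measurable fun s => twoMicrolocalWigner e ħ ε (v s) a := by
  obtain ⟨C, -, hC, -⟩ := exists_phaseCoeff_bound ha
  simp only [twoMicrolocalWigner_eq ha e hħ]
  exact measurable_form (schurBound_symbolKernel hC e ħ ε) hv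

lemma intervalIntegrable_twoMicrolocalWigner {a : Phase → ℂ} (ha : a ∈ testFunctions)
    (e : Fin 2 → ℤ) {ħ : ℝ} (hħ : 0 < ħ) (ε : ℝ) {v : ℝ → L2} (hv : Continuous v)
    (hu : ∀ s, ‖v s‖ = 1) (s₁ s₂ : ℝ) :
    IntervalIntegrable (fun s => twoMicrolocalWigner e ħ ε (v s) a) volume s₁ s₂ := by
  obtain ⟨C, -, hC, -⟩ := exists_phaseCoeff_bound ha
  rw [intervalIntegrable_iff]
  exact Measure.integrableOn_of_bounded (M := C * ∑' k, weight k) (by simp [uIoc])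
    (measurable_twoMicrolocalWigner ha e hħ ε hv).aestronglyMeasurable
    (Eventually.of_forall fun s => norm_twoMicrolocalWigner_le ha hC e hħ ε (hu s))

/-! ### Transport along the geodesic flow -/

lemma phaseCoeff_geodesicDeriv {a : Phase → ℂ} (ha : SmoothOnPhase a) (k : Fin 2 → ℤ) (ξ : Plane)
    (η : ℝ) : phaseCoeff (geodesicDeriv a) k ξ η =
      2 * Real.pi * Complex.I * (inner ℝ (latticeVec k) ξ : ℝ) * phaseCoeff a k ξ η :=
  (ha.smoothOnTorus ξ η).mFourierCoeff_dirDeriv ξ k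

/-- Since `|m|² - |m'|² = -(m' - m)·(m + m')`, the energy difference is `-2πħ` times the pairing of
`k = m' - m` with `ξ = πħ(m + m')`. Dividing by `iħ` yields precisely the Fourier multiplier of
`ξ·∂ₓ`, without remainder. -/
lemma energy_mul_symbolKernel {a : Phase → ℂ} (ha : SmoothOnPhase a) (e : Fin 2 → ℤ) {ħ : ℝ}
    (hħ : 0 < ħ) (ε : ℝ) (m m' : Fin 2 → ℤ) :
    ((energy ħ m - energy ħ m' : ℝ) : ℂ) / (Complex.I * ħ) *
      symbolKernel ħ (rescaledSymbol e ε a) m m' =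
      symbolKernel ħ (rescaledSymbol e ε (geodesicDeriv a)) m m' := by
  rw [symbolKernel_rescaledSymbol, symbolKernel_rescaledSymbol, phaseCoeff_geodesicDeriv ha]
  congr 1
  have hI := Complex.I_ne_zero
  have hħ' : (ħ : ℂ) ≠ 0 := by exact_mod_cast hħ.ne'
  have hI2 := Complex.I_sq
  rw [inner_smul_right, inner_latticeVec, energy, energy]
  simp only [latticeVec, Pi.sub_apply, Pi.add_apply]
  push_cast
  field_simp
  linear_combination (-((m' 0 : ℂ) ^ 2 - m 0 ^ 2 + (m' 1 ^ 2 - m 1 ^ 2))) * hI2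

/-- By `form_evolution`, the integral is the variation of a bounded form minus the integral of the
commutator with the potential. Shifting both indices by `j` moves the midpoint frequency by `2πħ j`,
so the factor `ħ` gained in the commutator cancels the division by `ħ`. -/
lemma norm_integral_geodesicDeriv_le {a : Phase → ℂ} (ha : a ∈ testFunctions) {C : ℝ} (hC0 : 0 ≤ C)
    (hC : ∀ k ξ η, ‖phaseCoeff a k ξ η‖ ≤ C * weight k)
    (hC' : ∀ k ξ η ξ' η', ‖phaseCoeff a k ξ η - phaseCoeff a k ξ' η'‖ ≤
        C * weight k * (‖ξ - ξ'‖ + |η - η'|)) (e : Fin 2 → ℤ) {ħ ε : ℝ} (hħ : 0 < ħ) (hε : 0 < ε)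
    {g : C(Torus, ℂ)} (hg : IsPotential g) {S : ℝ}
    (hS : HasSum (fun j => ‖mFourierCoeff g j‖ * ‖latticeVec j‖) S)
    {v : ℝ → L2} (hv : IsFlow ħ g v) (hu : ‖v 0‖ = 1) {s₁ s₂ : ℝ} (hs : s₁ ≤ s₂) :
    ‖∫ s in s₁..s₂, twoMicrolocalWigner e ħ ε (v s) (geodesicDeriv a)‖ ≤
      2 * (C * ∑' k, weight k) +
        2 * Real.pi * (1 + ε⁻¹) * S * (C * ∑' k, weight k) * (s₂ - s₁) := by
  have hn : ∀ s, ‖v s‖ = 1 := fun s => (hv.norm_eq hg s).trans hu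
  have ha' := geodesicDeriv_mem ha
  obtain ⟨D, -, hD, -⟩ := exists_phaseCoeff_bound ha'
  have hK := schurBound_symbolKernel hC e ħ ε
  have hK' := schurBound_symbolKernel hD e ħ ε
  set K := symbolKernel ħ (rescaledSymbol e ε a) with hKdef
  have eK : (fun m m' => ((energy ħ m - energy ħ m' : ℝ) : ℂ) / (Complex.I * ħ) * K m m') =
      symbolKernel ħ (rescaledSymbol e ε (geodesicDeriv a)) := by
    ext m m'
    exact energy_mul_symbolKernel ha.1 e hħ ε m m'
  have hb : ∀ s, SqBound (mFourierCoeff (v s)) 1 := fun s => by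
    simpa [hn] using sqBound_coeff (v s)
  have hb' : ∀ s, SqBound (mFourierCoeff (mulL2 g (v s))) (‖g‖ ^ 2) := fun s =>
    (sqBound_coeff _).mono (pow_le_pow_left₀ (norm_nonneg _)
      ((norm_mulL2_le g _).trans (by rw [hn, mul_one])) 2)
  obtain ⟨hi, h⟩ := form_evolution (C := max 1 (‖g‖ ^ 2)) hs hv.hasDerivAt hv.hasDerivAt
    (continuous_mFourierCoeff_mulL2 g hv.continuous)
    (continuous_mFourierCoeff_mulL2 g hv.continuous)
    (fun s _ => (hb s).mono (le_max_left _ _)) (fun s _ => (hb s).mono (le_max_left _ _))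
    (fun s _ => (hb' s).mono (le_max_right _ _)) (fun s _ => (hb' s).mono (le_max_right _ _))
    hK (M' := fun k => D * weight k) (by rw [eK]; exact hK')
  rw [eK] at hi h
  set R : ℝ → ℂ := fun s => (form K (mFourierCoeff (mulL2 g (v s))) (mFourierCoeff (v s)) -
    form K (mFourierCoeff (v s)) (mFourierCoeff (mulL2 g (v s)))) / (Complex.I * ħ) with hRdef
  have hR : ∀ s, ‖R s‖ ≤ 2 * Real.pi * (1 + ε⁻¹) * S * (C * ∑' k, weight k) := by
    intro s
    have hcomm := norm_form_commutator_le (M' := fun k => C * weight k)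
      (L := fun j => (1 + ε⁻¹) * (2 * Real.pi * ħ) * ‖latticeVec j‖)
      (S := (1 + ε⁻¹) * (2 * Real.pi * ħ) * S) hK (hb s) (hb s) hg.summable.norm hg.coeff_neg
      (hasSum_mFourierCoeff_mulL2 hg.summable (v s)) (hasSum_mFourierCoeff_mulL2 hg.summable (v s))
      (summable_weight.mul_left C) (fun j m m' => ?_) ?_
    · rw [hRdef, norm_div, norm_mul, Complex.norm_I, one_mul, Complex.norm_real,
        Real.norm_of_nonneg hħ.le, div_le_iff₀ hħ]
      refine hcomm.trans (le_of_eq ?_)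
      rw [tsum_mul_left]
      ring
    · rw [hKdef, symbolKernel_rescaledSymbol, symbolKernel_rescaledSymbol, add_sub_add_right_eq_sub]
      refine (norm_phaseCoeff_sub_le hC0 hC' e hε _ _ _).trans (le_of_eq ?_)
      rw [← smul_sub, ← latticeVec_sub, norm_smul]
      have : m + j + (m' + j) - (m + m') = j + j := by abel
      rw [this, latticeVec_add, ← two_smul ℝ (latticeVec j), norm_smul,
        Real.norm_of_nonneg (by positivity), Real.norm_of_nonneg (by norm_num)]
      ring
    · convert! hS.mul_left ((1 + ε⁻¹) * (2 * Real.pi * ħ)) using 1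
      ext j; ring
  have hW := intervalIntegrable_twoMicrolocalWigner ha' e hħ ε hv.continuous hn s₁ s₂
  simp only [twoMicrolocalWigner_eq ha' e hħ] at hW ⊢
  have hRi : IntervalIntegrable R volume s₁ s₂ := by
    refine (hi.sub hW).congr ?_
    exact fun s _ => by simp [hRdef]
  have hsplit : ∫ s in s₁..s₂, form (symbolKernel ħ (rescaledSymbol e ε (geodesicDeriv a)))
      (mFourierCoeff (v s)) (mFourierCoeff (v s)) =
      form K (mFourierCoeff (v s₂)) (mFourierCoeff (v s₂)) -
        form K (mFourierCoeff (v s₁)) (mFourierCoeff (v s₁)) - ∫ s in s₁..s₂, R s := by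
    rw [h, ← intervalIntegral.integral_sub hi hRi]
    refine intervalIntegral.integral_congr fun s _ => ?_
    simp [hRdef]
  rw [hsplit]
  have hG : ∀ s, ‖form K (mFourierCoeff (v s)) (mFourierCoeff (v s))‖ ≤ C * ∑' k, weight k :=
    fun s => by
      rw [← twoMicrolocalWigner_eq ha e hħ]
      exact norm_twoMicrolocalWigner_le ha hC e hħ ε (hn s)
  have hI := intervalIntegral.norm_integral_le_of_norm_le_const (a := s₁) (b := s₂)
    (fun s _ => hR s)
  rw [abs_of_nonneg (sub_nonneg.2 hs)] at hI
  calc _ ≤ ‖form K (mFourierCoeff (v s₂)) (mFourierCoeff (v s₂))‖ +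
        ‖form K (mFourierCoeff (v s₁)) (mFourierCoeff (v s₁))‖ + ‖∫ s in s₁..s₂, R s‖ :=
        (norm_sub_le _ _).trans (add_le_add (norm_sub_le _ _) le_rfl)
    _ ≤ _ := by linarith [hG s₁, hG s₂]

/-! ### Limits in the sense of averages in time -/

/-- Lebesgue differentiation turns bounds on averages over all intervals into bounds at almost every
time. The real functional `L` will be plus or minus the real or imaginary part. -/
lemma ae_le_of_forall_integral_le {f : ℝ → ℂ} (hf : LocallyIntegrable f) (L : ℂ →L[ℝ] ℝ) {c : ℝ}
    (h : ∀ s t, s < t → L (∫ x in s..t, f x) ≤ c * (t - s)) : ∀ᵐ t, L (f t) ≤ c := by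
  filter_upwards [_root_.LocallyIntegrable.ae_hasDerivAt_integral hf] with t ht
  have h1 : HasDerivAt (fun s => L (∫ x in t..s, f x)) (L (f t)) t :=
    L.hasFDerivAt.comp_hasDerivAt t (ht t)
  have h2 := (hasDerivAt_iff_tendsto_slope.1 h1).mono_left
    (nhdsWithin_mono t (show Ioi t ⊆ {t}ᶜ from fun s hs => ne_of_gt hs))
  refine le_of_tendsto h2 ?_
  filter_upwards [self_mem_nhdsWithin] with s hs
  rw [slope_def_field, intervalIntegral.integral_same, map_zero, sub_zero,
    div_le_iff₀ (sub_pos.2 hs)]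
  exact h t s hs

/-- The inequality is closed in `η` by continuity of the extended derivatives, and finite values are
dense. -/
lemma bNormLE_of_real {a : Phase → ℂ} (ha : SmoothOnPhase a) {M : ℝ}
    (h : ∀ j ≤ 3, ∀ (x ξ : Plane) (η : ℝ),
      ‖iteratedFDeriv ℝ j (fun y : Plane => a (toTorus y, ξ, (η : EReal))) x‖ ≤ M) :
    BNormLE a M := by
  intro j hj x ξ η
  obtain ⟨P, hP, hPa⟩ := ha.exists_slice_jet j
  have hc : IsClosed {η : EReal | ‖P (x, ξ, η)‖ ≤ M} :=
    isClosed_le (hP.comp (by fun_prop)).norm continuous_const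
  have := denseRange_coe_real.induction_on (p := fun η => ‖P (x, ξ, η)‖ ≤ M) η hc
    (fun η => by rw [← hPa]; exact h j hj x ξ η)
  rwa [hPa]

lemma exists_bNormLE {a : Phase → ℂ} (ha : a ∈ testFunctions) : ∃ M, BNormLE a M := by
  choose C hC0 hC using iteratedFDeriv_lift_bounded ha
  refine ⟨∑ j ∈ Finset.range 4, C j, bNormLE_of_real ha.1 fun j hj x ξ η => ?_⟩
  refine (congrArg norm (iteratedFDeriv_slice_left ha.1.contDiff j x (ξ, η))).trans_le ?_
  exact (norm_compContinuousLinearMap_inl_le _).trans ((hC j _).trans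
    (Finset.single_le_sum (f := C) (fun i _ => hC0 i) (Finset.mem_range.2 (by omega))))

lemma IsDualFamily.locallyIntegrable {μ : ℝ → testFunctions →ₗ[ℂ] ℂ} (hμ : IsDualFamily μ)
    (a : testFunctions) : LocallyIntegrable fun t => μ t a := by
  obtain ⟨C, hC⟩ := hμ.bounded
  obtain ⟨M, hM⟩ := exists_bNormLE a.2
  have : MemLp (fun t => μ t a) ⊤ volume :=
    memLp_top_of_bound (hμ.measurable a) (C * M) (hC.mono fun t ht => ht a M hM)
  exact this.locallyIntegrable le_top

/-- The setting of a sequence of solutions converging to a two-microlocal measure, with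
`E n = ε (h n)` and `T n = τ (h n)`. -/
structure SemiclassicalLimit (V : Torus → ℝ) (e : Fin 2 → ℤ) (h E T : ℕ → ℝ) (v : ℕ → ℝ → L2)
    (μ : ℝ → testFunctions →ₗ[ℂ] ℂ) : Prop where
  smooth : SmoothOnTorus fun x => (V x : ℂ)
  h_pos : ∀ n, 0 < h n
  h_lim : Tendsto h atTop (𝓝 0)
  E_pos : ∀ᶠ n in atTop, 0 < E n
  E_lim : Tendsto E atTop (𝓝 0)
  ratio_lim : Tendsto (fun n => h n / E n) atTop (𝓝 0)
  T_lim : Tendsto T atTop atTop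
  norm_zero : ∀ n, ‖v n 0‖ = 1
  strict : IsStrictlyHOscillating h fun n => v n 0
  solution : ∀ n, IsSchrodingerSolution (h n) (E n) V (v n 0) (v n)
  dual : IsDualFamily μ
  limit : ∀ (a : testFunctions) (θ : ℝ → ℂ), Integrable θ →
    Tendsto (fun n => ∫ t : ℝ, θ t * twoMicrolocalWigner e (h n) (E n) (v n (t * T n))
      (a : Phase → ℂ)) atTop (𝓝 (∫ t : ℝ, θ t * μ t a))

/-- The potential `ε² V`. -/
def scaledPotential {V : Torus → ℝ} (hV : SmoothOnTorus fun x => (V x : ℂ)) (ε : ℝ) : C(Torus, ℂ) :=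
  ⟨fun x => (ε : ℂ) ^ 2 * (V x : ℂ), continuous_const.mul hV.continuous⟩

section scaledPotential

variable {V : Torus → ℝ} (hV : SmoothOnTorus fun x => (V x : ℂ)) (ε : ℝ)

lemma mFourierCoeff_scaledPotential (j : Fin 2 → ℤ) :
    mFourierCoeff (scaledPotential hV ε) j =
      (ε : ℂ) ^ 2 * mFourierCoeff (fun x => (V x : ℂ)) j := by
  rw [mFourierCoeff_eq, mFourierCoeff_eq, ← integral_const_mul]
  congr 1; ext x
  simp only [scaledPotential, ContinuousMap.coe_mk]
  ring

lemma isPotential_scaledPotential : IsPotential (scaledPotential hV ε) := by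
  constructor
  · intro x
    simp [scaledPotential]
  · have := hV.summable_mFourierCoeff.mul_left ((ε : ℂ) ^ 2)
    exact this.congr fun j => (mFourierCoeff_scaledPotential hV ε j).symm

lemma exists_hasSum_scaledPotential : ∃ S, ∀ ε : ℝ, HasSum
    (fun j => ‖mFourierCoeff (scaledPotential hV ε) j‖ * ‖latticeVec j‖) (ε ^ 2 * S) := by
  refine ⟨∑' j, ‖mFourierCoeff (fun x => (V x : ℂ)) j‖ * ‖latticeVec j‖, fun ε => ?_⟩
  have := hV.summable_norm_mul_mFourierCoeff.hasSum.mul_left (ε ^ 2)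
  convert! this using 1
  ext j
  rw [mFourierCoeff_scaledPotential, norm_mul, norm_pow, Complex.norm_real, Real.norm_eq_abs,
    sq_abs, mul_assoc]

lemma exists_norm_scaledPotential_le : ∃ B, 0 < B ∧ ∀ ε : ℝ,
    ‖scaledPotential hV ε‖ ≤ ε ^ 2 * B := by
  refine ⟨‖scaledPotential hV 1‖ + 1, by positivity, fun ε => ?_⟩
  refine (ContinuousMap.norm_le _ (by positivity)).2 fun x => ?_
  have := (scaledPotential hV 1).norm_coe_le_norm x
  have e : scaledPotential hV ε x = (ε : ℂ) ^ 2 * scaledPotential hV 1 x := by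
    simp [scaledPotential]
  rw [e, norm_mul, norm_pow, Complex.norm_real, Real.norm_eq_abs, sq_abs]
  exact mul_le_mul_of_nonneg_left (by linarith) (by positivity)

end scaledPotential

namespace SemiclassicalLimit

variable {V : Torus → ℝ} {e : Fin 2 → ℤ} {h E T : ℕ → ℝ} {v : ℕ → ℝ → L2}
  {μ : ℝ → testFunctions →ₗ[ℂ] ℂ}

lemma isFlow (H : SemiclassicalLimit V e h E T v μ) (n : ℕ) :
    IsFlow (h n) (scaledPotential H.smooth (E n)) (v n) :=
  (H.solution n).isFlow (H.h_pos n).ne' fun _ => rfl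

lemma norm_eq (H : SemiclassicalLimit V e h E T v μ) (n : ℕ) (s : ℝ) : ‖v n s‖ = 1 :=
  ((H.isFlow n).norm_eq (isPotential_scaledPotential _ _) s).trans (H.norm_zero n)

lemma tendsto_integral (H : SemiclassicalLimit V e h E T v μ) (a : testFunctions) {s t : ℝ}
    (hst : s ≤ t) :
    Tendsto (fun n => ∫ x in s..t, twoMicrolocalWigner e (h n) (E n) (v n (x * T n)) a) atTop
      (𝓝 (∫ x in s..t, μ x a)) := by
  have key : ∀ F : ℝ → ℂ, ∫ x in s..t, F x = ∫ x, (Ioc s t).indicator 1 x * F x := by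
    intro F
    rw [intervalIntegral.integral_of_le hst, ← integral_indicator measurableSet_Ioc]
    congr 1; ext x
    by_cases hx : x ∈ Ioc s t <;> simp [hx]
  simp only [key]
  refine H.limit a _ ?_
  rw [integrable_indicator_iff measurableSet_Ioc]
  exact integrableOn_const (by simp)

lemma ae_le_of_integral (H : SemiclassicalLimit V e h E T v μ) (a : testFunctions)
    (L : ℂ →L[ℝ] ℝ) (c : ℝ)
    (hL : ∀ s t, s < t → ∀ δ > 0, ∀ᶠ n in atTop,
      L (∫ x in s..t, twoMicrolocalWigner e (h n) (E n) (v n (x * T n)) a) ≤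
        (c + δ) * (t - s)) : ∀ᵐ t, L (μ t a) ≤ c := by
  refine ae_le_of_forall_integral_le (H.dual.locallyIntegrable a) L fun s t hst => ?_
  refine le_of_forall_pos_le_add fun δ hδ => ?_
  have h1 := (L.continuous.tendsto _).comp (H.tendsto_integral a hst.le)
  have h2 := le_of_tendsto h1 (hL s t hst (δ / (t - s)) (div_pos hδ (sub_pos.2 hst)))
  have : t - s ≠ 0 := (sub_pos.2 hst).ne'
  refine h2.trans (le_of_eq ?_)
  field_simp

lemma ae_le_of_forall (H : SemiclassicalLimit V e h E T v μ) (a : testFunctions)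
    (L : ℂ →L[ℝ] ℝ) (c : ℝ)
    (hL : ∀ δ > 0, ∀ᶠ n in atTop, ∀ s, L (twoMicrolocalWigner e (h n) (E n) (v n s) a) ≤ c + δ) :
    ∀ᵐ t, L (μ t a) ≤ c := by
  refine H.ae_le_of_integral a L c fun s t hst δ hδ => ?_
  filter_upwards [hL δ hδ] with n hn
  have hi : IntervalIntegrable
      (fun x => twoMicrolocalWigner e (h n) (E n) (v n (x * T n)) a) volume s t :=
    intervalIntegrable_twoMicrolocalWigner a.2 e (H.h_pos n) (E n)
      (v := fun x => v n (x * T n))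
      ((H.isFlow n).continuous.comp (continuous_id.mul continuous_const))
      (fun x => H.norm_eq n _) s t
  rw [← L.intervalIntegral_comp_comm hi]
  refine (intervalIntegral.integral_mono_on hst.le
    ((L.integrable_comp hi.1 |> fun h => ?_) : IntervalIntegrable _ volume s t)
    intervalIntegrable_const (fun x _ => hn (x * T n))).trans ?_
  · exact (intervalIntegrable_iff_integrableOn_Ioc_of_le hst.le).2 h
  · rw [intervalIntegral.integral_const, smul_eq_mul, mul_comm]

lemma ae_eq_zero_of_tendsto (H : SemiclassicalLimit V e h E T v μ) (a : testFunctions)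
    (hL : ∀ s t, s < t → Tendsto (fun n =>
      ∫ x in s..t, twoMicrolocalWigner e (h n) (E n) (v n (x * T n)) a) atTop (𝓝 0)) :
    ∀ᵐ t, μ t a = 0 := by
  have key : ∀ L : ℂ →L[ℝ] ℝ, ∀ᵐ t, L (μ t a) ≤ 0 := fun L => by
    refine ae_le_of_forall_integral_le (H.dual.locallyIntegrable a) L fun s t hst => ?_
    rw [tendsto_nhds_unique (H.tendsto_integral a hst.le) (hL s t hst)]
    simp
  filter_upwards [key Complex.reCLM, key (-Complex.reCLM), key Complex.imCLM,
    key (-Complex.imCLM)] with t h1 h2 h3 h4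
  simp at h1 h2 h3 h4
  exact Complex.ext (le_antisymm h1 h2) (le_antisymm h3 h4)

/-- After rescaling time, the boundary terms are divided by `T n` and the commutator, with a
potential of size `E n ^ 2`, is of order `E n ^ 2 * (1 + (E n)⁻¹)`. Both tend to zero. -/
lemma ae_geodesicDeriv (H : SemiclassicalLimit V e h E T v μ) (a : testFunctions) :
    ∀ᵐ t, μ t ⟨geodesicDeriv a, geodesicDeriv_mem a.2⟩ = 0 := by
  obtain ⟨C, hC0, hC, hC'⟩ := exists_phaseCoeff_bound a.2
  obtain ⟨S, hS⟩ := exists_hasSum_scaledPotential H.smooth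
  refine H.ae_eq_zero_of_tendsto _ fun s t hst => ?_
  set W := C * ∑' k, weight k
  have hT : Tendsto (fun n => (T n)⁻¹ * (2 * W)) atTop (𝓝 0) := by
    simpa using H.T_lim.inv_tendsto_atTop.mul_const (2 * W)
  have hE : Tendsto (fun n => 2 * Real.pi * (E n ^ 2 + E n) * S * W * (t - s)) atTop (𝓝 0) := by
    have := ((H.E_lim.pow 2).add H.E_lim).const_mul (2 * Real.pi)
    simpa using ((this.mul_const S).mul_const W).mul_const (t - s)
  refine squeeze_zero_norm' ?_ (by simpa using hT.add hE)
  filter_upwards [H.E_pos, H.T_lim.eventually_gt_atTop 0] with n hEn hTn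
  have hb := norm_integral_geodesicDeriv_le a.2 hC0 hC hC' e (H.h_pos n) hEn
    (isPotential_scaledPotential H.smooth (E n)) (hS (E n)) (H.isFlow n) (H.norm_zero n)
    (mul_le_mul_of_nonneg_right hst.le hTn.le)
  have hsub := intervalIntegral.integral_comp_mul_right (a := s) (b := t)
    (fun x => twoMicrolocalWigner e (h n) (E n) (v n x) (geodesicDeriv a)) hTn.ne'
  rw [hsub, norm_smul, norm_inv, Real.norm_of_nonneg hTn.le]
  refine (mul_le_mul_of_nonneg_left hb (inv_pos.2 hTn).le).trans (le_of_eq ?_)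
  field_simp
  simp only [W]
  ring

end SemiclassicalLimit

/-! ### Positivity -/

lemma isClosed_nonneg_complex : IsClosed {z : ℂ | z.im = 0 ∧ 0 ≤ z.re} :=
  (isClosed_eq Complex.continuous_im continuous_const).inter
    (isClosed_le continuous_const Complex.continuous_re)

/-- The average over `p ∈ (m + B) ∩ (m' + B)` of the matrix elements of the multiplication by a
function with Fourier coefficients `F p`. -/
def averagedKernel (B : Finset (Fin 2 → ℤ)) (F : (Fin 2 → ℤ) → (Fin 2 → ℤ) → ℂ)
    (m m' : Fin 2 → ℤ) : ℂ :=
  (B.card : ℂ)⁻¹ * ∑ q ∈ B, if q - (m' - m) ∈ B then F (m + q) (m' - m) else 0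

/-- The proportion of `B` that is covered by `B + k`. -/
def overlap (B : Finset (Fin 2 → ℤ)) (k : Fin 2 → ℤ) : ℝ :=
  ({q ∈ B | q - k ∈ B}.card : ℝ) / B.card

lemma overlap_nonneg (B : Finset (Fin 2 → ℤ)) (k : Fin 2 → ℤ) : 0 ≤ overlap B k := by
  unfold overlap; positivity

lemma overlap_le_one (B : Finset (Fin 2 → ℤ)) (k : Fin 2 → ℤ) : overlap B k ≤ 1 :=
  div_le_one_of_le₀ (by exact_mod_cast Finset.card_filter_le _ _) (by positivity)

/-- Box points in the overlap contribute the variation `M * D` of the symbol. The others contribute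
the full size `M`, in proportion `1 - overlap`. -/
lemma norm_sub_averagedKernel_le {B : Finset (Fin 2 → ℤ)} (hB : B.Nonempty)
    {F : (Fin 2 → ℤ) → (Fin 2 → ℤ) → ℂ} {m m' : Fin 2 → ℤ} {z : ℂ} {M D : ℝ} (hD : 0 ≤ D)
    (hz : ‖z‖ ≤ M)
    (h : ∀ q ∈ B, q - (m' - m) ∈ B → ‖z - F (m + q) (m' - m)‖ ≤ M * D) :
    ‖z - averagedKernel B F m m'‖ ≤ M * (D + (1 - overlap B (m' - m))) := by
  have hM : 0 ≤ M := (norm_nonneg _).trans hz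
  have hc : (0 : ℝ) < B.card := by exact_mod_cast hB.card_pos
  have hc' : (B.card : ℂ) ≠ 0 := by exact_mod_cast hc.ne'
  have e : z - averagedKernel B F m m' = (B.card : ℂ)⁻¹ *
      ∑ q ∈ B, (z - if q - (m' - m) ∈ B then F (m + q) (m' - m) else 0) := by
    rw [Finset.sum_sub_distrib, mul_sub, averagedKernel, Finset.sum_const, nsmul_eq_mul,
      inv_mul_cancel_left₀ hc']
  have h1 : ∑ q ∈ B, ‖z - if q - (m' - m) ∈ B then F (m + q) (m' - m) else 0‖ ≤
      ∑ q ∈ B, (M * (D + 1) - M * if q - (m' - m) ∈ B then (1 : ℝ) else 0) := by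
    refine Finset.sum_le_sum fun q hq => ?_
    by_cases hq' : q - (m' - m) ∈ B
    · simp only [hq', if_true]
      linarith [h q hq hq']
    · simp only [hq', if_false, sub_zero, mul_zero]
      nlinarith
  rw [e, norm_mul, norm_inv, Complex.norm_natCast, inv_mul_le_iff₀ hc]
  refine (norm_sum_le _ _).trans (h1.trans (le_of_eq ?_))
  rw [Finset.sum_sub_distrib, Finset.sum_const, ← Finset.mul_sum, Finset.sum_boole, nsmul_eq_mul,
    overlap]
  field_simp
  ring

lemma SchurBound.averagedKernel {B : Finset (Fin 2 → ℤ)}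
    {F : (Fin 2 → ℤ) → (Fin 2 → ℤ) → ℂ} {M : (Fin 2 → ℤ) → ℝ} (hM : Summable M)
    (hF : ∀ p k, ‖F p k‖ ≤ M k) : SchurBound (averagedKernel B F) M := by
  refine ⟨hM, fun m m' => ?_⟩
  have hM0 : 0 ≤ M (m' - m) := (norm_nonneg _).trans (hF 0 _)
  have h1 : ‖∑ q ∈ B, if q - (m' - m) ∈ B then F (m + q) (m' - m) else 0‖ ≤
      B.card * M (m' - m) := by
    refine (norm_sum_le_of_le B (n := fun _ => M (m' - m)) fun q _ => ?_).trans (by simp)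
    split_ifs
    · exact hF _ _
    · simpa using hM0
  rw [TwoMicrolocal.averagedKernel, norm_mul, norm_inv, Complex.norm_natCast]
  rcases B.eq_empty_or_nonempty with rfl | hB
  · simpa using hM0
  · rwa [inv_mul_le_iff₀ (by exact_mod_cast hB.card_pos)]

lemma sum_mFourierCoeff_eq_integral {f : Torus → ℂ} (hf : Continuous f)
    (s : Finset (Fin 2 → ℤ)) (c : (Fin 2 → ℤ) → ℂ) :
    ∑ m ∈ s, ∑ m' ∈ s, mFourierCoeff f (m' - m) * c m * (starRingEnd ℂ) (c m') =
      ∫ x, f x * ((‖expSum s c x‖ ^ 2 : ℝ) : ℂ) ∂torusMeasure := by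
  have e : ∀ x, f x * ((‖expSum s c x‖ ^ 2 : ℝ) : ℂ) = ∑ m ∈ s, ∑ m' ∈ s,
      mFourier (-(m' - m)) x * f x * (c m * (starRingEnd ℂ) (c m')) := by
    intro x
    rw [← Complex.normSq_eq_norm_sq, ← Complex.mul_conj, expSum, map_sum, Finset.sum_mul_sum,
      Finset.mul_sum]
    refine Finset.sum_congr rfl fun m _ => ?_
    rw [Finset.mul_sum]
    refine Finset.sum_congr rfl fun m' _ => ?_
    rw [neg_sub, sub_eq_add_neg, mFourier_add, mFourier_neg, map_mul]
    ring
  have hi : ∀ m m' : Fin 2 → ℤ, Integrable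
      (fun x => mFourier (-(m' - m)) x * f x * (c m * (starRingEnd ℂ) (c m'))) torusMeasure :=
    fun m m' => ((((mFourier _).continuous.mul hf).mul continuous_const)).integrable_of_hasCompactSupport
      (HasCompactSupport.of_compactSpace _)
  simp only [e]
  rw [integral_finsetSum _ fun m _ => integrable_finsetSum _ fun m' _ => hi m m']
  refine Finset.sum_congr rfl fun m _ => ?_
  rw [integral_finsetSum _ fun m' _ => hi m m']
  refine Finset.sum_congr rfl fun m' _ => ?_
  rw [integral_mul_const, mFourierCoeff_eq]
  ring

/-- Exchanging sums, the form becomes the sum over `p`, with weight `1/|B|`, of the integrals of `f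
p` against the squared modulus of the part of the Fourier series with frequencies in `p - B`. It is
nonnegative on finite truncations, hence in the limit. -/
lemma form_averagedKernel_nonneg {B : Finset (Fin 2 → ℤ)} {f : (Fin 2 → ℤ) → Torus → ℂ}
    (hf : ∀ p, Continuous (f p)) (hf0 : ∀ p x, (f p x).im = 0 ∧ 0 ≤ (f p x).re)
    {M : (Fin 2 → ℤ) → ℝ} (hM : Summable M) (hF : ∀ p k, ‖mFourierCoeff (f p) k‖ ≤ M k)
    {a : (Fin 2 → ℤ) → ℂ} {A : ℝ} (ha : SqBound a A) :
    form (averagedKernel B fun p => mFourierCoeff (f p)) a a ∈ {z : ℂ | z.im = 0 ∧ 0 ≤ z.re} := by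
  have hlim := (SchurBound.averagedKernel (B := B) hM hF).tendsto_finset ha ha
  refine isClosed_nonneg_complex.mem_of_tendsto hlim (Eventually.of_forall fun s => ?_)
  let P := Finset.image (fun x : (Fin 2 → ℤ) × (Fin 2 → ℤ) => x.1 + x.2) (s ×ˢ B)
  have hK : ∀ m ∈ s, ∀ m', averagedKernel B (fun p => mFourierCoeff (f p)) m m' =
      (B.card : ℂ)⁻¹ * ∑ p ∈ P, if p - m ∈ B ∧ p - m' ∈ B
        then mFourierCoeff (f p) (m' - m) else 0 := by
    intro m hm m'
    rw [averagedKernel]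
    congr 1
    rw [← Finset.sum_filter, ← Finset.sum_filter]
    refine Finset.sum_nbij' (fun q => m + q) (fun p => p - m) ?_ ?_ ?_ ?_ ?_
    · intro q hq
      rw [Finset.mem_filter] at hq ⊢
      refine ⟨Finset.mem_image.2 ⟨(m, q), Finset.mem_product.2 ⟨hm, hq.1⟩, rfl⟩, ?_, ?_⟩
      · simpa using hq.1
      · have : m + q - m' = q - (m' - m) := by abel
        rw [this]; exact hq.2
    · intro p hp
      rw [Finset.mem_filter] at hp ⊢
      refine ⟨hp.2.1, ?_⟩
      have : p - m - (m' - m) = p - m' := by abel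
      rw [this]; exact hp.2.2
    · intro q _; simp
    · intro p _; simp
    · intro q _; rfl
  have hsum : ∑ m ∈ s, ∑ m' ∈ s, averagedKernel B (fun p => mFourierCoeff (f p)) m m' * a m *
      (starRingEnd ℂ) (a m') = ((∑ p ∈ P, (B.card : ℝ)⁻¹ *
        ∫ x, (f p x).re * ‖expSum {m ∈ s | p - m ∈ B} a x‖ ^ 2 ∂torusMeasure : ℝ) : ℂ) := by
    have h1 : ∀ p, ((∫ x, (f p x).re * ‖expSum {m ∈ s | p - m ∈ B} a x‖ ^ 2 ∂torusMeasure : ℝ) : ℂ)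
        = ∑ m ∈ s, ∑ m' ∈ s, (if p - m ∈ B ∧ p - m' ∈ B
        then mFourierCoeff (f p) (m' - m) else 0) * a m * (starRingEnd ℂ) (a m') := by
      intro p
      have h2 := sum_mFourierCoeff_eq_integral (hf p) {m ∈ s | p - m ∈ B} a
      rw [← integral_complex_ofReal]
      have h3 : ∀ x, (((f p x).re * ‖expSum {m ∈ s | p - m ∈ B} a x‖ ^ 2 : ℝ) : ℂ) =
          f p x * ((‖expSum {m ∈ s | p - m ∈ B} a x‖ ^ 2 : ℝ) : ℂ) := by
        intro x
        have : f p x = ((f p x).re : ℂ) := Complex.ext rfl (by simp [(hf0 p x).1])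
        conv_rhs => rw [this]
        push_cast; ring
      simp only [h3]
      rw [← h2, Finset.sum_filter]
      refine Finset.sum_congr rfl fun m _ => ?_
      by_cases hm : p - m ∈ B
      · rw [if_pos hm, Finset.sum_filter]
        refine Finset.sum_congr rfl fun m' _ => ?_
        by_cases hm' : p - m' ∈ B <;> simp [hm, hm']
      · simp [hm]
    rw [Complex.ofReal_sum]
    simp only [Complex.ofReal_mul, h1, Finset.mul_sum]
    symm
    rw [Finset.sum_comm]
    refine Finset.sum_congr rfl fun m hm => ?_
    rw [Finset.sum_comm]
    refine Finset.sum_congr rfl fun m' _ => ?_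
    rw [hK m hm, Finset.mul_sum, Finset.sum_mul, Finset.sum_mul]
    refine Finset.sum_congr rfl fun p _ => ?_
    push_cast
    ring
  rw [hsum]
  refine ⟨Complex.ofReal_im _, ?_⟩
  rw [Complex.ofReal_re]
  exact Finset.sum_nonneg fun p _ => mul_nonneg (by positivity)
    (integral_nonneg fun x => mul_nonneg (hf0 p x).2 (by positivity))

/-- The square box of side `N`. -/
def squareBox (N : ℕ) : Finset (Fin 2 → ℤ) := Fintype.piFinset fun _ => Finset.Ico 0 (N : ℤ)

lemma overlap_squareBox (N : ℕ) (k : Fin 2 → ℤ) :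
    overlap (squareBox N) k = ∏ i, ((Finset.Ico (max 0 (k i)) (min N (N + k i))).card : ℝ) / N := by
  have h : {q ∈ squareBox N | q - k ∈ squareBox N} =
      Fintype.piFinset fun i => Finset.Ico (max 0 (k i)) (min (N : ℤ) (N + k i)) := by
    ext q
    simp only [squareBox, Finset.mem_filter, Fintype.mem_piFinset, Finset.mem_Ico, Pi.sub_apply,
      ← forall_and]
    refine forall_congr' fun i => ?_
    omega
  rw [overlap, h, squareBox, Fintype.card_piFinset, Fintype.card_piFinset]
  simp [Finset.prod_div_distrib]

/-- Følner property of large boxes: for a fixed shift `k`, the fraction lost in each coordinate is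
at most `|k i| / N`. -/
lemma tendsto_overlap_squareBox (k : Fin 2 → ℤ) :
    Tendsto (fun N => overlap (squareBox N) k) atTop (𝓝 1) := by
  simp only [overlap_squareBox]
  have h : ∀ i, Tendsto
      (fun N : ℕ => ((Finset.Ico (max 0 (k i)) (min (N : ℤ) (N + k i))).card : ℝ) / N) atTop
      (𝓝 1) := by
    intro i
    have h0 : Tendsto (fun N : ℕ => 1 - (|k i| : ℝ) / N) atTop (𝓝 1) := by
      simpa using (tendsto_const_div_atTop_nhds_zero_nat (|k i| : ℝ)).const_sub 1
    refine tendsto_of_tendsto_of_tendsto_of_le_of_le' h0 tendsto_const_nhds ?_ ?_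
    · filter_upwards [eventually_gt_atTop 0] with N hN
      have hN' : (0 : ℝ) < N := by exact_mod_cast hN
      rw [le_div_iff₀ hN', sub_mul, div_mul_cancel₀ _ hN'.ne', one_mul, Int.card_Ico,
        sub_le_iff_le_add]
      have : (N : ℤ) ≤ ((min (N : ℤ) (N + k i) - max 0 (k i)).toNat : ℤ) + |k i| := by
        rcases abs_cases (k i) with h | h <;> omega
      exact_mod_cast this
    · filter_upwards [eventually_gt_atTop 0] with N hN
      have hN' : (0 : ℝ) < N := by exact_mod_cast hN
      rw [div_le_one hN', Int.card_Ico]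
      have : (min (N : ℤ) (N + k i) - max 0 (k i)).toNat ≤ N := by omega
      exact_mod_cast this
  simpa using tendsto_finsetProd Finset.univ fun i _ => h i

lemma tendsto_tsum_weight_overlap :
    Tendsto (fun N => ∑' k, weight k * (1 - overlap (squareBox N) k)) atTop (𝓝 0) := by
  have := tendsto_tsum_of_dominated_convergence (𝓕 := atTop)
    (f := fun N k => weight k * (1 - overlap (squareBox N) k)) (g := fun _ => (0 : ℝ))
    summable_weight (fun k => by
      simpa using ((tendsto_overlap_squareBox k).const_sub 1).const_mul (weight k))
    (Eventually.of_forall fun N k => ?_)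
  · simpa using this
  · have h1 := overlap_nonneg (squareBox N) k
    have h2 := overlap_le_one (squareBox N) k
    rw [Real.norm_of_nonneg (mul_nonneg (weight_pos k).le (by linarith))]
    exact mul_le_of_le_one_right (weight_pos k).le (by linarith)

/-- A weak Gårding inequality. The box is fixed first, so that the overlap defect summed against the
weight costs at most `δ`. Freezing the symbol at the frequencies `2πħp` costs a second `δ` when `(ħ
+ ħ/ε) r ≤ δ`, where `r` is proportional to the box radius and does not depend on `ħ`, `ε` or `u`.
-/
lemma exists_nonneg_near_twoMicrolocalWigner {a : Phase → ℂ} (ha : a ∈ testFunctions)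
    (ha0 : ∀ p, (a p).im = 0 ∧ 0 ≤ (a p).re) (e : Fin 2 → ℤ) {δ : ℝ} (hδ : 0 < δ) :
    ∃ r : ℝ, ∀ ħ ε : ℝ, 0 < ħ → 0 < ε → (ħ + ħ / ε) * r ≤ δ → ∀ u : L2, ‖u‖ = 1 →
      ∃ z : ℂ, (z.im = 0 ∧ 0 ≤ z.re) ∧ ‖twoMicrolocalWigner e ħ ε u a - z‖ ≤ 2 * δ := by
  obtain ⟨C, hC0, hC, hC'⟩ := exists_phaseCoeff_bound ha
  have hlim := tendsto_tsum_weight_overlap.const_mul C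
  rw [mul_zero] at hlim
  obtain ⟨N, hN, hN0⟩ := ((hlim.eventually (gt_mem_nhds hδ)).and (eventually_gt_atTop 0)).exists
  set B := squareBox N with hBdef
  have hB : B.Nonempty := ⟨0, by simp [hBdef, squareBox, hN0]⟩
  let ρ := ∑ q ∈ B, ‖latticeVec q‖
  have hρ : ∀ q ∈ B, ‖latticeVec q‖ ≤ ρ := fun q hq =>
    Finset.single_le_sum (f := fun q => ‖latticeVec q‖) (fun _ _ => norm_nonneg _) hq
  have hρ0 : 0 ≤ ρ := Finset.sum_nonneg fun _ _ => norm_nonneg _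
  refine ⟨2 * Real.pi * ρ * (C * ∑' k, weight k), fun ħ ε hħ hε hr u hu => ?_⟩
  let ξ : (Fin 2 → ℤ) → Plane := fun p => (2 * Real.pi * ħ) • latticeVec p
  let f : (Fin 2 → ℤ) → Torus → ℂ := fun p x => a (x, ξ p, ((hamiltonian e (ξ p) / ε : ℝ) : EReal))
  have hb : SqBound (mFourierCoeff u) 1 := by simpa [hu] using sqBound_coeff u
  have hF : ∀ p k, ‖mFourierCoeff (f p) k‖ ≤ C * weight k := fun p k => hC k _ _
  have hf : ∀ p, Continuous (f p) := fun p => ha.1.continuous.comp (by fun_prop)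
  refine ⟨_, form_averagedKernel_nonneg (B := B) hf (fun p x => ha0 _) (summable_weight.mul_left C)
    hF hb, ?_⟩
  set D := (1 + ε⁻¹) * (2 * Real.pi * ħ * ρ) with hD
  have hD0 : 0 ≤ D := by positivity
  have hK := schurBound_symbolKernel hC e ħ ε
  have hK' := SchurBound.averagedKernel (B := B) (summable_weight.mul_left C) hF
  have hs1 : Summable fun k => weight k * (1 - overlap B k) := by
    refine Summable.of_nonneg_of_le (fun k => ?_) (fun k => ?_) summable_weight
    · exact mul_nonneg (weight_pos k).le (by linarith [overlap_le_one B k])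
    · exact mul_le_of_le_one_right (weight_pos k).le (by linarith [overlap_nonneg B k])
  have hM : (fun k => C * weight k * (D + (1 - overlap B k))) =
      fun k => (C * D) * weight k + C * (weight k * (1 - overlap B k)) := by
    ext k; ring
  have hd : SchurBound (fun m m' => symbolKernel ħ (rescaledSymbol e ε a) m m' -
      averagedKernel B (fun p => mFourierCoeff (f p)) m m')
      fun k => C * weight k * (D + (1 - overlap B k)) := by
    refine ⟨?_, fun m m' => ?_⟩
    · rw [hM]
      exact (summable_weight.mul_left _).add (hs1.mul_left _)
    · refine norm_sub_averagedKernel_le hB hD0 (hK.le m m') fun q hq hq' => ?_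
      rw [symbolKernel_rescaledSymbol]
      refine (norm_phaseCoeff_sub_le hC0 hC' e hε _ _ (ξ (m + q))).trans ?_
      refine mul_le_mul_of_nonneg_left ?_ (mul_nonneg hC0 (weight_pos _).le)
      refine mul_le_mul_of_nonneg_left ?_ (by positivity)
      -- The same box point is `p = m + q = m' + q'` with `q' = q - (m' - m)`; averaging the two
      -- expressions compares `2πħp` with the midpoint `πħ(m + m')`, at distance controlled by the
      -- box alone.
      have e1 : (Real.pi * ħ) • latticeVec (m + m') - ξ (m + q) =
          -((Real.pi * ħ) • (latticeVec q + latticeVec (q - (m' - m)))) := by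
        simp only [ξ, latticeVec_add, latticeVec_sub]
        module
      rw [e1, norm_neg, norm_smul, Real.norm_of_nonneg (by positivity)]
      have := (norm_add_le _ _).trans (add_le_add (hρ _ hq) (hρ _ hq'))
      calc _ ≤ Real.pi * ħ * (ρ + ρ) := mul_le_mul_of_nonneg_left this (by positivity)
        _ = _ := by ring
  have h1 := hd.norm_form_le hb hb
  rw [hK.form_sub hK' hb hb, ← twoMicrolocalWigner_eq ha e hħ] at h1
  refine h1.trans ?_
  rw [hM, Summable.tsum_add (summable_weight.mul_left _) (hs1.mul_left _), tsum_mul_left,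
    tsum_mul_left]
  have h2 : C * D * ∑' k, weight k = (ħ + ħ / ε) * (2 * Real.pi * ρ * (C * ∑' k, weight k)) := by
    rw [hD]; field_simp
  rw [h2]
  linarith

namespace SemiclassicalLimit

variable {V : Torus → ℝ} {e : Fin 2 → ℤ} {h E T : ℕ → ℝ} {v : ℕ → ℝ → L2}
  {μ : ℝ → testFunctions →ₗ[ℂ] ℂ}

lemma ae_nonneg (H : SemiclassicalLimit V e h E T v μ) (a : testFunctions)
    (ha0 : ∀ p, ((a : Phase → ℂ) p).im = 0 ∧ 0 ≤ ((a : Phase → ℂ) p).re) :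
    ∀ᵐ t, (μ t a).im = 0 ∧ 0 ≤ (μ t a).re := by
  have key : ∀ L : ℂ →L[ℝ] ℝ, ‖L‖ ≤ 1 → (∀ z : ℂ, z.im = 0 ∧ 0 ≤ z.re → L z ≤ 0) →
      ∀ᵐ t, L (μ t a) ≤ 0 := by
    intro L hL1 hL
    refine H.ae_le_of_forall a L 0 fun δ hδ => ?_
    obtain ⟨r, hr⟩ := exists_nonneg_near_twoMicrolocalWigner a.2 ha0 e (half_pos hδ)
    have ht : Tendsto (fun n => (h n + h n / E n) * r) atTop (𝓝 0) := by
      simpa using (H.h_lim.add H.ratio_lim).mul_const r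
    filter_upwards [H.E_pos, ht.eventually (gt_mem_nhds (half_pos hδ))] with n hEn hn s
    obtain ⟨z, hz, hz'⟩ := hr (h n) (E n) (H.h_pos n) hEn hn.le (v n s) (H.norm_eq n s)
    have h1 : L (twoMicrolocalWigner e (h n) (E n) (v n s) a - z) ≤
        ‖twoMicrolocalWigner e (h n) (E n) (v n s) a - z‖ :=
      (le_abs_self _).trans ((L.le_opNorm _).trans (mul_le_of_le_one_left (norm_nonneg _) hL1))
    rw [map_sub] at h1
    linarith [hL z hz]
  filter_upwards [key Complex.imCLM Complex.imCLM_norm.le fun z hz => by simp [hz.1],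
    key (-Complex.imCLM) (by rw [norm_neg]; exact Complex.imCLM_norm.le) fun z hz => by simp [hz.1],
    key (-Complex.reCLM) (by rw [norm_neg]; exact Complex.reCLM_norm.le) fun z hz => by simp [hz.2]]
    with t h1 h2 h3
  simp at h1 h2 h3
  exact ⟨le_antisymm h1 h2, h3⟩

end SemiclassicalLimit

/-! ### Absence of mass at low frequencies -/

lemma norm_sq_spectralProj (I : Set ℝ) (ħ : ℝ) (u : L2) :
    HasSum ({m : Fin 2 → ℤ | 2 * energy ħ m ∈ I}.indicator fun m => ‖mFourierCoeff u m‖ ^ 2)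
      (‖spectralProj I ħ u‖ ^ 2) := by
  let J := {k : Fin 2 → ℤ | 4 * Real.pi ^ 2 * ħ ^ 2 * ((k 0 : ℝ) ^ 2 + (k 1 : ℝ) ^ 2) ∈ I}
  have hJ : {m : Fin 2 → ℤ | 2 * energy ħ m ∈ I} = J := by
    ext m
    simp only [J, energy, mem_ofPred_eq]
    ring_nf
  let c : (Fin 2 → ℤ) → ℂ := J.indicator fun m => mFourierCoeff u m
  have hc2 : ∀ m, ‖c m‖ ^ 2 = J.indicator (fun m => ‖mFourierCoeff u m‖ ^ 2) m := fun m => by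
    by_cases hm : m ∈ J <;> simp [c, hm]
  have hs : Summable fun m => ‖c m‖ ^ 2 := by
    simp only [hc2]
    exact (hasSum_sq_coeff u).summable.indicator J
  have hmem : Memℓp c 2 := memℓp_gen (by simpa using hs)
  have h1 : HasSum (fun k => c k • expBasis k) (expBasis.repr.symm ⟨c, hmem⟩) :=
    expBasis.hasSum_repr_symm ⟨c, hmem⟩
  have h2 : spectralProj I ħ u = expBasis.repr.symm ⟨c, hmem⟩ := by
    rw [← h1.tsum_eq, spectralProj]
    refine tsum_congr fun k => ?_
    change J.indicator (fun k => mFourierCoeff u k • expL2 k) k = _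
    by_cases hk : k ∈ J
    · rw [indicator_of_mem hk]
      simp only [c, indicator_of_mem hk, coe_expBasis]
    · rw [indicator_of_notMem hk]
      simp only [c, indicator_of_notMem hk, zero_smul]
  have h3 : ∀ m, mFourierCoeff (spectralProj I ħ u) m = c m := fun m => by
    rw [← expBasis_repr, h2, LinearIsometryEquiv.apply_symm_apply]
  have h4 := hasSum_sq_coeff (spectralProj I ħ u)
  simp only [h3, hc2] at h4
  rwa [hJ]

lemma norm_spectralProj_le (I : Set ℝ) (ħ : ℝ) (u : L2) : ‖spectralProj I ħ u‖ ≤ ‖u‖ := by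
  rw [← pow_le_pow_iff_left₀ (norm_nonneg _) (norm_nonneg _) two_ne_zero]
  exact hasSum_le (fun m => indicator_le_self' (fun _ _ => by positivity) m)
    (norm_sq_spectralProj I ħ u) (hasSum_sq_coeff u)

lemma energy_nonneg (ħ : ℝ) (m : Fin 2 → ℤ) : 0 ≤ energy ħ m := by
  unfold energy; positivity

lemma div_sq_add_sq_le_one (M E : ℝ) : M ^ 2 / (M ^ 2 + E ^ 2) ≤ 1 :=
  div_le_one_of_le₀ (by nlinarith [sq_nonneg E]) (by positivity)

/-- Either `2 E ≤ δ`, and the weight is at most `1` on a mode seen by the spectral projection, or `2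
E > δ`, and the weight is at most `4M²/δ²`. The factor `2` is there because the energy is half of
`-ħ²Δ`. -/
lemma tsum_low_energy_le (ħ : ℝ) {u : L2} (hu : ‖u‖ = 1) {M δ : ℝ} (hδ : 0 < δ) :
    ∑' m, ‖mFourierCoeff u m‖ ^ 2 * (M ^ 2 / (M ^ 2 + energy ħ m ^ 2)) ≤
      ‖spectralProj (Icc 0 δ) ħ u‖ ^ 2 + 4 * M ^ 2 / δ ^ 2 := by
  have h1 := norm_sq_spectralProj (Icc 0 δ) ħ u
  have h2 := (hasSum_sq_coeff u).mul_right (4 * M ^ 2 / δ ^ 2)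
  rw [hu, one_pow, one_mul] at h2
  have hle : ∀ m, ‖mFourierCoeff u m‖ ^ 2 * (M ^ 2 / (M ^ 2 + energy ħ m ^ 2)) ≤
      ({m : Fin 2 → ℤ | 2 * energy ħ m ∈ Icc 0 δ}.indicator fun m => ‖mFourierCoeff u m‖ ^ 2) m +
        ‖mFourierCoeff u m‖ ^ 2 * (4 * M ^ 2 / δ ^ 2) := by
    intro m
    have hE := energy_nonneg ħ m
    by_cases hm : m ∈ {m : Fin 2 → ℤ | 2 * energy ħ m ∈ Icc 0 δ}
    · rw [indicator_of_mem hm]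
      have := mul_le_of_le_one_right (sq_nonneg ‖mFourierCoeff u m‖)
        (div_sq_add_sq_le_one M (energy ħ m))
      have h4 : 0 ≤ ‖mFourierCoeff u m‖ ^ 2 * (4 * M ^ 2 / δ ^ 2) := by positivity
      linarith
    · rw [indicator_of_notMem hm, zero_add]
      refine mul_le_mul_of_nonneg_left ?_ (sq_nonneg _)
      have hE2 : δ < 2 * energy ħ m := by
        by_contra hne
        exact hm ⟨by positivity, not_lt.1 hne⟩
      rw [div_le_div_iff₀ (by nlinarith [sq_nonneg M]) (by positivity)]
      nlinarith [sq_nonneg M, mul_nonneg (sq_nonneg M) (sq_nonneg M),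
        mul_nonneg (sq_nonneg M) (show 0 ≤ 4 * energy ħ m ^ 2 - δ ^ 2 by nlinarith)]
  have hs := (h1.add h2).summable
  refine (Summable.tsum_le_tsum hle (Summable.of_nonneg_of_le (fun m => by positivity) hle hs)
    hs).trans ?_
  rw [(h1.add h2).tsum_eq]

/-- A symbol independent of `x` has only its zeroth Fourier coefficient, so its matrix is diagonal
and the quantization is a Fourier multiplier. -/
lemma twoMicrolocalWigner_xi {φ : Plane → ℝ} (hφ : (fun p : Phase => (φ p.2.1 : ℂ)) ∈ testFunctions)
    (e : Fin 2 → ℤ) {ħ : ℝ} (hħ : 0 < ħ) (ε : ℝ) (u : L2) :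
    twoMicrolocalWigner e ħ ε u (fun p => (φ p.2.1 : ℂ)) =
      ((∑' m, φ ((2 * Real.pi * ħ) • latticeVec m) * ‖mFourierCoeff u m‖ ^ 2 : ℝ) : ℂ) := by
  have hk : symbolKernel ħ (rescaledSymbol e ε fun p => (φ p.2.1 : ℂ)) =
      idKernel fun m => (φ ((2 * Real.pi * ħ) • latticeVec m) : ℂ) := by
    ext m m'
    rw [symbolKernel_rescaledSymbol, phaseCoeff, mFourierCoeff_eq]
    dsimp only
    rw [integral_mul_const, integral_mFourier, idKernel]
    by_cases h : m = m'
    · subst h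
      have : (Real.pi * ħ) • latticeVec (m + m) = (2 * Real.pi * ħ) • latticeVec m := by
        rw [latticeVec_add]; module
      simp [this]
    · simp [sub_eq_zero, h]
  rw [twoMicrolocalWigner_eq hφ e hħ, hk, form_idKernel, Complex.ofReal_tsum]
  refine tsum_congr fun m => ?_
  rw [mul_assoc, Complex.mul_conj, Complex.normSq_eq_norm_sq, Complex.ofReal_mul]

lemma norm_sq_latticeVec (m : Fin 2 → ℤ) :
    ‖latticeVec m‖ ^ 2 = (m 0 : ℝ) ^ 2 + (m 1 : ℝ) ^ 2 := by
  rw [EuclideanSpace.norm_sq_eq, Fin.sum_univ_two]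
  simp [latticeVec]

lemma energy_eq (ħ : ℝ) (m : Fin 2 → ℤ) :
    energy ħ m = ‖(2 * Real.pi * ħ) • latticeVec m‖ ^ 2 / 2 := by
  rw [norm_smul, mul_pow, norm_sq_latticeVec, Real.norm_eq_abs, sq_abs, energy]
  ring

lemma tsum_le_low_energy {φ : Plane → ℝ} {M : ℝ} (hM : 0 < M) (h1 : ∀ ξ, φ ξ ≤ 1) (h0 : ∀ ξ, 0 ≤ φ ξ)
    (hφ : ∀ ξ, M < ‖ξ‖ ^ 2 / 2 → φ ξ = 0) (ħ : ℝ) (u : L2) :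
    ∑' m, φ ((2 * Real.pi * ħ) • latticeVec m) * ‖mFourierCoeff u m‖ ^ 2 ≤
      2 * ∑' m, ‖mFourierCoeff u m‖ ^ 2 * (M ^ 2 / (M ^ 2 + energy ħ m ^ 2)) := by
  have hs := (hasSum_sq_coeff u).summable
  rw [← tsum_mul_left]
  refine Summable.tsum_le_tsum (fun m => ?_) ?_ ?_
  · by_cases hm : M < energy ħ m
    · rw [hφ _ (by rwa [← energy_eq]), zero_mul]
      positivity
    · have hE := energy_nonneg ħ m
      have : 1 ≤ 2 * (M ^ 2 / (M ^ 2 + energy ħ m ^ 2)) := by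
        rw [← mul_div_assoc, one_le_div (by positivity)]
        nlinarith
      have hn := sq_nonneg ‖mFourierCoeff u m‖
      nlinarith [h1 ((2 * Real.pi * ħ) • latticeVec m)]
  · exact Summable.of_nonneg_of_le (fun m => mul_nonneg (h0 _) (sq_nonneg _))
      (fun m => mul_le_of_le_one_left (sq_nonneg _) (h1 _)) hs
  · refine Summable.mul_left _ (Summable.of_nonneg_of_le (fun m => by positivity)
      (fun m => ?_) hs)
    exact mul_le_of_le_one_right (sq_nonneg _) (div_sq_add_sq_le_one _ _)

namespace SemiclassicalLimit

variable {V : Torus → ℝ} {e : Fin 2 → ℤ} {h E T : ℕ → ℝ} {v : ℕ → ℝ → L2}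
  {μ : ℝ → testFunctions →ₗ[ℂ] ℂ}

/-- Strict oscillation of the data selects `δ`, and then `M` is taken small compared with `δ`. The
low-energy mass at any time is bounded by twice a sum of three contributions of size `κ/8`: the
spectral mass of the datum, the tail of the weight, and the perturbation by `ε²V`, which vanishes in
the limit. -/
lemma exists_low_frequency_bound (H : SemiclassicalLimit V e h E T v μ) {κ : ℝ} (hκ : 0 < κ) :
    ∃ M > 0, ∀ (φ : Plane → ℝ) (hφ : (fun p : Phase => (φ p.2.1 : ℂ)) ∈ testFunctions),
      (∀ ξ, 0 ≤ φ ξ) → (∀ ξ, φ ξ ≤ 1) → (∀ ξ, M < ‖ξ‖ ^ 2 / 2 → φ ξ = 0) →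
      ∀ᵐ t, (μ t ⟨fun p => (φ p.2.1 : ℂ), hφ⟩).re ≤ κ := by
  obtain ⟨B, hB0, hB⟩ := exists_norm_scaledPotential_le H.smooth
  have hsq : 0 < Real.sqrt (κ / 8) := Real.sqrt_pos.2 (by positivity)
  obtain ⟨δ, hδ, hδ0⟩ := ((H.strict.eventually (gt_mem_nhds hsq)).and self_mem_nhdsWithin).exists
  have hδ0 : 0 < δ := hδ0
  have hev : ∀ᶠ n in atTop, ‖spectralProj (Icc 0 δ) (h n) (v n 0)‖ < Real.sqrt (κ / 8) :=
    eventually_lt_of_limsup_lt hδ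
      (isBoundedUnder_of ⟨1, fun n => (norm_spectralProj_le _ _ _).trans (H.norm_zero n).le⟩)
  -- Chosen so that the tail `4 M² / δ²` equals `κ / 8`.
  let M := δ * Real.sqrt (κ / 8) / 2
  have hM : 0 < M := by positivity
  have hMδ : 4 * M ^ 2 / δ ^ 2 = κ / 8 := by
    have := Real.sq_sqrt (show 0 ≤ κ / 8 by positivity)
    simp only [M]
    field_simp
    linarith
  refine ⟨M, hM, fun φ hφ h0 h1 hs => ?_⟩
  refine H.ae_le_of_forall _ Complex.reCLM κ fun ρ hρ => ?_
  have ht : Tendsto (fun n => 2 * (E n ^ 2 * B) / M) atTop (𝓝 0) := by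
    simpa using (((H.E_lim.pow 2).mul_const B).const_mul 2).div_const M
  filter_upwards [hev, ht.eventually (gt_mem_nhds (show 0 < κ / 8 by positivity)), H.E_pos]
    with n hn hn2 hn3 s
  have hp : ‖spectralProj (Icc 0 δ) (h n) (v n 0)‖ ^ 2 ≤ κ / 8 := by
    rw [← Real.sq_sqrt (show 0 ≤ κ / 8 by positivity)]
    exact pow_le_pow_left₀ (norm_nonneg _) hn.le 2
  have hw := twoMicrolocalWigner_xi hφ e (H.h_pos n) (E n) (v n s)
  have hl := (H.isFlow n).low_energy_le (H.h_pos n) (isPotential_scaledPotential H.smooth (E n))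
    (H.norm_zero n) (B := E n ^ 2 * B) (by positivity) (hB _) hM s
  have ht1 := tsum_low_energy_le (h n) (H.norm_zero n) (M := M) hδ0
  have ht2 := tsum_le_low_energy hM h1 h0 hs (h n) (v n s)
  change (twoMicrolocalWigner e (h n) (E n) (v n s) fun p => (φ p.2.1 : ℂ)).re ≤ κ + ρ
  rw [hw, Complex.ofReal_re]
  rw [hMδ] at ht1
  linarith

/-! ### Localization on the resonant set -/

/-- If `|H_Λ(ξ)| ≥ δ`, the rescaled variable `H_Λ(ξ)/ε` exceeds `R` in modulus as soon as `εR < δ`.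
The symbol is then identically zero, and so are the distributions along the tail of the sequence. -/
lemma ae_eq_zero_of_vanishing (H : SemiclassicalLimit V e h E T v μ) (a : testFunctions)
    {δ R : ℝ} (hδ : 0 < δ) (ha : ∀ (x : Torus) (ξ : Plane) (η : ℝ),
      |hamiltonian e ξ| < δ ∨ R < |η| → (a : Phase → ℂ) (x, ξ, (η : EReal)) = 0) :
    ∀ᵐ t, μ t a = 0 := by
  refine H.ae_eq_zero_of_tendsto a fun s t _ => ?_
  have ht : Tendsto (fun n => E n * R) atTop (𝓝 0) := by simpa using H.E_lim.mul_const R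
  refine Tendsto.congr' ?_ tendsto_const_nhds
  filter_upwards [H.E_pos, ht.eventually (gt_mem_nhds hδ)] with n hn hn2
  have h0 : (fun (x : Torus) (ξ : Plane) =>
      (a : Phase → ℂ) (x, ξ, ((hamiltonian e ξ / E n : ℝ) : EReal))) = fun _ _ => 0 := by
    ext x ξ
    refine ha x ξ _ ?_
    by_cases hξ : |hamiltonian e ξ| < δ
    · exact Or.inl hξ
    · right
      rw [abs_div, abs_of_pos hn, lt_div_iff₀ hn]
      linarith [not_lt.1 hξ]
  have hz : ∀ x : ℝ, twoMicrolocalWigner e (h n) (E n) (v n (x * T n)) a = 0 := fun x => by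
    rw [twoMicrolocalWigner, h0]
    simp [wigner, weyl]
  simp [hz]

end SemiclassicalLimit

/-! ### Separability of the space of test functions -/

instance finiteDimensional_continuousMultilinearMap (j : ℕ) :
    FiniteDimensional ℝ (ContinuousMultilinearMap ℝ (fun _ : Fin j => Plane) ℂ) :=
  Module.Finite.of_injective
    (ContinuousMultilinearMap.toMultilinearMapLinear :
      ContinuousMultilinearMap ℝ (fun _ : Fin j => Plane) ℂ →ₗ[ℝ] _)
    ContinuousMultilinearMap.toMultilinearMap_injective

lemma exists_countable_dense_image {α K X : Type*} [TopologicalSpace K] [CompactSpace K]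
    [T2Space K] [SecondCountableTopology K] [NormedAddCommGroup X] [SecondCountableTopology X]
    (S : Set α) (J : α → C(K, X)) :
    ∃ D ⊆ S, D.Countable ∧ ∀ a ∈ S, ∀ δ > 0, ∃ d ∈ D, ∀ p, ‖J a p - J d p‖ < δ := by
  obtain ⟨t, htS, htc, ht⟩ :=
    (TopologicalSpace.IsSeparable.of_separableSpace (J '' S)).exists_countable_dense_subset
  choose g hgS hg using (show ∀ b : t, ∃ a ∈ S, J a = b from fun b => htS b.2)
  have := htc.to_subtype
  refine ⟨range g, range_subset_iff.2 hgS, countable_range g, fun a ha δ hδ => ?_⟩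
  obtain ⟨b, hb, hab⟩ := Metric.mem_closure_iff.1 (ht (mem_image_of_mem J ha)) δ hδ
  refine ⟨g ⟨b, hb⟩, mem_range_self _, fun p => ?_⟩
  rw [hg, ← dist_eq_norm]
  exact (ContinuousMap.dist_apply_le_dist p).trans_lt hab

/-- The derivatives in `x`, of order at most three. -/
def jet (a : Phase → ℂ) (p : Plane × Plane × EReal) (j : Fin 4) :
    ContinuousMultilinearMap ℝ (fun _ : Fin (j : ℕ) => Plane) ℂ :=
  iteratedFDeriv ℝ j (fun y => a (toTorus y, p.2.1, p.2.2)) p.1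

lemma SmoothOnPhase.continuous_jet {a : Phase → ℂ} (ha : SmoothOnPhase a) : Continuous (jet a) := by
  refine continuous_pi fun j => ?_
  obtain ⟨P, hP, hPa⟩ := ha.exists_slice_jet j
  exact hP.congr fun p => (hPa p.1 p.2.1 p.2.2).symm

lemma jet_sub_latticeVec (a : Phase → ℂ) (x : Plane) (q : Plane × EReal) (k : Fin 2 → ℤ)
    (j : Fin 4) : jet a (x - latticeVec k, q) j = jet a (x, q) j := by
  have h := iteratedFDeriv_comp_add_right (𝕜 := ℝ) (f := fun y => a (toTorus y, q.1, q.2)) j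
    (latticeVec k) (x - latticeVec k)
  simp only [toTorus_add, toTorus_latticeVec, add_zero, sub_add_cancel] at h
  exact h

lemma bNormLE_sub_of_jet {a b : Phase → ℂ} (ha : SmoothOnPhase a) (hb : SmoothOnPhase b)
    {δ R : ℝ} (hδ : 0 ≤ δ) (haR : ∀ p : Phase, R < ‖p.2.1‖ → a p = 0)
    (hbR : ∀ p : Phase, R < ‖p.2.1‖ → b p = 0)
    (h : ∀ p : Plane × Plane × EReal, ‖p.1‖ ≤ 2 → ‖p.2.1‖ ≤ R →
      ∀ j, ‖jet a p j - jet b p j‖ ≤ δ)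
    (hab : SmoothOnPhase fun p => a p - b p) :
    BNormLE (fun p => a p - b p) δ := by
  refine bNormLE_of_real hab fun j hj x ξ η => ?_
  have hj : j < 4 := by omega
  by_cases hξ : R < ‖ξ‖
  · have : (fun y : Plane => a (toTorus y, ξ, (η : EReal)) - b (toTorus y, ξ, (η : EReal))) =
        fun _ => 0 := by
      funext y
      rw [haR (toTorus y, ξ, (η : EReal)) hξ, hbR (toTorus y, ξ, (η : EReal)) hξ, sub_zero]
    rw [this]
    simpa using hδ
  · obtain ⟨k, hk⟩ := exists_lattice_near x
    have h1 := h (x - latticeVec k, ξ, (η : EReal)) hk (not_lt.1 hξ) (⟨j, hj⟩ : Fin 4)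
    rw [jet_sub_latticeVec, jet_sub_latticeVec] at h1
    have h2 : iteratedFDeriv ℝ j
        (fun y : Plane => a (toTorus y, ξ, (η : EReal)) - b (toTorus y, ξ, (η : EReal))) x =
        iteratedFDeriv ℝ j (fun y : Plane => a (toTorus y, ξ, (η : EReal))) x -
          iteratedFDeriv ℝ j (fun y : Plane => b (toTorus y, ξ, (η : EReal))) x :=
      iteratedFDeriv_sub_apply
        ((ha.contDiff_slice ξ η).of_le (by exact_mod_cast le_top)).contDiffAt
        ((hb.contDiff_slice ξ η).of_le (by exact_mod_cast le_top)).contDiffAt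
    rw [h2]
    exact h1

/-- With the support in `ξ` bounded by `R`, and `x` reduced to a ball containing a fundamental
domain, the jets of order at most three embed the functions in `C(K, X)` with `K` compact metrizable
and `X` finite-dimensional. That space is separable, and so is each of its subsets; the approximants
can therefore be taken in `S`. -/
lemma exists_countable_dense_of_bounded (S : Set testFunctions) (R : ℝ)
    (hS : ∀ a ∈ S, ∀ p : Phase, R < ‖p.2.1‖ → (a : Phase → ℂ) p = 0) :
    ∃ D ⊆ S, D.Countable ∧ ∀ a ∈ S, ∀ δ > 0, ∃ d ∈ D,
      BNormLE ((a - d : testFunctions) : Phase → ℂ) δ := by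
  let K : Set (Plane × Plane × EReal) :=
    Metric.closedBall 0 2 ×ˢ (Metric.closedBall 0 R ×ˢ (univ : Set EReal))
  have hK : IsCompact K := (isCompact_closedBall _ _).prod ((isCompact_closedBall _ _).prod isCompact_univ)
  have : CompactSpace K := isCompact_iff_compactSpace.1 hK
  let J : testFunctions →
      C(K, (j : Fin 4) → ContinuousMultilinearMap ℝ (fun _ : Fin (j : ℕ) => Plane) ℂ) :=
    fun a => ⟨fun p => jet a p, a.2.1.continuous_jet.comp continuous_subtype_val⟩
  obtain ⟨D, hDS, hDc, hD⟩ := exists_countable_dense_image S J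
  refine ⟨D, hDS, hDc, fun a ha δ hδ => ?_⟩
  obtain ⟨d, hd, had⟩ := hD a ha δ hδ
  refine ⟨d, hd, bNormLE_sub_of_jet (R := R) a.2.1 d.2.1 hδ.le (hS a ha) (hS _ (hDS hd))
    (fun p h1 h2 j => ?_) (a - d).2.1⟩
  have hp : p ∈ K := by simp [K, h1, h2]
  exact (norm_le_pi_norm (J a ⟨p, hp⟩ - J d ⟨p, hp⟩) j).trans (had ⟨p, hp⟩).le

lemma exists_countable_dense (S : Set testFunctions) :
    ∃ D ⊆ S, D.Countable ∧ ∀ a ∈ S, ∀ δ > 0, ∃ d ∈ D,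
      BNormLE ((a - d : testFunctions) : Phase → ℂ) δ := by
  choose D hDS hDc hD using fun N : ℕ => exists_countable_dense_of_bounded
    {a ∈ S | ∀ p : Phase, (N : ℝ) < ‖p.2.1‖ → (a : Phase → ℂ) p = 0} N (fun a ha => ha.2)
  refine ⟨⋃ N, D N, iUnion_subset fun N a ha => (hDS N ha).1, countable_iUnion hDc,
    fun a ha δ hδ => ?_⟩
  obtain ⟨R, hR⟩ := exists_xi_bound a.2.2
  obtain ⟨N, hN⟩ := exists_nat_ge R
  obtain ⟨d, hd, h⟩ := hD N a ⟨ha, fun p hp => hR p (hN.trans_lt hp)⟩ δ hδ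
  exact ⟨d, mem_iUnion.2 ⟨N, hd⟩, h⟩

/-- The condition is imposed on a countable dense subset of `S`, outside one null set of times. The
essential bound makes `μ t` continuous for the norm of `𝓑`, and closedness of `F` passes the
condition to all of `S`. -/
lemma IsDualFamily.ae_forall_mem {μ : ℝ → testFunctions →ₗ[ℂ] ℂ} (hμ : IsDualFamily μ)
    {S : Set testFunctions} {F : Set ℂ} (hF : IsClosed F) (h : ∀ a ∈ S, ∀ᵐ t, μ t a ∈ F) :
    ∀ᵐ t, ∀ a ∈ S, μ t a ∈ F := by
  obtain ⟨D, hDS, hDc, hD⟩ := exists_countable_dense S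
  obtain ⟨C, hC⟩ := hμ.bounded
  filter_upwards [(ae_ball_iff hDc).2 fun a ha => h a (hDS ha), hC] with t h1 h2 a ha
  rw [← hF.closure_eq]
  refine Metric.mem_closure_iff.2 fun r hr => ?_
  obtain ⟨d, hd, had⟩ := hD a ha (r / (|C| + 1)) (by positivity)
  refine ⟨μ t d, h1 d hd, ?_⟩
  rw [dist_eq_norm, ← map_sub]
  refine (h2 _ _ had).trans_lt ?_
  rw [← mul_div_assoc, div_lt_iff₀ (by positivity), mul_comm]
  exact mul_lt_mul_of_pos_left (by linarith [le_abs_self C]) hr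

/-! ### Representation of positive functionals by measures -/

/-- A smooth function on the plane that is one on the ball of radius `N + 1`. -/
def cutoff (N : ℕ) : ContDiffBump (0 : Plane) := ⟨N + 1, N + 2, by positivity, by linarith⟩

lemma cutoff_eq_one {N : ℕ} {ξ : Plane} (hξ : ‖ξ‖ ≤ N) : cutoff N ξ = 1 :=
  (cutoff N).one_of_mem_closedBall (by
    rw [mem_closedBall_zero_iff]
    exact hξ.trans (le_add_of_nonneg_right zero_le_one))

lemma mem_testFunctions_of_eq {a b : Phase → ℂ} (ha : a ∈ testFunctions) (h : ∀ p, b p = a p) :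
    b ∈ testFunctions := (funext h : b = a) ▸ ha

lemma bump_mem {c : Plane} (χ : ContDiffBump c) :
    (fun p : Phase => ((χ p.2.1 : ℝ) : ℂ)) ∈ testFunctions :=
  xi_mem (φ := fun ξ => ((χ ξ : ℝ) : ℂ)) (Complex.ofRealCLM.contDiff.comp χ.contDiff)
    (χ.hasCompactSupport.comp_left Complex.ofReal_zero)

/-- The norm of `𝓑` only differentiates in `x`, so cutoffs in `ξ` have norm at most one however
steep they are. This is what makes the limit measure finite. -/
lemma bNormLE_bump {c : Plane} (χ : ContDiffBump c) :
    BNormLE (fun p : Phase => ((χ p.2.1 : ℝ) : ℂ)) 1 := by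
  intro j _ x ξ η
  rcases j with _ | j
  · rw [norm_iteratedFDeriv_zero, Complex.norm_real, Real.norm_of_nonneg χ.nonneg]
    exact χ.le_one
  · dsimp only
    rw [iteratedFDeriv_const_of_ne (Nat.succ_ne_zero j)]
    simp

/-- The real test functions. -/
def realTestFunctions : Submodule ℝ (CompactlySupportedContinuousMap Phase ℝ) where
  carrier := {f | (fun p => (f p : ℂ)) ∈ testFunctions}
  zero_mem' := mem_testFunctions_of_eq testFunctions.zero_mem fun p => by simp
  add_mem' hf hg := mem_testFunctions_of_eq (testFunctions.add_mem hf hg) fun p => by simp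
  smul_mem' c _ hf := mem_testFunctions_of_eq (testFunctions.smul_mem (c : ℂ) hf) fun p => by simp

section Representation

variable {ν : testFunctions →ₗ[ℂ] ℂ}

/-- The restriction of a functional to real test functions. -/
def realFunctional (ν : testFunctions →ₗ[ℂ] ℂ) : realTestFunctions →ₗ[ℝ] ℝ where
  toFun f := (ν ⟨fun p => ((f : CompactlySupportedContinuousMap Phase ℝ) p : ℂ), f.2⟩).re
  map_add' f g := by
    rw [← Complex.add_re, ← map_add]
    congr 2
    ext p; simp
  map_smul' c f := by
    rw [RingHom.id_apply, smul_eq_mul, ← Complex.re_ofReal_mul, ← smul_eq_mul, ← map_smul]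
    congr 2
    ext p; simp

lemma exists_cutoff_dominating (f : CompactlySupportedContinuousMap Phase ℝ) :
    ∃ N : ℕ, ∀ p, |f p| ≤ N * cutoff N p.2.1 := by
  have hc : Continuous fun p : Phase => ‖p.2.1‖ := by fun_prop
  obtain ⟨R, hR⟩ := f.hasCompactSupport.isCompact.bddAbove_image hc.continuousOn
  obtain ⟨C, hC⟩ := f.hasCompactSupport.exists_bound_of_continuous f.continuous
  obtain ⟨N, hN⟩ := exists_nat_ge (max R C)
  refine ⟨N, fun p => ?_⟩
  by_cases hp : f p = 0
  · rw [hp, abs_zero]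
    exact mul_nonneg (Nat.cast_nonneg _) (cutoff N).nonneg
  · have h1 : ‖p.2.1‖ ≤ R := hR ⟨p, subset_tsupport f hp, rfl⟩
    rw [cutoff_eq_one (h1.trans ((le_max_left _ _).trans hN)), mul_one]
    exact (hC p).trans ((le_max_right _ _).trans hN)

/-- The functions `N χ_N(ξ)`, as real test functions. -/
def scaledCutoff (N : ℕ) : realTestFunctions :=
  ⟨⟨⟨fun p : Phase => N * cutoff N p.2.1, continuous_const.mul
      ((cutoff N).continuous.comp (continuous_fst.comp continuous_snd))⟩, by
      have := (testFunctions.smul_mem (N : ℂ) (bump_mem (cutoff N))).2.comp_left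
        (g := Complex.re) Complex.zero_re
      convert! this using 1
      ext p
      change (N : ℝ) * cutoff N p.2.1 = _
      simp⟩, by
    refine mem_testFunctions_of_eq (testFunctions.smul_mem (N : ℂ) (bump_mem (cutoff N)))
      fun p => ?_
    change (((N : ℝ) * cutoff N p.2.1 : ℝ) : ℂ) = _
    simp⟩

/-- Positivity is known on test functions only, not on all of `C_c`. The M. Riesz extension theorem
applies because the functions `N χ_N(ξ)` are test functions that dominate every compactly supported
continuous function; the extended positive functional is then represented by a regular measure. -/
lemma exists_measure_of_nonneg
    (hpos : ∀ a : testFunctions, (∀ p, ((a : Phase → ℂ) p).im = 0 ∧ 0 ≤ ((a : Phase → ℂ) p).re) →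
      (ν a).im = 0 ∧ 0 ≤ (ν a).re) :
    ∃ m : Measure Phase, m.Regular ∧ ∀ f : realTestFunctions,
      ν ⟨fun p => ((f : CompactlySupportedContinuousMap Phase ℝ) p : ℂ), f.2⟩ =
        ((∫ p, (f : CompactlySupportedContinuousMap Phase ℝ) p ∂m : ℝ) : ℂ) := by
  have hpos' : ∀ f : realTestFunctions,
      (∀ p, 0 ≤ (f : CompactlySupportedContinuousMap Phase ℝ) p) →
      (ν ⟨fun p => ((f : CompactlySupportedContinuousMap Phase ℝ) p : ℂ), f.2⟩).im = 0 ∧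
        0 ≤ realFunctional ν f := fun f hf =>
    hpos _ fun p => ⟨Complex.ofReal_im _, by simpa using hf p⟩
  let s : PointedCone ℝ (CompactlySupportedContinuousMap Phase ℝ) :=
    { carrier := {f | ∀ p, 0 ≤ f p}
      zero_mem' := fun p => by simp
      add_mem' := fun {f g} hf hg p => by
        simpa using add_nonneg (hf p) (hg p)
      smul_mem' := fun c f hf p => mul_nonneg c.2 (hf p) }
  have dom : ∀ f : CompactlySupportedContinuousMap Phase ℝ, ∃ N, ∀ p,
      0 ≤ ((scaledCutoff N : CompactlySupportedContinuousMap Phase ℝ) + f) p ∧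
      0 ≤ ((scaledCutoff N : CompactlySupportedContinuousMap Phase ℝ) - f) p := by
    intro f
    obtain ⟨N, hN⟩ := exists_cutoff_dominating f
    refine ⟨N, fun p => ?_⟩
    have h := abs_le.1 (hN p)
    constructor
    · change 0 ≤ N * cutoff N p.2.1 + f p
      linarith
    · change 0 ≤ N * cutoff N p.2.1 - f p
      linarith
  obtain ⟨g, hg, hg0⟩ := riesz_extension s ⟨realTestFunctions, realFunctional ν⟩
    (fun f hf => (hpos' f hf).2) (fun f => by
      obtain ⟨N, hN⟩ := dom f
      exact ⟨scaledCutoff N, fun p => (hN p).1⟩)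
  let Λ : CompactlySupportedContinuousMap Phase ℝ →ₚ[ℝ] ℝ := PositiveLinearMap.mk₀ g fun f hf => hg0 f hf
  refine ⟨RealRMK.rieszMeasure Λ, inferInstance, fun f => ?_⟩
  rw [RealRMK.integral_rieszMeasure]
  refine Complex.ext ?_ ?_
  · rw [Complex.ofReal_re]
    exact (hg f).symm
  · rw [Complex.ofReal_im]
    obtain ⟨N, hN⟩ := dom f
    have h1 := (hpos' (scaledCutoff N) fun p => by
      exact mul_nonneg (Nat.cast_nonneg N) (cutoff N).nonneg).1
    have h2 := (hpos' (scaledCutoff N - f) fun p => (hN p).2).1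
    -- A real test function is a difference of two nonnegative ones, which shows that the functional
    -- is real on it.
    have e : (⟨fun p => ((f : CompactlySupportedContinuousMap Phase ℝ) p : ℂ), f.2⟩ :
        testFunctions) = ⟨fun p => ((scaledCutoff N : CompactlySupportedContinuousMap Phase ℝ) p : ℂ),
          (scaledCutoff N).2⟩ - ⟨fun p => (((scaledCutoff N - f : realTestFunctions) :
          CompactlySupportedContinuousMap Phase ℝ) p : ℂ), (scaledCutoff N - f).2⟩ := by
      ext p; simp
    rw [e, map_sub, Complex.sub_im, h1, h2, sub_zero]

/-- The masses of the sets `{‖ξ‖ ≤ N}` are bounded by the same `C`, by testing on cutoffs of norm at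
most one, so the total mass is finite by monotone convergence. Complex test functions are split into
real and imaginary parts. -/
lemma exists_measure_of_nonneg_of_bounded
    (hpos : ∀ a : testFunctions, (∀ p, ((a : Phase → ℂ) p).im = 0 ∧ 0 ≤ ((a : Phase → ℂ) p).re) →
      (ν a).im = 0 ∧ 0 ≤ (ν a).re)
    {C : ℝ} (hC : ∀ (a : testFunctions) (M : ℝ), BNormLE (a : Phase → ℂ) M → ‖ν a‖ ≤ C * M) :
    ∃ m : Measure Phase, IsFiniteMeasure m ∧ m.Regular ∧
      ∀ a : testFunctions, ν a = ∫ p, (a : Phase → ℂ) p ∂m := by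
  obtain ⟨m, hm, hν⟩ := exists_measure_of_nonneg hpos
  have hreal : ∀ f : Phase → ℝ, ∀ hf : (fun p => (f p : ℂ)) ∈ testFunctions,
      ν ⟨fun p => (f p : ℂ), hf⟩ = ((∫ p, f p ∂m : ℝ) : ℂ) := by
    intro f hf
    have h1 : Continuous f := (Complex.continuous_re.comp hf.1.continuous).congr fun p => by simp
    have h2 : HasCompactSupport f := by
      have := hf.2.comp_left (g := Complex.re) Complex.zero_re
      convert! this using 1
    exact hν ⟨⟨⟨f, h1⟩, h2⟩, hf⟩
  refine ⟨m, ⟨?_⟩, hm, fun a => ?_⟩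
  · have hball : ∀ N : ℕ, m {p | ‖p.2.1‖ ≤ N} ≤ ENNReal.ofReal C := by
      intro N
      have h1 := hreal (fun p => cutoff N p.2.1) (bump_mem _)
      have h2 := hC ⟨_, bump_mem (cutoff N)⟩ 1 (bNormLE_bump (cutoff N))
      have h3 : ∫ p, cutoff N p.2.1 ∂m ≤ C := by
        have := h1 ▸ h2
        rw [mul_one, Complex.norm_real] at this
        exact (le_abs_self _).trans this
      have hcont : Continuous fun p : Phase => cutoff N p.2.1 :=
        (cutoff N).continuous.comp (continuous_fst.comp continuous_snd)
      have hi : Integrable (fun p : Phase => cutoff N p.2.1) m := by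
        have := (bump_mem (cutoff N)).1.continuous.integrable_of_hasCompactSupport
          (bump_mem (cutoff N)).2 (μ := m)
        exact this.re
      have hms : MeasurableSet {p : Phase | ‖p.2.1‖ ≤ N} :=
        (isClosed_le (by fun_prop) continuous_const).measurableSet
      calc m {p | ‖p.2.1‖ ≤ N} = ∫⁻ p, {p : Phase | ‖p.2.1‖ ≤ N}.indicator 1 p ∂m :=
            (lintegral_indicator_one hms).symm
        _ ≤ ∫⁻ p, ENNReal.ofReal (cutoff N p.2.1) ∂m := by
            refine lintegral_mono fun p => ?_
            by_cases hp : p ∈ {p : Phase | ‖p.2.1‖ ≤ N}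
            · rw [indicator_of_mem hp, cutoff_eq_one hp]; simp
            · rw [indicator_of_notMem hp]; exact zero_le
        _ = ENNReal.ofReal (∫ p, cutoff N p.2.1 ∂m) :=
            (ofReal_integral_eq_lintegral_ofReal hi
              (Eventually.of_forall fun p => (cutoff N).nonneg)).symm
        _ ≤ _ := ENNReal.ofReal_le_ofReal h3
    have hU : (univ : Set Phase) = ⋃ N : ℕ, {p : Phase | ‖p.2.1‖ ≤ N} := by
      refine (eq_univ_of_forall fun p => ?_).symm
      obtain ⟨N, hN⟩ := exists_nat_ge ‖p.2.1‖
      exact mem_iUnion.2 ⟨N, hN⟩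
    have hmono : Monotone fun N : ℕ => {p : Phase | ‖p.2.1‖ ≤ N} := fun N N' h p hp =>
      (show ‖p.2.1‖ ≤ N from hp).trans (Nat.cast_le.2 h)
    rw [hU, hmono.measure_iUnion]
    exact (iSup_le hball).trans_lt ENNReal.ofReal_lt_top
  · have hi : Integrable (a : Phase → ℂ) m :=
      a.2.1.continuous.integrable_of_hasCompactSupport a.2.2
    have hre : (fun p => ((((a : Phase → ℂ) p).re : ℝ) : ℂ)) ∈ testFunctions :=
      clm_comp_mem a.2 (Complex.ofRealCLM.comp Complex.reCLM)
    have him : (fun p => ((((a : Phase → ℂ) p).im : ℝ) : ℂ)) ∈ testFunctions :=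
      clm_comp_mem a.2 (Complex.ofRealCLM.comp Complex.imCLM)
    have e : a = (⟨_, hre⟩ : testFunctions) + Complex.I • (⟨_, him⟩ : testFunctions) := by
      ext p
      simp [mul_comm Complex.I]
    have h1 := hreal _ hre
    have h2 := hreal _ him
    conv_lhs => rw [e]
    rw [map_add, map_smul, h1, h2, smul_eq_mul]
    refine Complex.ext ?_ ?_
    · have : (∫ p, (a : Phase → ℂ) p ∂m).re = ∫ p, ((a : Phase → ℂ) p).re ∂m :=
        (Complex.reCLM.integral_comp_comm hi).symm
      simp [this]
    · have : (∫ p, (a : Phase → ℂ) p ∂m).im = ∫ p, ((a : Phase → ℂ) p).im ∂m :=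
        (Complex.imCLM.integral_comp_comm hi).symm
      simp [this]

end Representation

/-! ### Properties of the limit measures -/

lemma geodesicDeriv_mul_eta (a : Phase → ℂ) (k : EReal → ℂ) (p : Phase) :
    geodesicDeriv (fun p => a p * k p.2.2) p = geodesicDeriv a p * k p.2.2 := by
  unfold geodesicDeriv
  dsimp only
  by_cases hk : k p.2.2 = 0
  · simp [hk]
  · let _ := invertibleOfNonzero hk
    have h := fderiv_const_smul_of_invertible (𝕜 := ℝ)
      (f := fun y : Plane => a (p.1 + toTorus y, p.2.1, p.2.2)) (x := 0) (k p.2.2)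
    have e : (fun y : Plane => a (p.1 + toTorus y, p.2.1, p.2.2) * k p.2.2) =
        k p.2.2 • fun y : Plane => a (p.1 + toTorus y, p.2.1, p.2.2) := by
      funext y
      exact mul_comm _ _
    rw [e, h, _root_.smul_apply, smul_eq_mul, mul_comm]

lemma exists_eta_cutoff (N : ℕ) : ∃ k : EReal → ℝ, (∀ η : ℝ, |η| ≤ N → k η = 1) ∧ k ⊤ = 0 ∧ k ⊥ = 0 ∧
    (∀ η, 0 ≤ k η) ∧ (∀ η, k η ≤ 1) ∧ (∀ η : ℝ, N + 2 < |η| → k η = 0) ∧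
    SmoothOnPhase fun p : Phase => (k p.2.2 : ℂ) := by
  -- The inner radius is `N + 1` rather than `N` because it has to be positive also when `N = 0`.
  let ψ : ContDiffBump (0 : ℝ) := ⟨N + 1, N + 2, by positivity, by linarith⟩
  obtain ⟨k, hk, h1, h2, hs⟩ := exists_smoothOnPhase_eta (ψ := fun η => ((ψ η : ℝ) : ℂ))
    (Complex.ofRealCLM.contDiff.comp ψ.contDiff)
    (ψ.hasCompactSupport.comp_left Complex.ofReal_zero)
  have hre : ∀ η : ℝ, (k η).re = ψ η := fun η => by rw [hk, Complex.ofReal_re]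
  have hk' : ∀ η, (((k η).re : ℝ) : ℂ) = k η := by
    intro η
    induction η with
    | coe η => rw [hk, Complex.ofReal_re]
    | top => simp [h1]
    | bot => simp [h2]
  refine ⟨fun η => (k η).re, fun η hη => ?_, by simp [h1], by simp [h2], fun η => ?_, fun η => ?_,
    fun η hη => ?_, ?_⟩
  · beta_reduce
    rw [hre]
    refine ψ.one_of_mem_closedBall ?_
    rw [mem_closedBall_zero_iff]
    exact hη.trans (le_add_of_nonneg_right zero_le_one)
  · induction η with
    | coe η => exact (hre η).ge.trans' ψ.nonneg
    | top => simp [h1]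
    | bot => simp [h2]
  · induction η with
    | coe η => exact (hre η).le.trans ψ.le_one
    | top => simp [h1]
    | bot => simp [h2]
  · beta_reduce
    rw [hre]
    refine ψ.zero_of_le_dist ?_
    rw [dist_zero_right]
    exact hη.le
  · simpa only [hk'] using hs

lemma mem_latticePerp_of_hamiltonian {Λ : AddSubgroup (Fin 2 → ℤ)} {e : Fin 2 → ℤ}
    (he : AddSubgroup.zmultiples e = Λ) {ξ : Plane} (hξ : hamiltonian e ξ = 0) :
    ξ ∈ latticePerp Λ := by
  have h0 : inner ℝ ξ (latticeVec e) = 0 := by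
    rcases div_eq_zero_iff.1 hξ with h | h
    · exact h
    · rw [norm_eq_zero.1 h, inner_zero_right]
  intro k hk
  rw [← he] at hk
  obtain ⟨n, rfl⟩ := AddSubgroup.mem_zmultiples_iff.1 hk
  have : latticeVec (n • e) = (n : ℝ) • latticeVec e := by
    ext i; simp [latticeVec]
  rw [this, inner_smul_right, h0, mul_zero]

lemma isClosed_latticePerp (Λ : AddSubgroup (Fin 2 → ℤ)) : IsClosed (latticePerp Λ) := by
  have : latticePerp Λ = ⋂ k ∈ Λ, {ξ | inner ℝ ξ (latticeVec k) = 0} := by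
    ext ξ; simp [latticePerp]
  rw [this]
  exact isClosed_biInter fun k _ => isClosed_eq (by fun_prop) continuous_const

lemma measurableSet_finite_eta : MeasurableSet {p : Phase | p.2.2 ≠ ⊥ ∧ p.2.2 ≠ ⊤} := by
  have hc : Continuous fun p : Phase => p.2.2 := by fun_prop
  exact ((isClosed_singleton.preimage hc).measurableSet.compl).inter
    (isClosed_singleton.preimage hc).measurableSet.compl

lemma finitePart_add_infinitePart (m : Measure Phase) : m = finitePart m + infinitePart m := by
  have : {p : Phase | p.2.2 = ⊥ ∨ p.2.2 = ⊤} = {p : Phase | p.2.2 ≠ ⊥ ∧ p.2.2 ≠ ⊤}ᶜ := by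
    ext p
    simp only [mem_compl_iff, mem_ofPred_eq]
    tauto
  rw [infinitePart, this, finitePart, Measure.restrict_add_restrict_compl measurableSet_finite_eta]

/-- The test functions supported away from `{H = 0}` and from `{η = ±∞}`. -/
def nonresonantFunctions (e : Fin 2 → ℤ) : Set testFunctions :=
  {a | ∃ δ > 0, ∃ R : ℝ, ∀ (x : Torus) (ξ : Plane) (η : ℝ),
    |hamiltonian e ξ| < δ ∨ R < |η| → (a : Phase → ℂ) (x, ξ, (η : EReal)) = 0}

/-- Product of cutoffs in `ξ`, in `η`, and away from `H_Λ = 0`. As `N` grows, the sets where these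
functions are nonzero exhaust all the points with finite `η` and `H_Λ(ξ) ≠ 0`. -/
lemma exists_nonresonant (e : Fin 2 → ℤ) (N : ℕ) : ∃ b : Phase → ℝ, ∃ hb : (fun p => (b p : ℂ)) ∈
    testFunctions, ⟨_, hb⟩ ∈ nonresonantFunctions e ∧ (∀ p, 0 ≤ b p) ∧
    ∀ (x : Torus) (ξ : Plane) (η : ℝ), ‖ξ‖ ≤ N → |η| ≤ N → 1 / ((N : ℝ) + 1) ≤ |hamiltonian e ξ| →
      b (x, ξ, (η : EReal)) ≠ 0 := by
  obtain ⟨k, hk1, -, -, hk0, -, hkR, hks⟩ := exists_eta_cutoff N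
  have hN : (0 : ℝ) < N + 1 := by positivity
  let ρ : ContDiffBump (0 : ℝ) := ⟨1 / ((N : ℝ) + 2), 1 / ((N : ℝ) + 1), by positivity,
    one_div_lt_one_div_of_lt hN (by linarith)⟩
  let g : Plane → ℝ := fun ξ => 1 - ρ (hamiltonian e ξ)
  have hg : ContDiff ℝ ∞ fun ξ => (g ξ : ℂ) := Complex.ofRealCLM.contDiff.comp
    (contDiff_const.sub (ρ.contDiff.comp (contDiff_hamiltonian e)))
  have hmem := mul_mem (mul_mem (bump_mem (cutoff N)) (smoothOnPhase_xi hg)) hks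
  have hb : (fun p : Phase => ((cutoff N p.2.1 * g p.2.1 * k p.2.2 : ℝ) : ℂ)) ∈ testFunctions :=
    mem_testFunctions_of_eq hmem fun p => by push_cast; rfl
  refine ⟨fun p => cutoff N p.2.1 * g p.2.1 * k p.2.2, hb, ⟨1 / ((N : ℝ) + 2), by positivity, N + 2,
    fun x ξ η h => ?_⟩, fun p => ?_, fun x ξ η h1 h2 h3 => ?_⟩
  · change ((cutoff N ξ * g ξ * k η : ℝ) : ℂ) = 0
    rw [Complex.ofReal_eq_zero]
    rcases h with h | h
    · have : g ξ = 0 := by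
        have h4 : ρ (hamiltonian e ξ) = 1 :=
          ρ.one_of_mem_closedBall (by rw [mem_closedBall_zero_iff]; exact h.le)
        simp only [g, h4, sub_self]
      rw [this, mul_zero, zero_mul]
    · rw [hkR η h, mul_zero]
  · exact mul_nonneg (mul_nonneg (cutoff N).nonneg (sub_nonneg.2 ρ.le_one)) (hk0 _)
  · have h4 : ρ (hamiltonian e ξ) = 0 := ρ.zero_of_le_dist (by rw [dist_zero_right]; exact h3)
    change cutoff N ξ * g ξ * k η ≠ 0
    simp [cutoff_eq_one h1, hk1 η h2, g, h4]

section Measure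

variable {m : Measure Phase} [IsFiniteMeasure m]

/-- A nonnegative function with zero integral vanishes almost everywhere, so the set in question is
covered by countably many null sets. -/
lemma measure_finite_nonresonant {e : Fin 2 → ℤ}
    (h : ∀ a ∈ nonresonantFunctions e, ∫ p, (a : Phase → ℂ) p ∂m = 0) :
    m {p | (p.2.2 ≠ ⊥ ∧ p.2.2 ≠ ⊤) ∧ hamiltonian e p.2.1 ≠ 0} = 0 := by
  choose b hb hbn hb0 hb1 using exists_nonresonant e
  have hnull : ∀ N, m {p | b N p ≠ 0} = 0 := by
    intro N
    have h1 := h _ (hbn N)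
    have hi : Integrable (b N) m := ((hb N).1.continuous.integrable_of_hasCompactSupport (hb N).2).re
    rw [integral_complex_ofReal, Complex.ofReal_eq_zero,
      integral_eq_zero_iff_of_nonneg (hb0 N) hi] at h1
    exact h1
  refine measure_mono_null (fun p hp => ?_) (measure_iUnion_null hnull)
  obtain ⟨x, ξ, η⟩ := p
  obtain ⟨⟨h1, h2⟩, h3⟩ := hp
  lift η to ℝ using ⟨h2, h1⟩
  obtain ⟨N₁, hN₁⟩ := exists_nat_ge (max ‖ξ‖ |η|)
  obtain ⟨N₂, hN₂⟩ := exists_nat_one_div_lt (abs_pos.2 h3)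
  refine mem_iUnion.2 ⟨max N₁ N₂, hb1 _ x ξ η ?_ ?_ ?_⟩
  · exact (le_max_left _ _).trans (hN₁.trans (by exact_mod_cast le_max_left _ _))
  · exact (le_max_right _ _).trans (hN₁.trans (by exact_mod_cast le_max_left _ _))
  · refine le_trans ?_ hN₂.le
    refine one_div_le_one_div_of_le (by positivity) ?_
    have : (N₂ : ℝ) ≤ (max N₁ N₂ : ℕ) := by exact_mod_cast le_max_right _ _
    linarith

/-- Multiplication by a cutoff in `η` stays within the test functions and commutes with `ξ·∂ₓ`. As
`N` grows, the cutoffs converge pointwise to the indicator of finite `η`, since they vanish at `±∞`;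
dominated convergence concludes. -/
lemma integral_finitePart_geodesicDeriv
    (h : ∀ a : testFunctions, ∫ p, geodesicDeriv (a : Phase → ℂ) p ∂m = 0) (a : testFunctions) :
    ∫ p, geodesicDeriv (a : Phase → ℂ) p ∂(finitePart m) = 0 := by
  choose k hk1 hktop hkbot hk0 hkle hkR hks using exists_eta_cutoff
  have hg := geodesicDeriv_mem a.2
  have hgi : Integrable (geodesicDeriv (a : Phase → ℂ)) m :=
    hg.1.continuous.integrable_of_hasCompactSupport hg.2
  have hz : ∀ N, ∫ p, geodesicDeriv (a : Phase → ℂ) p * (k N p.2.2 : ℂ) ∂m = 0 := fun N => by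
    have := h ⟨fun p => (a : Phase → ℂ) p * (k N p.2.2 : ℂ), mul_mem a.2 (hks N)⟩
    simpa only [geodesicDeriv_mul_eta _ fun η => (k N η : ℂ)] using this
  have hlim : Tendsto (fun N => ∫ p, geodesicDeriv (a : Phase → ℂ) p * (k N p.2.2 : ℂ) ∂m) atTop
      (𝓝 (∫ p, {p : Phase | p.2.2 ≠ ⊥ ∧ p.2.2 ≠ ⊤}.indicator (geodesicDeriv (a : Phase → ℂ)) p ∂m)) := by
    refine tendsto_integral_of_dominated_convergence (fun p => ‖geodesicDeriv (a : Phase → ℂ) p‖)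
      (fun N => (hg.1.continuous.mul (hks N).continuous).aestronglyMeasurable) hgi.norm
      (fun N => Eventually.of_forall fun p => ?_) (Eventually.of_forall fun p => ?_)
    · rw [norm_mul, Complex.norm_real, Real.norm_of_nonneg (hk0 N _)]
      exact mul_le_of_le_one_right (norm_nonneg _) (hkle N _)
    · obtain ⟨x, ξ, η⟩ := p
      induction η with
      | coe η =>
        obtain ⟨N₀, hN₀⟩ := exists_nat_ge |η|
        refine tendsto_const_nhds.congr' ?_
        filter_upwards [eventually_ge_atTop N₀] with N hN
        rw [indicator_of_mem (by simp), hk1 N η (hN₀.trans (by exact_mod_cast hN))]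
        simp
      | top => simp [hktop]
      | bot => simp [hkbot]
  simp only [hz] at hlim
  rw [finitePart, ← integral_indicator measurableSet_finite_eta]
  exact (tendsto_nhds_unique hlim tendsto_const_nhds)

lemma integral_infinitePart_geodesicDeriv
    (h : ∀ a : testFunctions, ∫ p, geodesicDeriv (a : Phase → ℂ) p ∂m = 0) (a : testFunctions) :
    ∫ p, geodesicDeriv (a : Phase → ℂ) p ∂(infinitePart m) = 0 := by
  have hg := geodesicDeriv_mem a.2
  have hgi : Integrable (geodesicDeriv (a : Phase → ℂ)) m :=
    hg.1.continuous.integrable_of_hasCompactSupport hg.2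
  have h1 := h a
  rw [finitePart_add_infinitePart m, integral_add_measure (by exact hgi.restrict) (by exact hgi.restrict),
    integral_finitePart_geodesicDeriv h, zero_add] at h1
  exact h1

lemma measure_le_of_integral_bump_le {χ : ContDiffBump (0 : Plane)} {κ : ℝ}
    (h : ∫ p : Phase, χ p.2.1 ∂m ≤ κ) : m {p | p.2.1 = 0} ≤ ENNReal.ofReal κ := by
  have hc : Continuous fun p : Phase => χ p.2.1 := χ.continuous.comp (by fun_prop)
  have hi : Integrable (fun p : Phase => χ p.2.1) m :=
    ((bump_mem χ).1.continuous.integrable_of_hasCompactSupport (bump_mem χ).2).re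
  have hms : MeasurableSet {p : Phase | p.2.1 = 0} :=
    (isClosed_eq (by fun_prop) continuous_const).measurableSet
  calc m {p | p.2.1 = 0} = ∫⁻ p, {p : Phase | p.2.1 = 0}.indicator 1 p ∂m :=
        (lintegral_indicator_one hms).symm
    _ ≤ ∫⁻ p, ENNReal.ofReal (χ p.2.1) ∂m := by
        refine lintegral_mono fun p => ?_
        by_cases hp : p ∈ {p : Phase | p.2.1 = 0}
        · rw [indicator_of_mem hp, show p.2.1 = 0 from hp,
            χ.one_of_mem_closedBall (Metric.mem_closedBall_self χ.rIn_pos.le)]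
          simp
        · rw [indicator_of_notMem hp]; exact zero_le
    _ = ENNReal.ofReal (∫ p, χ p.2.1 ∂m) :=
        (ofReal_integral_eq_lintegral_ofReal hi (Eventually.of_forall fun p => χ.nonneg)).symm
    _ ≤ _ := ENNReal.ofReal_le_ofReal h

end Measure

namespace SemiclassicalLimit

variable {V : Torus → ℝ} {e : Fin 2 → ℤ} {h E T : ℕ → ℝ} {v : ℕ → ℝ → L2}
  {μ : ℝ → testFunctions →ₗ[ℂ] ℂ}

lemma exists_bump (H : SemiclassicalLimit V e h E T v μ) {κ : ℝ} (hκ : 0 < κ) :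
    ∃ χ : ContDiffBump (0 : Plane), ∀ᵐ t, (μ t ⟨_, bump_mem χ⟩).re ≤ κ := by
  obtain ⟨M, hM, hφ⟩ := H.exists_low_frequency_bound hκ
  have hr : 0 < Real.sqrt (2 * M) := Real.sqrt_pos.2 (by positivity)
  let χ : ContDiffBump (0 : Plane) :=
    ⟨Real.sqrt (2 * M) / 2, Real.sqrt (2 * M), by positivity, by linarith⟩
  refine ⟨χ, hφ χ (bump_mem χ) (fun ξ => χ.nonneg) (fun ξ => χ.le_one) fun ξ hξ => ?_⟩
  refine χ.zero_of_le_dist ?_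
  rw [dist_zero_right]
  exact (Real.sqrt_le_left (norm_nonneg ξ)).2 (by linarith)

/-- All properties are first made simultaneous in the test function: the positive, the transported
and the nonresonant functions each satisfy a closed condition on their class. For the mass at `ξ =
0`, a countable family of bumps with bounds `1/(j + 1)` is enough. -/
theorem ae_exists_measure (H : SemiclassicalLimit V e h E T v μ) :
    ∀ᵐ t, ∃ m : Measure Phase, IsFiniteMeasure m ∧ m.Regular ∧
      (∀ a : testFunctions, μ t a = ∫ p, (a : Phase → ℂ) p ∂m) ∧ m {p | p.2.1 = 0} = 0 ∧
      (∀ a : testFunctions, ∫ p, geodesicDeriv (a : Phase → ℂ) p ∂m = 0) ∧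
      ∀ a ∈ nonresonantFunctions e, ∫ p, (a : Phase → ℂ) p ∂m = 0 := by
  choose χ hχ using fun j : ℕ => H.exists_bump (κ := 1 / ((j : ℝ) + 1)) (by positivity)
  obtain ⟨C, hC⟩ := H.dual.bounded
  have h1 := H.dual.ae_forall_mem (S := {a | ∀ p, ((a : Phase → ℂ) p).im = 0 ∧
    0 ≤ ((a : Phase → ℂ) p).re}) isClosed_nonneg_complex fun a ha => H.ae_nonneg a ha
  have h2 := H.dual.ae_forall_mem
    (S := range fun a : testFunctions => (⟨_, geodesicDeriv_mem a.2⟩ : testFunctions))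
    (isClosed_singleton (x := (0 : ℂ))) (by
      rintro _ ⟨a, rfl⟩
      exact H.ae_geodesicDeriv a)
  have h3 := H.dual.ae_forall_mem (S := nonresonantFunctions e) (isClosed_singleton (x := (0 : ℂ)))
    (by
      rintro a ⟨δ, hδ, R, ha⟩
      exact H.ae_eq_zero_of_vanishing a hδ ha)
  filter_upwards [h1, h2, h3, hC, ae_all_iff.2 hχ] with t h1 h2 h3 hC hχ
  obtain ⟨m, hm, hmr, hμ⟩ := exists_measure_of_nonneg_of_bounded h1 hC
  refine ⟨m, hm, hmr, hμ, ?_, fun a => ?_, fun a ha => ?_⟩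
  · have hle : ∀ j : ℕ, m {p | p.2.1 = 0} ≤ ENNReal.ofReal (1 / ((j : ℝ) + 1)) := fun j => by
      refine measure_le_of_integral_bump_le (χ := χ j) ?_
      have := hχ j
      rwa [hμ, integral_complex_ofReal, Complex.ofReal_re] at this
    have hlim : Tendsto (fun j : ℕ => ENNReal.ofReal (1 / ((j : ℝ) + 1))) atTop (𝓝 0) := by
      simpa using ENNReal.tendsto_ofReal (tendsto_one_div_add_atTop_nhds_zero_nat (𝕜 := ℝ))
    exact le_antisymm (ge_of_tendsto' hlim hle) zero_le
  · exact (hμ _).symm.trans (h2 _ ⟨a, rfl⟩)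
  · exact (hμ a).symm.trans (h3 a ha)

end SemiclassicalLimit

lemma exists_semiclassicalLimit {V : Torus → ℝ} (hV : SmoothOnTorus fun x => (V x : ℂ))
    {ε τ : ℝ → ℝ} (hε_pos : ∀ᶠ h in 𝓝[>] (0 : ℝ), 0 < ε h) (hε_lim : Tendsto ε (𝓝[>] 0) (𝓝 0))
    (hε_large : Tendsto (fun h => h / ε h) (𝓝[>] 0) (𝓝 0)) (hτ : Tendsto τ (𝓝[>] 0) atTop)
    {e : Fin 2 → ℤ} {μ : ℝ → testFunctions →ₗ[ℂ] ℂ} (hμ : μ ∈ accumulationPoints V e τ ε) :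
    ∃ (h E T : ℕ → ℝ) (v : ℕ → ℝ → L2), SemiclassicalLimit V e h E T v μ := by
  obtain ⟨hd, h, u, v, h0, hlim, hu, -, hstrict, hsol, hconv⟩ := hμ
  have hlim' : Tendsto h atTop (𝓝[>] 0) :=
    tendsto_nhdsWithin_iff.2 ⟨hlim, Eventually.of_forall h0⟩
  have huv : u = fun n => v n 0 := funext fun n => (hsol n).initial.symm
  subst huv
  exact ⟨h, fun n => ε (h n), fun n => τ (h n), v,
    { smooth := hV
      h_pos := h0
      h_lim := hlim
      E_pos := hlim'.eventually hε_pos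
      E_lim := hε_lim.comp hlim'
      ratio_lim := hε_large.comp hlim'
      T_lim := hτ.comp hlim'
      norm_zero := hu
      strict := hstrict
      solution := hsol
      dual := hd
      limit := hconv }⟩

lemma finitePart_nonresonant {Λ : AddSubgroup (Fin 2 → ℤ)} {e : Fin 2 → ℤ}
    (he : AddSubgroup.zmultiples e = Λ) {m : Measure Phase}
    (h : m {p | (p.2.2 ≠ ⊥ ∧ p.2.2 ≠ ⊤) ∧ hamiltonian e p.2.1 ≠ 0} = 0) :
    finitePart m {p | p.2.1 ∉ latticePerp Λ} = 0 := by
  rw [finitePart, Measure.restrict_apply' measurableSet_finite_eta]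
  refine measure_mono_null (fun p hp => ?_) h
  exact ⟨hp.2, fun h0 => hp.1 (mem_latticePerp_of_hamiltonian he h0)⟩

end TwoMicrolocal

end

/-! ### Conclusion. -/

theorem proposition2p1
    (V : TwoMicrolocal.Torus → ℝ)
    (hV : TwoMicrolocal.SmoothOnTorus fun x => (V x : ℂ))
    (ε τ : ℝ → ℝ)
    (hε_pos : ∀ᶠ h in 𝓝[>] (0 : ℝ), 0 < ε h)
    (hε_lim : Tendsto ε (𝓝[>] 0) (𝓝 0))
    (hε_large : Tendsto (fun h => h / ε h) (𝓝[>] 0) (𝓝 0))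
    (hτ : Tendsto τ (𝓝[>] 0) atTop)
    (Λ : AddSubgroup (Fin 2 → ℤ)) (hΛ : TwoMicrolocal.IsPrimitiveRankOne Λ)
    (e : Fin 2 → ℤ) (he : AddSubgroup.zmultiples e = Λ)
    (μ : ℝ → TwoMicrolocal.testFunctions →ₗ[ℂ] ℂ)
    (hμ : μ ∈ TwoMicrolocal.accumulationPoints V e τ ε) :
    ∀ᵐ t : ℝ, ∃ m : Measure TwoMicrolocal.Phase,
      IsFiniteMeasure m ∧ m.Regular ∧
      (∀ a : TwoMicrolocal.testFunctions,
        μ t a = ∫ p, (a : TwoMicrolocal.Phase → ℂ) p ∂m) ∧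
      m {p | p.2.1 = 0} = 0 ∧
      m = TwoMicrolocal.finitePart m + TwoMicrolocal.infinitePart m ∧
      (TwoMicrolocal.finitePart m).support ⊆ {p | p.2.1 ∈ TwoMicrolocal.latticePerp Λ} ∧
      TwoMicrolocal.finitePart m
        {p | ¬ (p.2.1 ∈ TwoMicrolocal.latticePerp Λ ∧ p.2.1 ≠ 0)} = 0 ∧
      ∀ a : TwoMicrolocal.testFunctions,
        (∫ p, TwoMicrolocal.geodesicDeriv (a : TwoMicrolocal.Phase → ℂ) p
          ∂(TwoMicrolocal.finitePart m)) = 0 ∧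
        (∫ p, TwoMicrolocal.geodesicDeriv (a : TwoMicrolocal.Phase → ℂ) p
          ∂(TwoMicrolocal.infinitePart m)) = 0 := by
  obtain ⟨h, E, T, v, H⟩ :=
    TwoMicrolocal.exists_semiclassicalLimit hV hε_pos hε_lim hε_large hτ hμ
  filter_upwards [H.ae_exists_measure] with t ⟨m, hm, hmr, hμm, h0, hgeo, hres⟩
  have hperp := TwoMicrolocal.finitePart_nonresonant he
    (TwoMicrolocal.measure_finite_nonresonant hres)
  refine ⟨m, hm, hmr, hμm, h0, TwoMicrolocal.finitePart_add_infinitePart m, ?_, ?_, fun a =>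
    ⟨TwoMicrolocal.integral_finitePart_geodesicDeriv hgeo a,
      TwoMicrolocal.integral_infinitePart_geodesicDeriv hgeo a⟩⟩
  -- Only `ξ ∈ Λ^⊥` is a closed condition: the null set `{ξ = 0}` may still meet the closed support,
  -- which is why the exclusion of `0` is stated separately, as a null set.
  · refine Measure.support_subset_of_isClosed ?_ (mem_ae_iff.2 hperp)
    exact (TwoMicrolocal.isClosed_latticePerp Λ).preimage
      (f := fun p : TwoMicrolocal.Phase => p.2.1) (by fun_prop)
  · refine measure_mono_null (fun p hp => ?_)
      (measure_union_null hperp (Measure.absolutelyContinuous_of_le Measure.restrict_le_self h0))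
    by_cases h1 : p.2.1 = 0
    · exact Or.inr h1
    · exact Or.inl fun h2 => hp ⟨h2, h1⟩
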